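/- **Conventions.** Let $r\in\mathbb N\cup\{\infty\}$. Graphs are finite; they may have parallel edges, and each edge has an integer length (length $1$ in an ordinary graph). An edge of length $n$ is measured like a path of $n$ unit edges, but the inner points of such a path are not vertices. Lengths of paths and cycles and distances are taken with respect to edge lengths; two parallel edges form a cycle. A graph is *disconnected* if it has at least two components. *Balls.* The ball $B_{r/2}(v)$ consists of all vertices of distance at most $r/2$ from $v$ and of all edges all of whose points have distance at most $r/2$ from $v$. (So, for unit lengths, if $r=2s+1$ it is the subgraph induced by the vertices of distance at most $s$, and if $r=2s$ it is that subgraph without the edges joining two vertices of distance exactly $s$.) A vertex $v$ is an *$r$-local cutvertex* if $B_{r/2}(v)-v$ is disconnected. A connected graph is *$r$-locally 2-connected* if it has no $r$-local cutvertex and has a cycle of length at most $r$; a graph is $r$-locally 2-connected if all its components are. *Explorer-neighbourhoods.* The *core* of $v,w$ is the set of vertices on shortest $v$–$w$ paths. For $b\in\{v,w\}$, label each vertex $u$ of $B_{r/2}(b)$ with the set of shortest paths from the core to $u$ contained in $B_{r/2}(b)$. The *explorer-neighbourhood* $\mathrm{Ex}(v,w)$ is the union of these two labelled balls, where the copies of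 a vertex in the two balls are identified if and only if their labels agree, and the copies of an edge if and only if both its endvertices are identified. A set $\{v,w\}$ with $v\neq w$ is an *$r$-local 2-separator* if $v,w$ have distance at most $r/2$ and $\mathrm{Ex}(v,w)-v-w$ is disconnected. A connected $r$-locally 2-connected graph is *$r$-locally 3-connected* if it has no $r$-local 2-separator and has at least four vertices. *Crossing.* A pair of distinct vertices $a,b$ *crosses* an $r$-local 2-separator $\{v,w\}$ if $a,b$ have copies in different components of $\mathrm{Ex}(v,w)-v-w$ such that some cycle of length at most $r$ in $\mathrm{Ex}(v,w)$ contains both copies and $v$ or $w$. Let $\mathcal N(G)$ be the set of all $r$-local 2-separators of $G$ that are not crossed by any $r$-local 2-separator of $G$. *Cutting.* *$r$-locally cutting* an $r$-local 2-separator $\{v,w\}$ of a graph $G$ means the following. Replace $v$ and $w$ each by one copy (a *slice*) for every component $k$ of $\mathrm{Ex}(v,w)-v-w$; the slice for $k$ of $v$ (or $w$) inherits those edges of $v$ (or $w$) whose other endvertex lies, as seen in $\mathrm{Ex}(v,w)$, in $k$. For each $k$ join its two slices by a *torso edge*, whose length is the minimum length of a $v$–$w$ path in $\mathrm{Ex}(v,w)$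 with $k$ removed. For each edge $e$ of $G$ between $v$ and $w$, add a new component that consists of $e$ and one edge parallel to $e$ whose length is the minimum length of a $v$–$w$ path in $\mathrm{Ex}(v,w)$. A *lift* of a set $\{b_1,b_2\}$ of vertices of $G$ to the resulting graph is a set $\{b_1',b_2'\}$ such that each $b_i'$ is equal to $b_i$ or is a slice of $b_i$, and such that some cycle of length at most $r$ contains $b_1'$ and $b_2'$. When several cuttings are performed in succession, lifts are iterated. To cut $G$ *$r$-locally along* $\mathcal N(G)$ means to choose a linear ordering of $\mathcal N(G)$ and to cut at its members in this order, where after each cutting the remaining members are replaced by lifts. **Theorem.** Let $r\in\mathbb N\cup\{\infty\}$ and let $G$ be a finite simple graph (with unit edge lengths) that is $r$-locally 2-connected. 1. For every linear ordering of $\mathcal N(G)$, the graph $G$ can be cut $r$-locally along $\mathcal N(G)$ in that order (suitable lifts exist, and each is an $r$-local 2-separator when it is cut), and for every graph $G'$ obtained in this way, every component of $G'$ is $r$-locally 3-connected or a cycle of length at most $r$. 2. Let $G''$ be a graph obtained from $G$ by any finite sequence of $r$-local cuttings at $r$-local 2-separators of the current graphs, such that every component of $G''$ is $r$-locally 3-connected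 or a cycle of length at most $r$. Then for every $X\in\mathcal N(G)$, one of the cuttings in this sequence is at $X$ or at a lift of $X$. -/

import Mathlib

universe u

/-- A (multi)graph each of whose edges carries a length. An ordinary graph is the case of unit
lengths (`LenGraph.ofSimple`); cutting produces edges of larger length and pairs of parallel edges.
An edge of length `n` is measured like a path of `n` unit edges, but the inner points of such a
path do not count as vertices. -/
structure LenGraph where
  /-- vertices -/
  V : Type u
  /-- edges -/
  E : Type u
  /-- the two endvertices of an edge -/
  ends : E → Sym2 V
  /-- the length of an edge -/
  len : E → ℕ

namespace LenGraph

/-- An ordinary graph, with unit edge lengths. -/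
def ofSimple {V : Type u} (G : SimpleGraph V) : LenGraph.{u} where
  V := V
  E := G.edgeSet
  ends e := e
  len _ := 1

variable (G : LenGraph.{u})

/-! ### Walks, components, cycles -/

/-- `G.IsWalk x p y`: the list of edges `p` is traversed by a walk from `x` to `y`. -/
inductive IsWalk : G.V → List G.E → G.V → Prop
  | nil (x : G.V) : IsWalk x [] x
  | cons {x y z : G.V} {e : G.E} {p : List G.E} :
      G.ends e = s(x, y) → IsWalk y p z → IsWalk x (e :: p) z

/-- The length of a walk: the sum of the lengths of its edges. -/
def length (p : List G.E) : ℕ := (p.map G.len).sum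

/-- There is a walk of length exactly `n` from `x` to `y`. -/
def HasWalk (x y : G.V) (n : ℕ) : Prop := ∃ p, G.IsWalk x p y ∧ G.length p = n

/-- The underlying simple graph (used for connectedness). -/
def toSimple : SimpleGraph G.V := SimpleGraph.fromRel fun x y => ∃ e, G.ends e = s(x, y)

/-- The subgraph with vertex set `S` and all edges of `F` that have both endvertices in `S`. -/
def sub (S : Set G.V) (F : Set G.E) : LenGraph.{u} where
  V := {x // x ∈ S}
  E := {e // e ∈ F ∧ ∀ x ∈ G.ends e, x ∈ S}
  ends e := (G.ends e.1).attachWith e.2.2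
  len e := G.len e.1

/-- A connected component, as a graph. -/
def component (c : G.toSimple.ConnectedComponent) : LenGraph.{u} := G.sub c.supp Set.univ

/-- `c 0, e 0, c 1, e 1, …, c n, e n` is a cycle with `n + 1` edges (indices modulo `n + 1`).
Two parallel edges form a cycle. -/
def IsCycle (n : ℕ) (c : Fin (n + 1) → G.V) (e : Fin (n + 1) → G.E) : Prop :=
  Function.Injective c ∧ Function.Injective e ∧ ∀ i, G.ends (e i) = s(c i, c (i + 1))

/-- There is a cycle of length at most `r` whose vertex set includes `S`. -/
def HasCycleThrough (r : ℕ∞) (S : Set G.V) : Prop :=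
  ∃ (n : ℕ) (c : Fin (n + 1) → G.V) (e : Fin (n + 1) → G.E), G.IsCycle n c e ∧
    ((∑ i, G.len (e i) : ℕ) : ℕ∞) ≤ r ∧ S ⊆ Set.range c

/-- `G` is a cycle of length at most `r`. -/
def IsCycleGraph (r : ℕ∞) : Prop :=
  ∃ (n : ℕ) (c : Fin (n + 1) → G.V) (e : Fin (n + 1) → G.E), G.IsCycle n c e ∧
    ((∑ i, G.len (e i) : ℕ) : ℕ∞) ≤ r ∧ Function.Surjective c ∧ Function.Surjective e

/-! ### Balls and local cutvertices -/

/-- The vertices of the ball of radius `r / 2` around `v`: those of distance at most `r / 2`. -/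
def ballV (r : ℕ∞) (v : G.V) : Set G.V := {u | ∃ n : ℕ, G.HasWalk v u n ∧ ((2 * n : ℕ) : ℕ∞) ≤ r}

/-- The edges of the ball of radius `r / 2` around `v`: those edges all of whose points have
distance at most `r / 2` from `v`. The point of an edge `xy` of length `l` that is furthest from
`v` has distance `(d(v,x) + d(v,y) + l) / 2`. For unit lengths: if `r = 2 s + 1`, these are all
edges between vertices of distance at most `s`, and if `r = 2 s`, they are all these edges except
for those joining two vertices of distance exactly `s`. -/
def ballE (r : ℕ∞) (v : G.V) : Set G.E :=
  {e | ∃ (x y : G.V) (m n : ℕ), G.ends e = s(x, y) ∧ G.HasWalk v x m ∧ G.HasWalk v y n ∧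
    ((m + n + G.len e : ℕ) : ℕ∞) ≤ r}

theorem self_mem_ballV (r : ℕ∞) (v : G.V) : v ∈ G.ballV r v :=
  ⟨0, ⟨[], IsWalk.nil v, rfl⟩, by simp⟩

/-- The ball of radius `r / 2` around `v` with `v` removed. -/
def puncturedBall (r : ℕ∞) (v : G.V) : LenGraph.{u} :=
  G.sub {u | u ∈ G.ballV r v ∧ u ≠ v} (G.ballE r v)

/-- `v` is an `r`-local cutvertex: the punctured ball is disconnected. -/
def IsLocalCutvertex (r : ℕ∞) (v : G.V) : Prop := ¬ (G.puncturedBall r v).toSimple.Preconnected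

/-- `G` is connected, and it is `r`-locally 2-connected. -/
def ConnLocallyTwoConnected (r : ℕ∞) : Prop :=
  G.toSimple.Connected ∧ (∀ v, ¬ G.IsLocalCutvertex r v) ∧ G.HasCycleThrough r ∅

/-- A graph is `r`-locally 2-connected if all its components are. -/
def LocallyTwoConnected (r : ℕ∞) : Prop := ∀ c, (G.component c).ConnLocallyTwoConnected r

/-! ### Explorer-neighbourhoods and local 2-separators -/

/-- The core: the vertices on shortest paths between `v` and `w`. -/
def core (v w : G.V) : Set G.V :=
  {u | ∃ m n : ℕ, G.HasWalk v u m ∧ G.HasWalk u w n ∧ ∀ k, G.HasWalk v w k → m + n ≤ k}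

/-- The walks from the core of `v` and `w` to `u` that are contained in the ball of radius `r / 2`
around `b`; each is recorded by its first vertex and its list of edges. -/
def ballPaths (r : ℕ∞) (v w b u : G.V) : Set (G.V × List G.E) :=
  {q | q.1 ∈ G.core v w ∧ G.IsWalk q.1 q.2 u ∧ ∀ e ∈ q.2, e ∈ G.ballE r b}

/-- The label of `u` in the ball around `b`: the set of shortest paths from the core to `u`
contained in this ball. -/
def label (r : ℕ∞) (v w b u : G.V) : Set (G.V × List G.E) :=
  {q | q ∈ G.ballPaths r v w b u ∧ ∀ q' ∈ G.ballPaths r v w b u, G.length q.2 ≤ G.length q'.2}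

/-- The vertices of the explorer-neighbourhood: the labelled vertices of the two balls around
`v` and `w`. A vertex of both balls has a single copy if its two labels agree, and two otherwise. -/
def ExplV (r : ℕ∞) (v w : G.V) : Type u :=
  {z : G.V × Set (G.V × List G.E) //
    ∃ b, (b = v ∨ b = w) ∧ z.1 ∈ G.ballV r b ∧ z.2 = G.label r v w b z.1}

/-- The copy in the explorer-neighbourhood of a vertex `u` of the ball around `b ∈ {v, w}`. -/
def copy (r : ℕ∞) (v w : G.V) {b : G.V} (hb : b = v ∨ b = w) (u : {u // u ∈ G.ballV r b}) :
    G.ExplV r v w :=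
  ⟨(u.1, G.label r v w b u.1), b, hb, u.2, rfl⟩

/-- The edges of the explorer-neighbourhood: the edges of the two labelled balls, where the two
copies of an edge are identified if and only if their endvertices are. -/
def ExplE (r : ℕ∞) (v w : G.V) : Type u :=
  {f : G.E × Sym2 (G.ExplV r v w) // ∃ (b : G.V) (hb : b = v ∨ b = w)
    (x y : {u // u ∈ G.ballV r b}), f.1 ∈ G.ballE r b ∧ G.ends f.1 = s(x.1, y.1) ∧
      f.2 = s(G.copy r v w hb x, G.copy r v w hb y)}

/-- The explorer-neighbourhood of parameter `r` with explorers based at `v` and `w`. -/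
def expl (r : ℕ∞) (v w : G.V) : LenGraph.{u} where
  V := G.ExplV r v w
  E := G.ExplE r v w
  ends f := f.1.2
  len f := G.len f.1.1

/-- `side v w false = v` and `side v w true = w`. -/
def side (v w : G.V) (i : Bool) : G.V := cond i w v

theorem side_eq (v w : G.V) (i : Bool) : G.side v w i = v ∨ G.side v w i = w := by
  cases i <;> simp [side]

/-- The vertices `v` (for `false`) and `w` (for `true`) of the explorer-neighbourhood. -/
def base (r : ℕ∞) (v w : G.V) (i : Bool) : (G.expl r v w).V :=
  G.copy r v w (G.side_eq v w i) ⟨G.side v w i, G.self_mem_ballV r _⟩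

/-- The punctured explorer-neighbourhood: the explorer-neighbourhood without `v` and `w`. -/
def puncturedExpl (r : ℕ∞) (v w : G.V) : LenGraph.{u} :=
  (G.expl r v w).sub {z | z ≠ G.base r v w false ∧ z ≠ G.base r v w true} Set.univ

/-- The components of the punctured explorer-neighbourhood. -/
abbrev LocalComp (r : ℕ∞) (v w : G.V) : Type u := (G.puncturedExpl r v w).toSimple.ConnectedComponent

/-- `{v, w}` is an `r`-local 2-separator: `v` and `w` have distance at most `r / 2`, and the
punctured explorer-neighbourhood is disconnected. -/
def IsLocalSep (r : ℕ∞) (v w : G.V) : Prop :=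
  v ≠ w ∧ w ∈ G.ballV r v ∧ ¬ (G.puncturedExpl r v w).toSimple.Preconnected

/-- `G` is connected, and it is `r`-locally 3-connected. -/
def ConnLocallyThreeConnected (r : ℕ∞) : Prop :=
  G.ConnLocallyTwoConnected r ∧ (∀ v w, ¬ G.IsLocalSep r v w) ∧ 4 ≤ ENat.card G.V

/-- The pair `(a, b)` crosses `{v, w}`: it has copies in different components of the punctured
explorer-neighbourhood, and some cycle of the explorer-neighbourhood of length at most `r` contains
these two copies and `v` or `w`. -/
def Crosses (r : ℕ∞) (a b v w : G.V) : Prop :=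
  a ≠ b ∧ ∃ a' b' : (G.puncturedExpl r v w).V, a'.1.1.1 = a ∧ b'.1.1.1 = b ∧
    ¬ (G.puncturedExpl r v w).toSimple.Reachable a' b' ∧
    ∃ i, (G.expl r v w).HasCycleThrough r {a'.1, b'.1, G.base r v w i}

/-- The set of all `r`-local 2-separators that are not crossed by any `r`-local 2-separator. -/
def uncrossed (r : ℕ∞) : Set (Sym2 G.V) :=
  {X | ∃ v w, X = s(v, w) ∧ G.IsLocalSep r v w ∧
    ∀ a b, G.IsLocalSep r a b → ¬ G.Crosses r a b v w}

/-! ### Local cutting -/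

/-- The vertices after `r`-locally cutting `{v, w}`: the other vertices; the slices of `v`
(for `false`) and `w` (for `true`), one for each local component; and two new vertices for the
artificial component of an edge between `v` and `w`. -/
inductive CutV (r : ℕ∞) (v w : G.V) : Type u
  | old (x : G.V) (hx : x ≠ v ∧ x ≠ w)
  | slice (k : G.LocalComp r v w) (i : Bool)
  | art (e : G.E) (he : G.ends e = s(v, w)) (i : Bool)

/-- The slice for `k` of `v` (for `false`) or `w` (for `true`) inherits the edge `e`: in the
explorer-neighbourhood, `e` joins that vertex to a vertex of `k`. -/
def Inherits (r : ℕ∞) (v w : G.V) (e : G.E) (i : Bool) (k : G.LocalComp r v w) : Prop :=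
  ∃ (f : G.ExplE r v w) (z : (G.puncturedExpl r v w).V), f.1.1 = e ∧
    f.1.2 = s(G.base r v w i, z.1) ∧ (G.puncturedExpl r v w).toSimple.connectedComponentMk z = k

/-- The edges after `r`-locally cutting `{v, w}`: the edges avoiding `v` and `w`; the edges
inherited by slices; a torso edge for each local component; and, for each edge between `v` and `w`,
this edge and the torso edge parallel to it. -/
inductive CutE (r : ℕ∞) (v w : G.V) : Type u
  | old (e : G.E) (he : ∀ x ∈ G.ends e, x ≠ v ∧ x ≠ w)
  | inherited (e : G.E) (i : Bool) (y : G.V) (hy : y ≠ v ∧ y ≠ w)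
      (he : G.ends e = s(G.side v w i, y)) (k : G.LocalComp r v w) (hk : G.Inherits r v w e i k)
  | torso (k : G.LocalComp r v w)
  | artOld (e : G.E) (he : G.ends e = s(v, w))
  | artTorso (e : G.E) (he : G.ends e = s(v, w))

/-- The endvertices of the edges after cutting. -/
def cutEnds (r : ℕ∞) (v w : G.V) : G.CutE r v w → Sym2 (G.CutV r v w)
  | .old e he => ((G.ends e).attachWith (P := fun x => x ≠ v ∧ x ≠ w) he).map
      fun x => .old x.1 x.2
  | .inherited _ i y hy _ k _ => s(.slice k i, .old y hy)
  | .torso k => s(.slice k false, .slice k true)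
  | .artOld e he => s(.art e he false, .art e he true)
  | .artTorso e he => s(.art e he false, .art e he true)

/-- The length of the torso edge for `k`: the minimum length of a path between `v` and `w` in the
explorer-neighbourhood with the component `k` removed. -/
noncomputable def torsoLen (r : ℕ∞) (v w : G.V) (k : G.LocalComp r v w) : ℕ :=
  sInf {n | ∃ p, (G.expl r v w).IsWalk (G.base r v w false) p (G.base r v w true) ∧
    (G.expl r v w).length p = n ∧ ∀ f ∈ p, ∀ z : (G.puncturedExpl r v w).V,
      z.1 ∈ (G.expl r v w).ends f → (G.puncturedExpl r v w).toSimple.connectedComponentMk z ≠ k}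

/-- The lengths of the edges after cutting. The torso edge of an artificial component has as its
length the minimum length of a path between `v` and `w` in the explorer-neighbourhood. -/
noncomputable def cutLen (r : ℕ∞) (v w : G.V) : G.CutE r v w → ℕ
  | .old e _ => G.len e
  | .inherited e _ _ _ _ _ _ => G.len e
  | .torso k => G.torsoLen r v w k
  | .artOld e _ => G.len e
  | .artTorso _ _ => sInf {n | (G.expl r v w).HasWalk (G.base r v w false) (G.base r v w true) n}

/-- The graph obtained from `G` by `r`-locally cutting `{v, w}`. -/
noncomputable def cut (r : ℕ∞) (v w : G.V) : LenGraph.{u} where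
  V := G.CutV r v w
  E := G.CutE r v w
  ends := G.cutEnds r v w
  len := G.cutLen r v w

/-- `G.Over r v w x' x`: the vertex `x'` of the graph obtained by cutting `{v, w}` is equal to the
vertex `x` of `G`, or it is a slice of `x`. -/
def Over (r : ℕ∞) (v w : G.V) : (G.cut r v w).V → G.V → Prop
  | .old y _, x => y = x
  | .slice _ i, x => G.side v w i = x
  | .art _ _ _, _ => False

/-- `Y` is a lift of `X` to the graph obtained by cutting `{v, w}`: a set of two vertices that are
equal to the vertices of `X` or slices thereof, and that lie on a common cycle of length at
most `r`. -/
def IsLift (r : ℕ∞) (v w : G.V) (X : Sym2 G.V) (Y : Sym2 (G.cut r v w).V) : Prop :=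
  ∃ (a b : G.V) (a' b' : (G.cut r v w).V), X = s(a, b) ∧ Y = s(a', b') ∧
    G.Over r v w a' a ∧ G.Over r v w b' b ∧ (G.cut r v w).HasCycleThrough r {a', b'}

/-- `CutsAlong r G L H`: the graph `H` is obtained from `G` by `r`-locally cutting the members of
the list `L`, in this order; after each cutting, the remaining members are replaced by lifts, and
each one has to be an `r`-local 2-separator when it is cut. -/
inductive CutsAlong (r : ℕ∞) : (G : LenGraph.{u}) → List (Sym2 G.V) → LenGraph.{u} → Prop
  | nil (G : LenGraph.{u}) : CutsAlong r G [] G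
  | cons {G H : LenGraph.{u}} {v w : G.V} {L : List (Sym2 G.V)}
      {L' : List (Sym2 (G.cut r v w).V)} :
      G.IsLocalSep r v w → List.Forall₂ (G.IsLift r v w) L L' →
      CutsAlong r (G.cut r v w) L' H → CutsAlong r G (s(v, w) :: L) H

/-- A finite sequence of `r`-local cuttings leading from one graph to another. -/
inductive CutSeq (r : ℕ∞) : LenGraph.{u} → LenGraph.{u} → Type (u + 1)
  | nil (G : LenGraph.{u}) : CutSeq r G G
  | cons {G H : LenGraph.{u}} (v w : G.V) (h : G.IsLocalSep r v w)
      (S : CutSeq r (G.cut r v w) H) : CutSeq r G H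

/-- The sequence cuts at `X` or at one of its (iterated) lifts. -/
def CutSeq.CutsAt {r : ℕ∞} : {G H : LenGraph.{u}} → CutSeq r G H → Sym2 G.V → Prop
  | _, _, .nil _, _ => False
  | G, _, .cons v w _ S, X => X = s(v, w) ∨ ∃ Y, G.IsLift r v w X Y ∧ S.CutsAt Y

/-- Every component is `r`-locally 3-connected or a cycle of length at most `r`. -/
def BasicComponents (r : ℕ∞) : Prop :=
  ∀ c, (G.component c).ConnLocallyThreeConnected r ∨ (G.component c).IsCycleGraph r

end LenGraph

/-! Local separators are translated into integer cochains, that is, antisymmetric functions on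
oriented edges (darts). For an edge set `A`, the cochain `g v A` is 1 on leaving `v` through `A` and
-1 on entering `v` through `A`. The topology is that of closed walks of length at most `r`: a
cochain vanishing on all of them (`Van`) has a potential on every ball of radius `r/2`. A local
cutvertex is a vertex `v` with a set `A` of some but not all edges at `v` such that `Van r (g v A)`.
A local 2-separator is a pair `{v, w}` with sets `A`, `B` such that `chi = g v A + g w B` vanishes
on short closed walks, `v` and `w` have the same potential, and edges leave the pair on both sides
(`isLocalSep_iff`). Local components correspond to the finest such splittings (`bal_K`,
`Bal.const_on_K`), so the explorer-neighbourhood can be forgotten after this translation.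

If two separators cross, their four vertices alternate on a short cycle (`cross_cycle`), so crossing
is symmetric. Multiplying the two potentials gives a linear relation between the four cut cochains
(`product_van`). Since there are no local cutvertices, it forces the cut cochains of the two
separators to agree up to sign on short closed walks (`SCross.van`), and it makes crossing
independent of the chosen separation (`SCross.ne_zero`). If every separator is crossed, all vertices
with one common cut cochain lie on one short cycle. Two consecutive ones cannot form a separator, as
a pair crossing it would have to lie on the remaining arc of that cycle. Hence they are joined by an
edge, and a component with a separator is a cycle (`cuts_next`, `exists_ring`). A component without
separators is locally 3-connected, or has fewer than four vertices and is again a cycle.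

Cutting preserves all hypotheses (`Good.cut`). Walks of the cut graph descend by replacing torso
edges with walks of the same length (`push`); short cycles of the original graph either lift or
split into two arcs that are edges or close up through torso edges (`lift_cyc`). It follows that the
separators of the cut graph are lifts of the separators that neither equal nor cross the cut one
(`down_LS`, `exists_near_lift`, `lift_LS`), with the crossing relation unchanged (`scross_up`,
`scross_down`).

For the first statement, cutting at an uncrossed separator therefore removes exactly this member
from the set of uncrossed separators. After the last cutting every separator is crossed, so all
components are basic. For the second, an uncrossed separator stays uncrossed under cutting any other
local separator, whereas every separator of a graph with basic components is crossed, so it has to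
be cut at some point. -/

namespace LenGraph

/-! ### Darts, short closed walks and cochains. -/

/-- An edge traversed in a chosen direction. -/
structure Dart (G : LenGraph.{u}) where
  /-- the start -/
  src : G.V
  /-- the end -/
  tgt : G.V
  /-- the edge -/
  e : G.E
  h : G.ends e = s(src, tgt)

variable {G : LenGraph.{u}} {r : ℕ∞}

/-- The reversed dart. -/
def Dart.symm (d : G.Dart) : G.Dart := ⟨d.tgt, d.src, d.e, by rw [d.h, Sym2.eq_swap]⟩

@[simp] theorem Dart.symm_src (d : G.Dart) : d.symm.src = d.tgt := rfl
@[simp] theorem Dart.symm_tgt (d : G.Dart) : d.symm.tgt = d.src := rfl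
@[simp] theorem Dart.symm_e (d : G.Dart) : d.symm.e = d.e := rfl
@[simp] theorem Dart.symm_symm (d : G.Dart) : d.symm.symm = d := rfl

theorem Dart.ext' {d d' : G.Dart} (h1 : d.src = d'.src) (h2 : d.tgt = d'.tgt) (h3 : d.e = d'.e) :
    d = d' := by
  cases d; cases d'; simp_all

theorem exists_dart (e : G.E) : ∃ d : G.Dart, d.e = e := by
  induction h : G.ends e with
  | _ x y => exact ⟨⟨x, y, e, h⟩, rfl⟩

theorem Dart.eq_or_symm {d d' : G.Dart} (h : d.e = d'.e) : d = d' ∨ d = d'.symm := by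
  have h1 := d.h
  rw [h, d'.h] at h1
  rcases Sym2.eq_iff.1 h1 with ⟨a, b⟩ | ⟨a, b⟩
  · exact .inl (Dart.ext' a.symm b.symm h)
  · exact .inr (Dart.ext' b.symm a.symm h)

/-- `Wk x p y`: the list of darts `p` is a walk from `x` to `y`. -/
def Wk : G.V → List G.Dart → G.V → Prop
  | x, [], y => x = y
  | x, d :: p, y => d.src = x ∧ Wk d.tgt p y

@[simp] theorem wk_nil {x y : G.V} : Wk x [] y ↔ x = y := Iff.rfl
@[simp] theorem wk_cons {x y : G.V} {d : G.Dart} {p : List G.Dart} :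
    Wk x (d :: p) y ↔ d.src = x ∧ Wk d.tgt p y := Iff.rfl

theorem wk_append {x y : G.V} {p q : List G.Dart} :
    Wk x (p ++ q) y ↔ ∃ z, Wk x p z ∧ Wk z q y := by
  induction p generalizing x with
  | nil => simp
  | cons d p ih => simp [ih, and_assoc]

theorem Wk.append {x y z : G.V} {p q : List G.Dart} (h : Wk x p y) (h' : Wk y q z) :
    Wk x (p ++ q) z := wk_append.2 ⟨y, h, h'⟩

theorem wk_split {x y : G.V} {p q : List G.Dart} {d : G.Dart} :
    Wk x (p ++ d :: q) y ↔ Wk x p d.src ∧ Wk d.tgt q y := by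
  rw [wk_append]
  constructor
  · rintro ⟨z, h1, rfl, h2⟩; exact ⟨h1, h2⟩
  · rintro ⟨h1, h2⟩; exact ⟨_, h1, rfl, h2⟩

theorem Wk.tgt_eq {x y z : G.V} {p : List G.Dart} (h : Wk x p y) (h' : Wk x p z) : y = z := by
  induction p generalizing x with
  | nil => exact h.symm.trans h'
  | cons d p ih => exact ih h.2 h'.2

/-- The reversed walk. -/
def rev (p : List G.Dart) : List G.Dart := (p.map Dart.symm).reverse

theorem Wk.rev {x y : G.V} {p : List G.Dart} (h : Wk x p y) : Wk y (rev p) x := by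
  induction p generalizing x with
  | nil => exact Eq.symm h
  | cons d p ih =>
    have := ih h.2
    simp only [LenGraph.rev, List.map_cons, List.reverse_cons] at this ⊢
    exact this.append ⟨rfl, h.1⟩

/-- The length of a walk. -/
def plen (p : List G.Dart) : ℕ := (p.map fun d => G.len d.e).sum

@[simp] theorem plen_nil : plen ([] : List G.Dart) = 0 := rfl
@[simp] theorem plen_cons (d : G.Dart) (p : List G.Dart) : plen (d :: p) = G.len d.e + plen p := by
  simp [plen]
@[simp] theorem plen_append (p q : List G.Dart) : plen (p ++ q) = plen p + plen q := by
  simp [plen]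
@[simp] theorem plen_rev (p : List G.Dart) : plen (rev p) = plen p := by
  simp only [plen, rev, List.map_reverse, List.map_map, List.sum_reverse]; rfl

/-- The sum of a cochain along a walk. -/
def csum (c : G.Dart → ℤ) (p : List G.Dart) : ℤ := (p.map c).sum

@[simp] theorem csum_nil (c : G.Dart → ℤ) : csum c [] = 0 := rfl
@[simp] theorem csum_cons (c : G.Dart → ℤ) (d : G.Dart) (p : List G.Dart) :
    csum c (d :: p) = c d + csum c p := by simp [csum]
@[simp] theorem csum_append (c : G.Dart → ℤ) (p q : List G.Dart) :
    csum c (p ++ q) = csum c p + csum c q := by simp [csum]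

/-- Cochains are antisymmetric functions on darts. -/
def Anti (c : G.Dart → ℤ) : Prop := ∀ d, c d.symm = - c d

theorem csum_rev {c : G.Dart → ℤ} (hc : Anti c) (p : List G.Dart) :
    csum c (rev p) = - csum c p := by
  induction p with
  | nil => simp [rev]
  | cons d p ih =>
    have : rev (d :: p) = rev p ++ [d.symm] := by simp [rev]
    rw [this]; simp [ih, hc d]

theorem csum_eq_zero {c : G.Dart → ℤ} {p : List G.Dart} (h : ∀ d ∈ p, c d = 0) :
    csum c p = 0 := by
  induction p with
  | nil => rfl
  | cons d p ih => simp [h d, ih fun d' hd' => h d' (List.mem_cons_of_mem _ hd')]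

theorem csum_congr {c c' : G.Dart → ℤ} {p : List G.Dart} (h : ∀ d ∈ p, c d = c' d) :
    csum c p = csum c' p := by
  unfold csum; rw [List.map_congr_left h]

theorem csum_add (c c' : G.Dart → ℤ) (p : List G.Dart) :
    csum (fun d => c d + c' d) p = csum c p + csum c' p := by
  induction p with
  | nil => rfl
  | cons d p ih => simp [ih]; ring

theorem csum_sub (c c' : G.Dart → ℤ) (p : List G.Dart) :
    csum (fun d => c d - c' d) p = csum c p - csum c' p := by
  induction p with
  | nil => rfl
  | cons d p ih => simp [ih]; ring

/-- Summing the increments of a vertex potential along a walk. -/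
theorem csum_potential {c : G.Dart → ℤ} (F : G.V → ℤ) {x y : G.V} {p : List G.Dart}
    (hp : Wk x p y) (h : ∀ d ∈ p, c d = F d.tgt - F d.src) : csum c p = F y - F x := by
  induction p generalizing x with
  | nil => cases hp; simp
  | cons d p ih =>
    obtain ⟨rfl, hp⟩ := hp
    rw [csum_cons, ih hp fun d' hd' => h d' (List.mem_cons_of_mem _ hd'), h d (by simp)]
    ring

/-- Summing the increments of a function of prefixes along a walk. -/
theorem csum_telescope {c : G.Dart → ℤ} (F : List G.Dart → ℤ) (l : List G.Dart)
    (h : ∀ p d q, l = p ++ d :: q → c d = F (p ++ [d]) - F p) : csum c l = F l - F [] := by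
  induction l using List.reverseRecOn with
  | nil => simp
  | append_singleton l a ih =>
    rw [csum_append, ih, csum_cons, csum_nil, h l a [] rfl]
    · ring
    · intro p d q hpq
      exact h p d (q ++ [a]) (by simp [hpq])

/-- A walk that is part of a closed walk of length at most `r`. -/
def SW (r : ℕ∞) (x : G.V) (p : List G.Dart) (y : G.V) : Prop :=
  Wk x p y ∧ ∃ q, Wk y q x ∧ ((plen p + plen q : ℕ) : ℕ∞) ≤ r

theorem le_trans_cast {a b : ℕ} (h : (b : ℕ∞) ≤ r) (hab : a ≤ b) : (a : ℕ∞) ≤ r :=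
  le_trans (by exact_mod_cast hab) h

theorem SW.symm {x y : G.V} {p : List G.Dart} (h : SW r x p y) : SW r y (rev p) x := by
  obtain ⟨h1, q, h2, h3⟩ := h
  exact ⟨h1.rev, rev q, h2.rev, by simpa using h3⟩

theorem SW.closed_le {x : G.V} {p : List G.Dart} (h : SW r x p x) : ((plen p : ℕ) : ℕ∞) ≤ r := by
  obtain ⟨_, q, _, h3⟩ := h
  exact le_trans_cast h3 (by omega)

theorem SW.of_closed {x : G.V} {p : List G.Dart} (h : Wk x p x)
    (hr : ((plen p : ℕ) : ℕ∞) ≤ r) : SW r x p x :=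
  ⟨h, [], rfl, by simpa using hr⟩

theorem SW.exists_close {x y : G.V} {p : List G.Dart} (h : SW r x p y) :
    ∃ q, SW r y q x ∧ SW r x (p ++ q) x := by
  obtain ⟨h1, q, h2, h3⟩ := h
  exact ⟨q, ⟨h2, p, h1, by rwa [add_comm]⟩, SW.of_closed (h1.append h2) (by simpa using h3)⟩

theorem SW.left {x y z : G.V} {p q : List G.Dart} (h : SW r x (p ++ q) y) (hp : Wk x p z) :
    SW r x p z := by
  obtain ⟨h1, q', h2, h3⟩ := h
  obtain ⟨z', h4, h5⟩ := wk_append.1 h1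
  obtain rfl := h4.tgt_eq hp
  exact ⟨hp, q ++ q', h5.append h2, by simpa [add_assoc] using h3⟩

theorem SW.right {x y z : G.V} {p q : List G.Dart} (h : SW r x (p ++ q) y) (hp : Wk z q y)
    (hx : Wk x p z) : SW r z q y := by
  obtain ⟨h1, q', h2, h3⟩ := h
  exact ⟨hp, q' ++ p, h2.append hx, by
    rw [plen_append] at h3 ⊢; exact le_trans_cast h3 (by omega)⟩

theorem SW.split {x y : G.V} {p q : List G.Dart} (h : SW r x (p ++ q) y) :
    ∃ z, SW r x p z ∧ SW r z q y := by
  obtain ⟨z, h1, h2⟩ := wk_append.1 h.1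
  exact ⟨z, h.left h1, h.right h2 h1⟩

theorem SW.prefix {x y : G.V} {p q : List G.Dart} {d : G.Dart} (h : SW r x (p ++ d :: q) y) :
    SW r x p d.src ∧ SW r x (p ++ [d]) d.tgt ∧ SW r d.src [d] d.tgt ∧ SW r d.tgt q y := by
  obtain ⟨h1, h2⟩ := wk_split.1 h.1
  have h3 : Wk x (p ++ [d]) d.tgt := wk_split.2 ⟨h1, rfl⟩
  have h4 : SW r x ((p ++ [d]) ++ q) y := by simpa using h
  exact ⟨h.left h1, h4.left h3, (h4.left h3).right ⟨rfl, rfl⟩ h1, h4.right h2 h3⟩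

theorem SW.nil (x : G.V) : SW r x [] x := ⟨rfl, [], rfl, by simp⟩

/-- Shortest walks exist. -/
theorem exists_geodesic {x y : G.V} {p : List G.Dart} (h : Wk x p y) :
    ∃ q, Wk x q y ∧ ∀ q', Wk x q' y → plen q ≤ plen q' := by
  classical
  have hne : ∃ n, ∃ q, Wk x q y ∧ plen q = n := ⟨_, p, h, rfl⟩
  obtain ⟨q, hq, hn⟩ := Nat.find_spec hne
  exact ⟨q, hq, fun q' hq' => hn ▸ Nat.find_min' hne ⟨q', hq', rfl⟩⟩

/-- The cochain vanishes on all closed walks of length at most `r`. -/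
def Van (r : ℕ∞) (c : G.Dart → ℤ) : Prop := ∀ x p, SW r x p x → csum c p = 0

/-- Two walks between the same vertices which both close up to short closed walks have the same
sum, although their union need not be short. -/
theorem Van.eq {c : G.Dart → ℤ} (hc : Anti c) (h : Van r c) {x y : G.V} {p q : List G.Dart}
    (hp : SW r x p y) (hq : SW r x q y) : csum c p = csum c q := by
  -- Both walks are compared with one geodesic `D`. It is no longer than the walk closing up `p`, so
  -- `p` followed by the reverse of `D` is a closed walk of length at most `r`; `p` followed by the
  -- reverse of `q` may be too long.
  obtain ⟨D, hD, hmin⟩ := exists_geodesic hp.1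
  have key : ∀ p, SW r x p y → csum c p = csum c D := by
    rintro p ⟨h1, q, h2, h3⟩
    have h4 := hmin _ h2.rev
    rw [plen_rev] at h4
    have := h x (p ++ rev D) (SW.of_closed (h1.append hD.rev) (by
      rw [plen_append, plen_rev]; exact le_trans_cast h3 (by omega)))
    rw [csum_append, csum_rev hc] at this
    omega
  rw [key p hp, key q hq]

open Classical in
/-- The cochain counting the passages from `v` into the edges of `A`. -/
noncomputable def g (v : G.V) (A : Set G.E) (d : G.Dart) : ℤ :=
  (if d.src = v ∧ d.e ∈ A then 1 else 0) - (if d.tgt = v ∧ d.e ∈ A then 1 else 0)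

theorem g_anti (v : G.V) (A : Set G.E) : Anti (g v A) := fun d => by
  simp only [g, Dart.symm_src, Dart.symm_tgt, Dart.symm_e, neg_sub]; rfl

theorem g_of_ne {v : G.V} {A : Set G.E} {d : G.Dart} (h1 : d.src ≠ v) (h2 : d.tgt ≠ v) :
    g v A d = 0 := by simp [g, h1, h2]

theorem g_of_notMem {v : G.V} {A : Set G.E} {d : G.Dart} (h : d.e ∉ A) :
    g v A d = 0 := by simp [g, h]

theorem g_univ {v : G.V} {x y : G.V} {p : List G.Dart} (hp : Wk x p y) [DecidableEq G.V] :
    csum (g v Set.univ) p = (if x = v then 1 else 0) - (if y = v then 1 else 0) := by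
  rw [csum_potential (fun z => - if z = v then 1 else 0) hp]
  · ring
  · intro d _; simp only [g, Set.mem_univ, and_true]; rw [sub_neg_eq_add, add_comm]; congr

theorem g_compl (v : G.V) (A : Set G.E) (d : G.Dart) : g v Aᶜ d = g v Set.univ d - g v A d := by
  simp only [g, Set.mem_compl_iff, Set.mem_univ, and_true]
  by_cases h1 : d.src = v <;> by_cases h2 : d.tgt = v <;> by_cases h3 : d.e ∈ A <;> simp [h1, h2, h3]

theorem csum_g_compl (v : G.V) (A : Set G.E) (p : List G.Dart) :
    csum (g v Aᶜ) p = csum (g v Set.univ) p - csum (g v A) p := by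
  rw [← csum_sub]; exact csum_congr fun d _ => g_compl v A d

/-- The cochain of a candidate separation at `{v, w}`. -/
noncomputable def chi (v : G.V) (A : Set G.E) (w : G.V) (B : Set G.E) (d : G.Dart) : ℤ :=
  g v A d + g w B d

theorem chi_anti (v : G.V) (A : Set G.E) (w : G.V) (B : Set G.E) : Anti (chi v A w B) := fun d => by
  simp only [chi, g_anti v A d, g_anti w B d]; ring

theorem csum_chi (v : G.V) (A : Set G.E) (w : G.V) (B : Set G.E) (p : List G.Dart) :
    csum (chi v A w B) p = csum (g v A) p + csum (g w B) p := csum_add _ _ _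

theorem chi_comm (v : G.V) (A : Set G.E) (w : G.V) (B : Set G.E) :
    chi v A w B = chi w B v A := by funext d; simp only [chi]; ring

/-- The edge sets `A` at `v` and `B` at `w` form one side of a local separation at `{v, w}`. -/
def Bal (r : ℕ∞) (v : G.V) (A : Set G.E) (w : G.V) (B : Set G.E) : Prop :=
  Van r (chi v A w B) ∧ ∀ D, SW r v D w → csum (chi v A w B) D = 0

theorem Bal.swap {v w : G.V} {A B : Set G.E} (h : Bal r v A w B) : Bal r w B v A := by
  refine ⟨chi_comm v A w B ▸ h.1, fun D hD => ?_⟩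
  have := h.2 _ hD.symm
  rw [csum_rev (chi_anti _ _ _ _), chi_comm] at this
  omega

/-- The cochain `g v Set.univ` comes from a potential supported at `v`, so it does not see closed
walks. On a walk from `v` to `w` the contributions of the two ends are 1 and -1 and cancel. -/
theorem Bal.compl {v w : G.V} {A B : Set G.E} (hvw : v ≠ w) (h : Bal r v A w B) :
    Bal r v Aᶜ w Bᶜ := by
  classical
  constructor
  · intro x p hp
    have := h.1 x p hp
    rw [csum_chi] at this ⊢
    rw [csum_g_compl, csum_g_compl, g_univ hp.1, g_univ hp.1]; omega
  · intro D hD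
    have := h.2 D hD
    rw [csum_chi] at this ⊢
    rw [csum_g_compl, csum_g_compl, g_univ hD.1, g_univ hD.1]
    simp [hvw, hvw.symm]; omega

/-- The edge set `A` contains some but not all edges at `v`. -/
def Proper (v : G.V) (A : Set G.E) : Prop :=
  (∃ d : G.Dart, d.src = v ∧ d.e ∈ A) ∧ ∃ d : G.Dart, d.src = v ∧ d.e ∉ A

theorem Proper.compl {v : G.V} {A : Set G.E} (h : Proper v A) : Proper v Aᶜ := by
  obtain ⟨⟨d, h1, h2⟩, d', h3, h4⟩ := h
  exact ⟨⟨d', h3, h4⟩, d, h1, fun h => h h2⟩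

/-- `v` and `w` lie on a common closed walk of length at most `r`. -/
def Near (r : ℕ∞) (v w : G.V) : Prop := ∃ p, SW r v p w

theorem Near.symm {v w : G.V} (h : Near r v w) : Near r w v := by
  obtain ⟨p, hp⟩ := h; exact ⟨_, hp.symm⟩

/-- Local 2-separators in terms of cochains. -/
def LS (r : ℕ∞) (v w : G.V) : Prop :=
  v ≠ w ∧ Near r v w ∧ ∃ A B : Set G.E, Bal r v A w B ∧
    (∃ d : G.Dart, (d.src = v ∧ d.tgt ≠ w ∧ d.e ∈ A) ∨ (d.src = w ∧ d.tgt ≠ v ∧ d.e ∈ B)) ∧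
    ∃ d : G.Dart, (d.src = v ∧ d.tgt ≠ w ∧ d.e ∉ A) ∨ (d.src = w ∧ d.tgt ≠ v ∧ d.e ∉ B)

theorem LS.symm {v w : G.V} (h : LS r v w) : LS r w v := by
  obtain ⟨h1, h2, A, B, h3, ⟨d, h4⟩, d', h5⟩ := h
  exact ⟨h1.symm, h2.symm, B, A, h3.swap, ⟨d, h4.symm⟩, d', h5.symm⟩

/-- `{a, b}` crosses `{v, w}`, in terms of cochains. -/
def SCross (r : ℕ∞) (v w a b : G.V) : Prop :=
  a ≠ v ∧ a ≠ w ∧ b ≠ v ∧ b ≠ w ∧ ∃ A B : Set G.E, Bal r v A w B ∧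
    ∃ D, SW r a D b ∧ csum (chi v A w B) D ≠ 0

theorem SCross.swap_left {v w a b : G.V} (h : SCross r v w a b) : SCross r w v a b := by
  obtain ⟨h1, h2, h3, h4, A, B, h5, D, h6, h7⟩ := h
  exact ⟨h2, h1, h4, h3, B, A, h5.swap, D, h6, chi_comm v A w B ▸ h7⟩

theorem SCross.swap_right {v w a b : G.V} (h : SCross r v w a b) : SCross r v w b a := by
  obtain ⟨h1, h2, h3, h4, A, B, h5, D, h6, h7⟩ := h
  exact ⟨h3, h4, h1, h2, A, B, h5, _, h6.symm, by rw [csum_rev (chi_anti _ _ _ _)]; exact neg_ne_zero.2 h7⟩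

/-- Connectedness, local 2-connectedness and further properties preserved by local cutting. -/
structure Good (r : ℕ∞) (G : LenGraph.{u}) : Prop where
  finV : Finite G.V
  finE : Finite G.E
  noloop : ∀ d : G.Dart, d.src ≠ d.tgt
  pos : ∀ e, 0 < G.len e
  -- Absence of local cutvertices, in cochain form.
  link : ∀ (v : G.V) (A : Set G.E), Proper v A → ¬ Van r (g v A)
  deg2 : ∀ v : G.V, ∃ d d' : G.Dart, d.src = v ∧ d'.src = v ∧ d.e ≠ d'.e
  -- Two parallel edges exhaust the edges at their ends. This is vacuous in a simple graph and holds
  -- in the artificial components; it lets neighbours on a ring be joined by no additional edge.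
  par : ∀ d d' d'' : G.Dart, d.src = d'.src → d.tgt = d'.tgt → d.e ≠ d'.e → d''.src = d.src →
    d''.e = d.e ∨ d''.e = d'.e

theorem not_nodup_split {α β : Type*} {f : α → β} {l : List α} (h : ¬ (l.map f).Nodup) :
    ∃ p d q d' s, l = p ++ d :: (q ++ d' :: s) ∧ f d = f d' := by
  induction l with
  | nil => simp at h
  | cons a l ih =>
    by_cases h1 : (l.map f).Nodup
    · rw [List.map_cons, List.nodup_cons] at h
      have h2 : f a ∈ l.map f := by by_contra h3; exact h ⟨h3, h1⟩
      obtain ⟨b, hb, hab⟩ := List.mem_map.1 h2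
      obtain ⟨q, s, rfl⟩ := List.append_of_mem hb
      exact ⟨[], a, q, b, s, rfl, hab.symm⟩
    · obtain ⟨p, d, q, d', s, rfl, h2⟩ := ih h1
      exact ⟨a :: p, d, q, d', s, rfl, h2⟩

/-- A simple closed walk of length at most `r`. -/
def Cyc (r : ℕ∞) (x : G.V) (p : List G.Dart) : Prop :=
  SW r x p x ∧ p ≠ [] ∧ (p.map Dart.src).Nodup ∧ (p.map Dart.e).Nodup

/-- A cochain not vanishing on short closed walks does not vanish on some short cycle. -/
theorem exists_cyc {c : G.Dart → ℤ} (hc : Anti c) (h : ¬ Van r c) :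
    ∃ x p, Cyc r x p ∧ csum c p ≠ 0 := by
  have key : ∀ n, ∀ (x : G.V) (p : List G.Dart), p.length = n → SW r x p x → csum c p ≠ 0 →
      ∃ x p, Cyc r x p ∧ csum c p ≠ 0 := by
    intro n
    induction n using Nat.strong_induction_on with
    | _ n ih =>
    intro x p hn hp hcp
    by_cases h1 : (p.map Dart.src).Nodup
    · by_cases h2 : (p.map Dart.e).Nodup
      · exact ⟨x, p, ⟨hp, by rintro rfl; exact hcp rfl, h1, h2⟩, hcp⟩
      -- Distinct sources together with a repeated edge leave only the walk `d, d.symm`, whose sum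
      -- is zero.
      · exfalso
        obtain ⟨p1, d, p2, d', p3, rfl, he⟩ := not_nodup_split h2
        have hw := hp.1
        rw [wk_split, wk_split] at hw
        obtain ⟨w1, w2, w3⟩ := hw
        simp only [List.map_append, List.map_cons] at h1
        rcases Dart.eq_or_symm he with rfl | rfl
        · rw [List.nodup_append] at h1
          have := h1.2.1
          simp at this
        · cases p2 with
          | cons b p2 =>
            have := w2.1
            rw [List.nodup_append] at h1
            have := h1.2.1
            simp at this
            exact this.2.1.2.1 ‹b.src = d'.symm.tgt›
          | nil =>
            cases p3 with
            | cons b p3 =>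
              have := w3.1
              rw [List.nodup_append] at h1
              have := h1.2.1
              simp at this
              exact this.1.2.1 (by simp_all)
            | nil =>
              cases p1 with
              | cons b p1 =>
                have h3 : b.src = d'.symm.src := w1.1.trans (by simpa using w3.symm)
                simp at h1
                exact h1.1.2.1 h3
              | nil => apply hcp; simp [hc d']
    · obtain ⟨p1, d, p2, d', p3, rfl, he⟩ := not_nodup_split h1
      have hw := hp.1
      rw [wk_split, wk_split] at hw
      obtain ⟨w1, w2, w3⟩ := hw
      have hl := hp.closed_le
      -- A repeated vertex splits the closed walk into two closed walks with fewer darts; the sums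
      -- add up, so one of them is nonzero.
      have e1 : SW r d.src (d :: p2) d.src := SW.of_closed ⟨rfl, he ▸ w2⟩
        (le_trans_cast hl (by simp; omega))
      have e2 : SW r x (p1 ++ d' :: p3) x := SW.of_closed (wk_split.2 ⟨he ▸ w1, w3⟩)
        (le_trans_cast hl (by simp; omega))
      by_cases h4 : csum c (d :: p2) = 0
      · refine ih _ ?_ x _ rfl e2 ?_
        · simp at hn ⊢; omega
        · simp at h4 hcp ⊢; omega
      · refine ih _ ?_ _ _ rfl e1 h4
        simp at hn ⊢; omega
  simp only [Van, not_forall] at h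
  obtain ⟨x, p, hp, hcp⟩ := h
  exact key _ x p rfl hp hcp

/-- Rotating a short cycle. -/
theorem Cyc.rotate {x : G.V} {p q : List G.Dart} {d : G.Dart} (h : Cyc r x (p ++ d :: q)) :
    Cyc r d.src (d :: q ++ p) := by
  obtain ⟨h1, h2, h3, h4⟩ := h
  obtain ⟨w1, w2⟩ := wk_split.1 h1.1
  refine ⟨SW.of_closed (Wk.append ⟨rfl, w2⟩ w1) (le_trans_cast h1.closed_le (by simp; omega)),
    by simp, ?_, ?_⟩
  · rw [List.map_append] at h3 ⊢; exact List.nodup_append_comm.1 h3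
  · rw [List.map_append] at h4 ⊢; exact List.nodup_append_comm.1 h4

theorem Cyc.rotate_to {x : G.V} {p : List G.Dart} (h : Cyc r x p) {d : G.Dart} (hd : d ∈ p) :
    ∃ q, Cyc r d.src (d :: q) ∧ (d :: q).Perm p := by
  obtain ⟨p1, p2, rfl⟩ := List.append_of_mem hd
  exact ⟨p2 ++ p1, h.rotate, by
    have := (List.perm_append_comm : (p1 ++ d :: p2).Perm (d :: p2 ++ p1)); exact this.symm⟩

theorem csum_perm (c : G.Dart → ℤ) {p q : List G.Dart} (h : p.Perm q) : csum c p = csum c q :=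
  (h.map c).sum_eq

/-- A walk with a nonzero sum of `g v A` visits `v`. -/
theorem exists_mem_of_csum_g_ne {v : G.V} {A : Set G.E} {p : List G.Dart}
    (h : csum (g v A) p ≠ 0) : ∃ d ∈ p, d.src = v ∨ d.tgt = v := by
  by_contra hcon
  push Not at hcon
  exact h (csum_eq_zero fun d hd => g_of_ne (hcon d hd).1 (hcon d hd).2)

theorem Wk.exists_src_of_tgt {x y v : G.V} {p : List G.Dart} (h : Wk x p y) {d : G.Dart}
    (hd : d ∈ p) (hv : d.tgt = v) (hy : y ≠ v) : ∃ d ∈ p, d.src = v := by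
  obtain ⟨p1, p2, rfl⟩ := List.append_of_mem hd
  obtain ⟨_, w2⟩ := wk_split.1 h
  cases p2 with
  | nil => exact absurd (w2.symm.trans hv) hy
  | cons b p2 => exact ⟨b, by simp, w2.1.trans hv⟩

theorem Wk.exists_src {x v : G.V} {p : List G.Dart} (h : Wk x p x) {d : G.Dart}
    (hd : d ∈ p) (hv : d.src = v ∨ d.tgt = v) : ∃ d ∈ p, d.src = v := by
  rcases hv with hv | hv
  · exact ⟨d, hd, hv⟩
  · by_cases hx : x = v
    · cases p with
      | nil => simp at hd
      | cons b p => exact ⟨b, by simp, h.1.trans hx⟩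
    · exact h.exists_src_of_tgt hd hv hx

theorem exists_src_of_csum_g_ne {v x : G.V} {A : Set G.E} {p : List G.Dart} (hp : Wk x p x)
    (h : csum (g v A) p ≠ 0) : ∃ d ∈ p, d.src = v := by
  obtain ⟨d, hd, h1⟩ := exists_mem_of_csum_g_ne h
  exact hp.exists_src hd h1

/-- The potential of a separation takes the values `0` and `1` only. -/
theorem Bal.pot01 {v w t : G.V} {A B : Set G.E} (hvw : v ≠ w) (h : Bal r v A w B) {p : List G.Dart}
    (hp : SW r v p t) (hv : t ≠ v) (hw : t ≠ w) :
    csum (chi v A w B) p = 0 ∨ csum (chi v A w B) p = 1 := by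
  induction p using List.reverseRecOn generalizing t with
  | nil => exact absurd hp.1.symm hv
  | append_singleton p d ih =>
    obtain ⟨h1, _⟩ := SW.prefix (q := []) hp
    have ht : d.tgt = t := (wk_split.1 hp.1).2
    rw [csum_append, csum_cons, csum_nil, add_zero]
    -- Going back from the end, the last visit to `v` or `w` decides: the sum up to that visit is
    -- zero by `Bal`, the step leaving the separator adds 0 or 1, and later steps add nothing.
    by_cases h2 : d.src = v
    · have := h.1 v p (h2 ▸ h1)
      rw [this, zero_add]
      simp only [chi, g, h2, ht, hv, hw]; by_cases d.e ∈ A <;> simp_all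
    · by_cases h3 : d.src = w
      · have := h.2 p (h3 ▸ h1)
        rw [this, zero_add]
        have : v ≠ w := fun h => h2 (h3.trans h.symm)
        simp only [chi, g, h3, ht, hv, hw]; by_cases d.e ∈ B <;> simp_all
      · have : chi v A w B d = 0 := by
          simp [chi, g, h2, h3, ht, hv, hw]
        rw [this, add_zero]
        exact ih h1 h2 h3

end LenGraph

namespace LenGraph
variable {G : LenGraph.{u}} {r : ℕ∞}

theorem SW.rotate {x : G.V} {p q : List G.Dart} {d : G.Dart} (h : SW r x (p ++ d :: q) x) :
    SW r d.src (d :: q ++ p) d.src := by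
  obtain ⟨w1, w2⟩ := wk_split.1 h.1
  exact SW.of_closed (Wk.append ⟨rfl, w2⟩ w1) (le_trans_cast h.closed_le (by simp; omega))

/-- A cochain supported at `S` vanishes on short closed walks if it does so on those starting
in `S`. -/
theorem van_of_base {c : G.Dart → ℤ} (S : Set G.V) (h : ∀ x p, x ∈ S → SW r x p x → csum c p = 0)
    (h0 : ∀ d : G.Dart, d.src ∉ S → d.tgt ∉ S → c d = 0) : Van r c := by
  intro x p hp
  by_cases h1 : ∃ d ∈ p, d.src ∈ S ∨ d.tgt ∈ S
  · obtain ⟨d, hd, h2⟩ := h1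
    have : ∃ d ∈ p, d.src ∈ S := by
      rcases h2 with h2 | h2
      · exact ⟨d, hd, h2⟩
      · obtain ⟨d', hd', h3⟩ := hp.1.exists_src hd (.inr rfl)
        exact ⟨d', hd', h3 ▸ h2⟩
    obtain ⟨d, hd, h2⟩ := this
    obtain ⟨p1, p2, rfl⟩ := List.append_of_mem hd
    have := h _ _ h2 hp.rotate
    rw [csum_append] at this ⊢; omega
  · push Not at h1
    exact csum_eq_zero fun d hd => h0 d (h1 d hd).1 (h1 d hd).2

/-! ### Walks given by lists of edges, and balls -/

theorem isWalk_iff {x y : G.V} {q : List G.E} :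
    G.IsWalk x q y ↔ ∃ p : List G.Dart, Wk x p y ∧ p.map Dart.e = q := by
  constructor
  · intro h
    induction h with
    | nil x => exact ⟨[], rfl, rfl⟩
    | @cons x y z e p he _ ih =>
      obtain ⟨p', h1, rfl⟩ := ih
      exact ⟨⟨x, y, e, he⟩ :: p', ⟨rfl, h1⟩, rfl⟩
  · rintro ⟨p, h, rfl⟩
    induction p generalizing x with
    | nil => cases h; exact .nil _
    | cons d p ih => obtain ⟨rfl, h⟩ := h; exact .cons d.h (ih h)

theorem length_map_e (p : List G.Dart) : G.length (p.map Dart.e) = plen p := by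
  simp [length, plen, Function.comp_def]

theorem hasWalk_iff {x y : G.V} {n : ℕ} : G.HasWalk x y n ↔ ∃ p, Wk x p y ∧ plen p = n := by
  constructor
  · rintro ⟨q, h1, h2⟩
    obtain ⟨p, h3, rfl⟩ := isWalk_iff.1 h1
    exact ⟨p, h3, by rw [← h2, length_map_e]⟩
  · rintro ⟨p, h1, h2⟩
    exact ⟨_, isWalk_iff.2 ⟨p, h1, rfl⟩, by rw [length_map_e, h2]⟩

/-- A geodesic between two vertices of a closed walk is at most as long as each of the two arcs, so
twice its length is at most `r`. Conversely, a geodesic is closed up by its own reverse. -/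
theorem near_iff {v u : G.V} :
    Near r v u ↔ ∃ p, Wk v p u ∧ ((2 * plen p : ℕ) : ℕ∞) ≤ r := by
  constructor
  · rintro ⟨p, h1, q, h2, h3⟩
    obtain ⟨D, hD, hm⟩ := exists_geodesic h1
    have := hm _ h1
    have := hm _ h2.rev
    rw [plen_rev] at this
    exact ⟨D, hD, le_trans_cast h3 (by omega)⟩
  · rintro ⟨p, h1, h2⟩
    exact ⟨p, h1, rev p, h1.rev, by rw [plen_rev]; exact le_trans_cast h2 (by omega)⟩

theorem mem_ballV {v u : G.V} : u ∈ G.ballV r v ↔ Near r v u := by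
  rw [near_iff]
  constructor
  · rintro ⟨n, h1, h2⟩
    obtain ⟨p, h3, rfl⟩ := hasWalk_iff.1 h1
    exact ⟨p, h3, h2⟩
  · rintro ⟨p, h1, h2⟩
    exact ⟨_, hasWalk_iff.2 ⟨p, h1, rfl⟩, h2⟩

/-- The furthest point of an edge is within `r/2` of `v` precisely when going out to one end,
crossing the edge and returning from the other end costs at most `r`. -/
theorem mem_ballE {v : G.V} {d : G.Dart} :
    d.e ∈ G.ballE r v ↔ ∃ p q, SW r v (p ++ d :: q) v := by
  constructor
  · rintro ⟨x, y, m, n, h1, h2, h3, h4⟩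
    obtain ⟨p, h5, rfl⟩ := hasWalk_iff.1 h2
    obtain ⟨q, h6, rfl⟩ := hasWalk_iff.1 h3
    rw [d.h] at h1
    rcases Sym2.eq_iff.1 h1 with ⟨rfl, rfl⟩ | ⟨rfl, rfl⟩
    · exact ⟨p, rev q, SW.of_closed (wk_split.2 ⟨h5, h6.rev⟩)
        (le_trans_cast h4 (by simp; omega))⟩
    · exact ⟨q, rev p, SW.of_closed (wk_split.2 ⟨h6, h5.rev⟩)
        (le_trans_cast h4 (by simp; omega))⟩
  · rintro ⟨p, q, h⟩
    obtain ⟨h1, h2⟩ := wk_split.1 h.1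
    exact ⟨d.src, d.tgt, _, _, d.h, hasWalk_iff.2 ⟨p, h1, rfl⟩, hasWalk_iff.2 ⟨_, h2.rev, rfl⟩,
      le_trans_cast h.closed_le (by simp; omega)⟩

theorem SW.mem_ballE_left {v w : G.V} {p : List G.Dart} (h : SW r v p w) {d : G.Dart}
    (hd : d ∈ p) : d.e ∈ G.ballE r v := by
  obtain ⟨p1, p2, rfl⟩ := List.append_of_mem hd
  obtain ⟨q, _, h2⟩ := h.exists_close
  exact mem_ballE.2 ⟨p1, p2 ++ q, by simpa using h2⟩

theorem rev_mem {p : List G.Dart} {d : G.Dart} (hd : d ∈ p) : d.symm ∈ rev p := by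
  simp only [rev, List.mem_reverse, List.mem_map]; exact ⟨d, hd, rfl⟩

open Classical in
/-- The potential of a cochain relative to `v`. -/
noncomputable def pot (r : ℕ∞) (c : G.Dart → ℤ) (v u : G.V) : ℤ :=
  -- By `Van.eq` the chosen walk is immaterial once the cochain vanishes on short closed walks; 0 is
  -- a default value outside the ball.
  if h : Near r v u then csum c h.choose else 0

theorem pot_eq {c : G.Dart → ℤ} (hc : Anti c) (h : Van r c) {v u : G.V} {p : List G.Dart}
    (hp : SW r v p u) : pot r c v u = csum c p := by
  have h1 : Near r v u := ⟨p, hp⟩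
  rw [pot, dif_pos h1]
  exact h.eq hc h1.choose_spec hp

theorem pot_self {c : G.Dart → ℤ} (hc : Anti c) (h : Van r c) (v : G.V) : pot r c v v = 0 :=
  pot_eq hc h (SW.nil v)

theorem pot_step {c : G.Dart → ℤ} (hc : Anti c) (h : Van r c) {v : G.V} {d : G.Dart}
    (hd : d.e ∈ G.ballE r v) : pot r c v d.tgt = pot r c v d.src + c d := by
  obtain ⟨p, q, h1⟩ := mem_ballE.1 hd
  obtain ⟨h2, h3, _⟩ := h1.prefix
  rw [pot_eq hc h h2, pot_eq hc h h3]; simp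

theorem near_of_mem_ballE {v : G.V} {d : G.Dart} (hd : d.e ∈ G.ballE r v) :
    Near r v d.src ∧ Near r v d.tgt := by
  obtain ⟨p, q, h1⟩ := mem_ballE.1 hd
  obtain ⟨h2, h3, _⟩ := h1.prefix
  exact ⟨⟨_, h2⟩, ⟨_, h3⟩⟩

/-- Every edge lies on a short closed walk (in the sense that it can be closed up). -/
def EdgeClose (r : ℕ∞) (G : LenGraph.{u}) : Prop := ∀ d : G.Dart, SW r d.src [d] d.tgt

/-- By `deg2` the set `{d.e}` is proper at `d.src`, so `link` yields a short cycle on which its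
cochain is nonzero; such a cycle traverses the edge. -/
theorem Good.edgeClose (h : Good r G) : EdgeClose r G := by
  intro d
  obtain ⟨d1, d2, h1, h2, h3⟩ := h.deg2 d.src
  have hp : Proper d.src {d.e} := by
    refine ⟨⟨d, rfl, rfl⟩, ?_⟩
    by_cases h4 : d1.e = d.e
    · exact ⟨d2, h2, fun h5 => h3 (h4.trans (Eq.symm h5))⟩
    · exact ⟨d1, h1, h4⟩
  obtain ⟨x, p, hp, hne⟩ := exists_cyc (g_anti _ _) (h.link _ _ hp)
  have : ∃ d' ∈ p, d'.e = d.e := by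
    by_contra hcon
    push Not at hcon
    exact hne (csum_eq_zero fun d' hd' => g_of_notMem (hcon d' hd'))
  obtain ⟨d', hd', he⟩ := this
  obtain ⟨p1, p2, rfl⟩ := List.append_of_mem hd'
  obtain ⟨_, _, h5, _⟩ := hp.1.prefix
  rcases Dart.eq_or_symm he with rfl | rfl
  · exact h5
  · exact h5.symm

theorem EdgeClose.mem_left (h : EdgeClose r G) (d : G.Dart) : d.e ∈ G.ballE r d.src :=
  (h d).mem_ballE_left (List.mem_singleton_self d)

/-! ### Connectedness of subgraphs -/

theorem toSimple_adj {x y : G.V} :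
    G.toSimple.Adj x y ↔ x ≠ y ∧ ∃ d : G.Dart, d.src = x ∧ d.tgt = y := by
  simp only [toSimple, SimpleGraph.fromRel_adj]
  refine and_congr_right fun _ => ⟨?_, ?_⟩
  · rintro (⟨e, he⟩ | ⟨e, he⟩)
    · exact ⟨⟨x, y, e, he⟩, rfl, rfl⟩
    · exact ⟨Dart.symm ⟨y, x, e, he⟩, rfl, rfl⟩
  · rintro ⟨d, rfl, rfl⟩
    exact .inl ⟨d.e, d.h⟩

/-- Darts of a subgraph as darts of the graph. -/
def Dart.up {S : Set G.V} {F : Set G.E} (d : (G.sub S F).Dart) : G.Dart :=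
  ⟨d.src.1, d.tgt.1, d.e.1, by
    have := congrArg (Sym2.map Subtype.val) d.h
    simp only [sub] at this
    rw [Sym2.attachWith_map_subtypeVal] at this
    simpa using this⟩

theorem attachWith_eq {α : Type*} {P : α → Prop} {s : Sym2 α} (h : ∀ x ∈ s, P x) {x y : α}
    (hx : P x) (hy : P y) (hs : s = s(x, y)) : s.attachWith h = s(⟨x, hx⟩, ⟨y, hy⟩) := by
  subst hs
  apply Sym2.map.injective Subtype.val_injective
  rw [Sym2.attachWith_map_subtypeVal]; rfl

/-- A dart of the graph as a dart of a subgraph. -/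
def Dart.down {S : Set G.V} {F : Set G.E} (d : G.Dart) (h1 : d.src ∈ S) (h2 : d.tgt ∈ S)
    (h3 : d.e ∈ F) : (G.sub S F).Dart :=
  ⟨⟨d.src, h1⟩, ⟨d.tgt, h2⟩, ⟨d.e, h3, by
    rw [d.h]; intro x hx; rcases Sym2.mem_iff.1 hx with rfl | rfl <;> assumption⟩,
    attachWith_eq _ _ _ d.h⟩

theorem sub_adj {S : Set G.V} {F : Set G.E} {x y : (G.sub S F).V} :
    (G.sub S F).toSimple.Adj x y ↔
      x ≠ y ∧ ∃ d : G.Dart, d.src = x.1 ∧ d.tgt = y.1 ∧ d.e ∈ F := by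
  rw [toSimple_adj]
  refine and_congr_right fun _ => ⟨?_, ?_⟩
  · rintro ⟨d, rfl, rfl⟩
    exact ⟨d.up, rfl, rfl, d.e.2.1⟩
  · rintro ⟨d, h1, h2, h3⟩
    exact ⟨d.down (h1 ▸ x.2) (h2 ▸ y.2) h3, Subtype.ext h1, Subtype.ext h2⟩

theorem sub_reach_of_dart {S : Set G.V} {F : Set G.E} {d : G.Dart} (h1 : d.src ∈ S)
    (h2 : d.tgt ∈ S) (h3 : d.e ∈ F) :
    (G.sub S F).toSimple.Reachable ⟨d.src, h1⟩ ⟨d.tgt, h2⟩ := by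
  by_cases h : d.src = d.tgt
  · have : (⟨d.src, h1⟩ : (G.sub S F).V) = ⟨d.tgt, h2⟩ := Subtype.ext h
    exact this ▸ SimpleGraph.Reachable.refl _
  · exact SimpleGraph.Adj.reachable (sub_adj.2 ⟨fun h4 => h (congrArg Subtype.val h4), d, rfl, rfl, h3⟩)

theorem reach_invariant {V : Type*} {H : SimpleGraph V} {P : V → V → Prop} (h0 : ∀ x, P x x)
    (ht : ∀ x y z, P x y → P y z → P x z)
    (h : ∀ x y, H.Adj x y → P x y) {x y : V} (hxy : H.Reachable x y) : P x y := by
  obtain ⟨p⟩ := hxy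
  induction p with
  | nil => exact h0 _
  | cons hadj _ ih => exact ht _ _ _ (h _ _ hadj) ih

/-! ### Local cutvertices -/

theorem punctured_reach {v u : G.V} {p : List G.Dart} (hp : SW r v p u)
    (hu : u ∈ {u | u ∈ G.ballV r v ∧ u ≠ v}) :
    ∃ (d : G.Dart) (h : d.tgt ∈ {u | u ∈ G.ballV r v ∧ u ≠ v}), d.src = v ∧
      (G.puncturedBall r v).toSimple.Reachable ⟨d.tgt, h⟩ ⟨u, hu⟩ := by
  induction p using List.reverseRecOn generalizing u with
  | nil => exact absurd hp.1.symm hu.2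
  | append_singleton p d ih =>
    obtain ⟨h1, h2, _⟩ := SW.prefix (q := []) hp
    obtain rfl : d.tgt = u := (wk_split.1 hp.1).2
    by_cases h3 : d.src = v
    · exact ⟨d, hu, h3, SimpleGraph.Reachable.refl _⟩
    · obtain ⟨d', h4, h5, h6⟩ := ih h1 ⟨mem_ballV.2 ⟨p, h1⟩, h3⟩
      exact ⟨d', h4, h5, h6.trans (sub_reach_of_dart _ _ (h2.mem_ballE_left (by simp)))⟩

/-- If `g v A` vanishes on short closed walks, its potential is constant along edges avoiding `v`,
but 1 behind `A` and 0 behind the other edges at `v`, so the punctured ball is disconnected.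
Conversely, the indicator of a component of the punctured ball is a potential for the edges from `v`
into it. -/
theorem not_isLocalCutvertex_iff (hec : EdgeClose r G) (hl : ∀ d : G.Dart, d.src ≠ d.tgt)
    (v : G.V) : ¬ G.IsLocalCutvertex r v ↔ ∀ A : Set G.E, Proper v A → ¬ Van r (g v A) := by
  rw [IsLocalCutvertex, not_not]
  have hn : ∀ d : G.Dart, d.src = v → d.tgt ∈ {u | u ∈ G.ballV r v ∧ u ≠ v} := by
    rintro d rfl
    exact ⟨mem_ballV.2 ⟨_, hec d⟩, (hl d).symm⟩
  constructor
  · rintro hpre A ⟨⟨d, h1, h2⟩, d', h3, h4⟩ hvan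
    have key : pot r (g v A) v d.tgt = pot r (g v A) v d'.tgt := by
      refine reach_invariant (P := fun x y : (G.puncturedBall r v).V =>
        pot r (g v A) v x.1 = pot r (g v A) v y.1) (fun _ => rfl) (fun _ _ _ => Eq.trans)
        (fun x y hxy => ?_) (hpre ⟨d.tgt, hn d h1⟩ ⟨d'.tgt, hn d' h3⟩)
      obtain ⟨_, d, h1, h2, h3⟩ := sub_adj.1 hxy
      rw [← h1, ← h2, pot_step (g_anti v A) hvan h3, g_of_ne (h1 ▸ x.2.2) (h2 ▸ y.2.2), add_zero]
    have e1 : ∀ d : G.Dart, d.src = v → pot r (g v A) v d.tgt = g v A d := by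
      rintro d rfl
      rw [pot_step (g_anti _ A) hvan (hec.mem_left d), pot_self (g_anti _ A) hvan, zero_add]
    rw [e1 d h1, e1 d' h3] at key
    have n1 : d.tgt ≠ v := (hn d h1).2
    have n2 : d'.tgt ≠ v := (hn d' h3).2
    simp [g, h1, h2, h3, h4, n1] at key
  · intro hA z z'
    by_contra hcon
    classical
    let R : G.V → Prop := fun u => ∃ h, (G.puncturedBall r v).toSimple.Reachable z ⟨u, h⟩
    let A : Set G.E := {e | ∃ d : G.Dart, d.e = e ∧ d.src = v ∧ R d.tgt}
    have memA : ∀ d : G.Dart, d.src = v → (d.e ∈ A ↔ R d.tgt) := by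
      intro d hd
      refine ⟨?_, fun h => ⟨d, rfl, hd, h⟩⟩
      rintro ⟨d', h1, h2, h3⟩
      rcases Dart.eq_or_symm h1 with rfl | rfl
      · exact h3
      · exact absurd (hd.trans h2.symm) (hl d)
    have notR : ¬ R v := fun ⟨h, _⟩ => h.2 rfl
    refine hA A ⟨?_, ?_⟩ ?_
    · obtain ⟨p, hp⟩ := mem_ballV.1 z.2.1
      obtain ⟨d, h1, h2, h3⟩ := punctured_reach hp z.2
      exact ⟨d, h2, (memA d h2).2 ⟨h1, h3.symm⟩⟩
    · obtain ⟨p, hp⟩ := mem_ballV.1 z'.2.1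
      obtain ⟨d, h1, h2, h3⟩ := punctured_reach hp z'.2
      refine ⟨d, h2, fun h => ?_⟩
      obtain ⟨h4, h5⟩ := (memA d h2).1 h
      exact hcon (h5.trans h3)
    · refine van_of_base {v} ?_ fun d h1 h2 => g_of_ne h1 h2
      rintro x p rfl hp
      rw [csum_potential (fun u => if R u then 1 else 0) hp.1, sub_self]
      intro d hd
      by_cases h1 : d.src = x
      · have h2 : d.tgt ≠ x := (hn d h1).2
        simp only [g, h1, true_and, memA d h1, h2, false_and, if_false, notR]
      · by_cases h2 : d.tgt = x
        · have := memA d.symm h2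
          simp only [g, h1, false_and, h2, true_and, if_false, notR]
          rw [Dart.symm_e, Dart.symm_tgt] at this
          simp only [this]
        · have h3 := hp.mem_ballE_left hd
          obtain ⟨h4, h5⟩ := near_of_mem_ballE h3
          have hr := sub_reach_of_dart (S := {u | u ∈ G.ballV r x ∧ u ≠ x})
            ⟨mem_ballV.2 h4, h1⟩ ⟨mem_ballV.2 h5, h2⟩ h3
          have : R d.src ↔ R d.tgt :=
            ⟨fun ⟨_, h⟩ => ⟨_, h.trans hr⟩, fun ⟨_, h⟩ => ⟨_, h.trans hr.symm⟩⟩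
          rw [g_of_ne h1 h2]; simp [this]

/-! ### Cycles -/

theorem Wk.get_succ {x y : G.V} {p : List G.Dart} (h : Wk x p y) (i : ℕ) (hi : i + 1 < p.length) :
    p[i].tgt = p[i + 1].src := by
  induction p generalizing x i with
  | nil => simp at hi
  | cons d p ih =>
    cases i with
    | zero =>
      cases p with
      | nil => simp at hi
      | cons b p => exact h.2.1.symm
    | succ i => exact ih h.2 i (by simpa using hi)

theorem Wk.get_last {x y : G.V} {p : List G.Dart} (h : Wk x p y) (hp : p ≠ []) :
    (p.getLast hp).tgt = y := by
  induction p generalizing x with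
  | nil => exact absurd rfl hp
  | cons d p ih =>
    cases p with
    | nil => exact h.2
    | cons b p => rw [List.getLast_cons (by simp)]; exact ih h.2 (by simp)

theorem Cyc.isCycle {x : G.V} {p : List G.Dart} (h : Cyc r x p) :
    ∃ (n : ℕ) (hn : p.length = n + 1), G.IsCycle n (fun i => (p[i.1]'(by omega)).src)
      (fun i => (p[i.1]'(by omega)).e) ∧
      (((∑ i : Fin (n + 1), G.len (p[i.1]'(by omega)).e : ℕ) : ℕ∞) ≤ r) := by
  obtain ⟨h1, h2, h3, h4⟩ := h
  obtain ⟨n, hn⟩ : ∃ n, p.length = n + 1 := ⟨p.length - 1, by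
    have := List.length_pos_iff.2 h2; omega⟩
  refine ⟨n, hn, ⟨?_, ?_, ?_⟩, ?_⟩
  · intro i j hij
    have := (List.Nodup.getElem_inj_iff h3 (i := i.1) (j := j.1) (hi := by simp; omega)
      (hj := by simp; omega)).1 (by simpa using hij)
    exact Fin.ext this
  · intro i j hij
    have := (List.Nodup.getElem_inj_iff h4 (i := i.1) (j := j.1) (hi := by simp; omega)
      (hj := by simp; omega)).1 (by simpa using hij)
    exact Fin.ext this
  · intro i
    rw [(p[i.1]'(by omega)).h]
    congr 2
    by_cases hi : i.1 + 1 < p.length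
    · have e1 : ((i + 1 : Fin (n + 1)) : ℕ) = i.1 + 1 := by
        rw [Fin.val_add_one, if_neg]
        intro h; have := congrArg Fin.val h; simp at this; omega
      simp only [e1]
      exact h1.1.get_succ _ hi
    · have hl : i = Fin.last n := Fin.ext (by simp; omega)
      subst hl
      simp only [Fin.last_add_one, Fin.val_last, Fin.val_zero]
      have e2 := h1.1.get_last h2
      rw [List.getLast_eq_getElem] at e2
      have e3 : p[n] = p[p.length - 1] := by congr 1; omega
      rw [e3, e2]
      cases p with
      | nil => exact absurd rfl h2
      | cons b p => exact h1.1.1.symm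
  · refine le_trans_cast h1.closed_le (le_of_eq ?_)
    rw [plen, ← List.sum_ofFn]
    congr 1
    apply List.ext_getElem
    · simp [hn]
    · intro i hi1 hi2; rw [List.getElem_ofFn]; simp

theorem Cyc.hasCycleThrough {x : G.V} {p : List G.Dart} (h : Cyc r x p) {S : Set G.V}
    (hS : ∀ s ∈ S, ∃ d ∈ p, d.src = s) : G.HasCycleThrough r S := by
  obtain ⟨n, hn, h1, h2⟩ := h.isCycle
  refine ⟨n, _, _, h1, h2, ?_⟩
  intro s hs
  obtain ⟨d, hd, rfl⟩ := hS s hs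
  obtain ⟨i, hi, rfl⟩ := List.getElem_of_mem hd
  exact ⟨⟨i, by omega⟩, rfl⟩

theorem wk_range {c : ℕ → G.V} {f : ℕ → G.Dart} (h1 : ∀ i, (f i).src = c i)
    (h2 : ∀ i, (f i).tgt = c (i + 1)) (m : ℕ) : Wk (c 0) ((List.range m).map f) (c m) := by
  induction m with
  | zero => rfl
  | succ m ih =>
    rw [List.range_succ, List.map_append]
    exact ih.append ⟨h1 m, h2 m⟩

/-- A cycle as a closed walk. -/
theorem IsCycle.exists_walk {n : ℕ} {c : Fin (n + 1) → G.V} {e : Fin (n + 1) → G.E}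
    (h : G.IsCycle n c e) (hr : ((∑ i, G.len (e i) : ℕ) : ℕ∞) ≤ r) :
    ∃ p, SW r (c 0) p (c 0) ∧ (∀ i, ∃ d ∈ p, d.src = c i ∧ d.tgt = c (i + 1) ∧ d.e = e i) ∧
      p.map Dart.src = List.ofFn c := by
  have hof : ∀ k : ℕ, Fin.ofNat (n + 1) k + 1 = Fin.ofNat (n + 1) (k + 1) := by
    intro k; apply Fin.ext; simp [Fin.val_add, Fin.ofNat]
  have hmk : ∀ (k : ℕ) (hk : k < n + 1), Fin.ofNat (n + 1) k = ⟨k, hk⟩ := by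
    intro k hk; apply Fin.ext; simp [Fin.ofNat, Nat.mod_eq_of_lt hk]
  let f : ℕ → G.Dart := fun k => ⟨c (Fin.ofNat (n + 1) k), c (Fin.ofNat (n + 1) k + 1),
    e (Fin.ofNat (n + 1) k), h.2.2 _⟩
  have hw := wk_range (c := fun k : ℕ => c (Fin.ofNat (n + 1) k)) (f := f) (fun _ => rfl)
    (fun i => by rw [← hof]) (n + 1)
  have h0 : Fin.ofNat (n + 1) (n + 1) = 0 := by apply Fin.ext; simp [Fin.ofNat]
  have h0' : Fin.ofNat (n + 1) 0 = 0 := by apply Fin.ext; simp [Fin.ofNat]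
  simp only [h0, h0'] at hw
  refine ⟨(List.range (n + 1)).map f, SW.of_closed hw (le_trans_cast hr (le_of_eq ?_)), ?_, ?_⟩
  · rw [plen, List.map_map, ← List.sum_ofFn]
    congr 1
    apply List.ext_getElem
    · simp
    · intro i h1 h2
      have h3 : i < n + 1 := by simpa [Nat.lt_succ_iff] using h1
      rw [List.getElem_ofFn, List.getElem_map, List.getElem_range]
      simp only [Function.comp, f, hmk i h3]
  · intro i
    refine ⟨f i, List.mem_map.2 ⟨i, List.mem_range.2 i.2, rfl⟩, ?_⟩
    simp only [f, hmk i i.2, Fin.eta, and_self]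
  · rw [List.map_map]
    apply List.ext_getElem
    · simp
    · intro i h1 h2
      have h3 : i < n + 1 := by simpa [Nat.lt_succ_iff] using h1
      rw [List.getElem_ofFn, List.getElem_map, List.getElem_range]
      simp only [Function.comp, f, hmk i h3]

end LenGraph

namespace LenGraph
variable {G : LenGraph.{u}} {r : ℕ∞} {v w : G.V}

/-! ### The core and the labels -/

theorem mem_core {c : G.V} : c ∈ G.core v w ↔
    ∃ p q, Wk v p c ∧ Wk c q w ∧ ∀ D, Wk v D w → plen p + plen q ≤ plen D := by
  constructor
  · rintro ⟨m, n, h1, h2, h3⟩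
    obtain ⟨p, hp, rfl⟩ := hasWalk_iff.1 h1
    obtain ⟨q, hq, rfl⟩ := hasWalk_iff.1 h2
    exact ⟨p, q, hp, hq, fun D hD => h3 _ (hasWalk_iff.2 ⟨D, hD, rfl⟩)⟩
  · rintro ⟨p, q, hp, hq, h⟩
    refine ⟨_, _, hasWalk_iff.2 ⟨p, hp, rfl⟩, hasWalk_iff.2 ⟨q, hq, rfl⟩, fun k hk => ?_⟩
    obtain ⟨D, hD, rfl⟩ := hasWalk_iff.1 hk
    exact h D hD

theorem mem_core_side {c : G.V} (i : Bool) (hc : c ∈ G.core v w) :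
    ∃ p q, Wk (G.side v w i) p c ∧ Wk c q (G.side v w !i) ∧
      ∀ D, Wk (G.side v w i) D (G.side v w !i) → plen p + plen q ≤ plen D := by
  obtain ⟨p, q, hp, hq, h⟩ := mem_core.1 hc
  cases i
  · exact ⟨p, q, hp, hq, h⟩
  · refine ⟨rev q, rev p, hq.rev, hp.rev, fun D hD => ?_⟩
    have := h _ hD.rev
    simp only [plen_rev] at *; omega

theorem side_mem_core (hn : Near r v w) (i : Bool) : G.side v w i ∈ G.core v w := by
  obtain ⟨p, hp⟩ := hn
  obtain ⟨q, hq, h⟩ := exists_geodesic hp.1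
  cases i
  · exact mem_core.2 ⟨[], q, rfl, hq, fun D hD => by simpa using h D hD⟩
  · exact mem_core.2 ⟨q, [], hq, rfl, fun D hD => by simpa using h D hD⟩

theorem mem_ballPaths {b u : G.V} {q : G.V × List G.E} : q ∈ G.ballPaths r v w b u ↔
    q.1 ∈ G.core v w ∧ ∃ P : List G.Dart, P.map Dart.e = q.2 ∧ Wk q.1 P u ∧
      ∀ d ∈ P, d.e ∈ G.ballE r b := by
  constructor
  · rintro ⟨h1, h2, h3⟩
    obtain ⟨P, h4, h5⟩ := isWalk_iff.1 h2
    exact ⟨h1, P, h5, h4, fun d hd => h3 _ (h5 ▸ List.mem_map_of_mem hd)⟩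
  · rintro ⟨h1, P, h5, h4, h3⟩
    refine ⟨h1, isWalk_iff.2 ⟨P, h4, h5⟩, fun e he => ?_⟩
    rw [← h5] at he
    obtain ⟨d, hd, rfl⟩ := List.mem_map.1 he
    exact h3 d hd

theorem exists_mem_label {b u : G.V} {q : G.V × List G.E} (hq : q ∈ G.ballPaths r v w b u) :
    ∃ q0 ∈ G.label r v w b u, G.length q0.2 ≤ G.length q.2 := by
  classical
  have hne : ∃ n, ∃ q ∈ G.ballPaths r v w b u, G.length q.2 = n := ⟨_, q, hq, rfl⟩
  obtain ⟨q0, h0, h1⟩ := Nat.find_spec hne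
  exact ⟨q0, ⟨h0, fun q' hq' => h1 ▸ Nat.find_min' hne ⟨q', hq', rfl⟩⟩,
    h1 ▸ Nat.find_min' hne ⟨q, hq, rfl⟩⟩

/-- As lengths are positive, the trivial path is the only shortest one. In particular `v` and `w`
have a single copy each. -/
theorem label_core (hpos : ∀ e, 0 < G.len e) {b c : G.V} (hc : c ∈ G.core v w) :
    G.label r v w b c = {(c, [])} := by
  have h0 : ((c, []) : G.V × List G.E) ∈ G.ballPaths r v w b c :=
    ⟨hc, .nil c, by simp⟩
  ext ⟨c', Q⟩
  simp only [label, Set.mem_ofPred_eq, Set.mem_singleton_iff]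
  constructor
  · rintro ⟨h1, h2⟩
    have h3 := h2 _ h0
    cases Q with
    | nil =>
      have := h1.2.1
      cases this
      rfl
    | cons e Q => have := hpos e; simp [length] at h3; omega
  · rintro h
    obtain ⟨rfl, rfl⟩ := Prod.mk.inj h
    exact ⟨h0, fun q' _ => by simp [length]⟩

/-- Suppose `y` lies on a short closed walk through both `v` and `w`. In that walk, replace the arc
to `y` by a shortest path from the core, and the closing walk by the piece of a `v`–`w` geodesic
leading to the start of this path. The result is no longer and is based at the other separator
vertex, so the path lies in the other ball as well. By symmetry the labels of `y` agree. -/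
theorem label_subset_ballPaths (hn : Near r v w) (i : Bool) {y : G.V} {W1 W2 : List G.Dart}
    (h1 : Wk (G.side v w i) W1 y) (h2 : Wk y W2 (G.side v w !i))
    (h : SW r (G.side v w i) (W1 ++ W2) (G.side v w !i)) :
    G.label r v w (G.side v w i) y ⊆ G.ballPaths r v w (G.side v w !i) y := by
  rintro ⟨c, Q⟩ ⟨hq, hmin⟩
  obtain ⟨hc, P, rfl, hP, hPb⟩ := mem_ballPaths.1 hq
  obtain ⟨p', q', hp', hq', hgeo⟩ := mem_core_side i hc
  have hW1 : plen P ≤ plen W1 := by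
    have := hmin (G.side v w i, W1.map Dart.e) (mem_ballPaths.2
      ⟨side_mem_core hn i, W1, rfl, h1, fun d hd => h.mem_ballE_left (by simp [hd])⟩)
    simpa [length_map_e] using this
  refine mem_ballPaths.2 ⟨hc, P, rfl, hP, fun d hd => ?_⟩
  obtain ⟨_, q0, hq0, hr⟩ := h
  have hq0' := hgeo _ hq0.rev
  rw [plen_rev] at hq0'
  have hs : SW r (G.side v w !i) (rev q' ++ P ++ W2) (G.side v w !i) :=
    SW.of_closed ((hq'.rev.append hP).append h2) (le_trans_cast hr (by
      simp only [plen_append, plen_rev]; omega))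
  exact hs.mem_ballE_left (by simp [hd])

theorem label_eq_side (hn : Near r v w) (i : Bool) {y : G.V} {W1 W2 : List G.Dart}
    (h1 : Wk (G.side v w i) W1 y) (h2 : Wk y W2 (G.side v w !i))
    (h : SW r (G.side v w i) (W1 ++ W2) (G.side v w !i)) :
    G.label r v w (G.side v w i) y = G.label r v w (G.side v w !i) y := by
  have e1 := label_subset_ballPaths hn i h1 h2 h
  have e2 : G.label r v w (G.side v w !i) y ⊆ G.ballPaths r v w (G.side v w i) y := by
    have hs := h.symm
    have hrev : rev (W1 ++ W2) = rev W2 ++ rev W1 := by simp [rev]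
    rw [hrev] at hs
    have hr1 := h1.rev
    have hr2 := h2.rev
    have := label_subset_ballPaths (W1 := rev W2) (W2 := rev W1) hn (!i) hr2
      (by simpa using hr1) (by simpa using hs)
    simpa using this
  have key : ∀ b b', G.label r v w b y ⊆ G.ballPaths r v w b' y →
      G.label r v w b' y ⊆ G.ballPaths r v w b y → G.label r v w b y ⊆ G.label r v w b' y := by
    intro b b' s1 s2 q hq
    refine ⟨s1 hq, fun q' hq' => ?_⟩
    obtain ⟨q0, hq0, hle⟩ := exists_mem_label hq'
    exact (hq.2 q0 (s2 hq0)).trans hle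
  exact (key _ _ e1 e2).antisymm (key _ _ e2 e1)

theorem eq_side {b : G.V} (hb : b = v ∨ b = w) (i : Bool) :
    b = G.side v w i ∨ b = G.side v w !i := by
  rcases hb with rfl | rfl <;> cases i <;> simp [side]

theorem label_eq (hn : Near r v w) (i : Bool) {y : G.V} {W1 W2 : List G.Dart}
    (h1 : Wk (G.side v w i) W1 y) (h2 : Wk y W2 (G.side v w !i))
    (h : SW r (G.side v w i) (W1 ++ W2) (G.side v w !i)) {b b' : G.V} (hb : b = v ∨ b = w)
    (hb' : b' = v ∨ b' = w) : G.label r v w b y = G.label r v w b' y := by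
  have := label_eq_side hn i h1 h2 h
  rcases eq_side hb i with h3 | h3 <;> rcases eq_side hb' i with h4 | h4 <;> simp only [h3, h4, this]

/-! ### Copies of vertices and edges -/

theorem copy_eq_base (hpos : ∀ e, 0 < G.len e) (hn : Near r v w) {b : G.V} (hb : b = v ∨ b = w)
    (u : {u // u ∈ G.ballV r b}) (i : Bool) :
    G.copy r v w hb u = G.base r v w i ↔ u.1 = G.side v w i := by
  constructor
  · intro h
    exact congrArg (fun z : G.ExplV r v w => z.1.1) h
  · intro h
    apply Subtype.ext
    show (u.1, G.label r v w b u.1) = (G.side v w i, G.label r v w (G.side v w i) (G.side v w i))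
    rw [h, label_core hpos (side_mem_core hn i), label_core hpos (side_mem_core hn i)]

/-- A dart of a ball as a dart of the explorer-neighbourhood. -/
def explDart {b : G.V} (hb : b = v ∨ b = w) (d : G.Dart) (hd : d.e ∈ G.ballE r b) :
    (G.expl r v w).Dart where
  src := G.copy r v w hb ⟨d.src, mem_ballV.2 (near_of_mem_ballE hd).1⟩
  tgt := G.copy r v w hb ⟨d.tgt, mem_ballV.2 (near_of_mem_ballE hd).2⟩
  e := ⟨(d.e, s(_, _)), b, hb, ⟨d.src, mem_ballV.2 (near_of_mem_ballE hd).1⟩,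
    ⟨d.tgt, mem_ballV.2 (near_of_mem_ballE hd).2⟩, hd, d.h, rfl⟩
  h := rfl

theorem exists_explDart (d : (G.expl r v w).Dart) :
    ∃ (b : G.V) (hb : b = v ∨ b = w) (d0 : G.Dart) (hd : d0.e ∈ G.ballE r b),
      d0.e = d.e.1.1 ∧ d = explDart hb d0 hd := by
  obtain ⟨s, t, ⟨⟨e, se⟩, b, hb, x, y, h1, h2, h3⟩, h⟩ := d
  change se = s(s, t) at h
  change G.ends e = _ at h2
  change se = _ at h3
  subst h3
  rcases Sym2.eq_iff.1 h with ⟨rfl, rfl⟩ | ⟨rfl, rfl⟩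
  · exact ⟨b, hb, ⟨x.1, y.1, e, h2⟩, h1, rfl, rfl⟩
  · refine ⟨b, hb, ⟨y.1, x.1, e, by rw [h2, Sym2.eq_swap]⟩, h1, rfl, ?_⟩
    refine Dart.ext' rfl rfl ?_
    apply Subtype.ext
    exact Prod.ext rfl Sym2.eq_swap

/-- The projection of a dart of the explorer-neighbourhood. -/
def Dart.down' (d : (G.expl r v w).Dart) : G.Dart :=
  ⟨d.src.1.1, d.tgt.1.1, d.e.1.1, by
    obtain ⟨b, hb, d0, hd, h1, rfl⟩ := exists_explDart d
    exact d0.h⟩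

@[simp] theorem down'_explDart {b : G.V} (hb : b = v ∨ b = w) (d : G.Dart)
    (hd : d.e ∈ G.ballE r b) : (explDart hb d hd).down' = d := rfl

theorem Wk.down' {x y : (G.expl r v w).V} {p : List (G.expl r v w).Dart} (h : Wk x p y) :
    Wk x.1.1 (p.map Dart.down') y.1.1 := by
  induction p generalizing x with
  | nil => cases h; rfl
  | cons d p ih => exact ⟨congrArg (fun z : G.ExplV r v w => z.1.1) h.1, ih h.2⟩

theorem plen_down' (p : List (G.expl r v w).Dart) : plen (p.map Dart.down') = plen p := by
  simp only [plen, List.map_map]; rfl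

/-- Walks in a ball lift to the explorer-neighbourhood. -/
theorem exists_lift_expl {b x y : G.V} (hb : b = v ∨ b = w) {p : List G.Dart} (hp : Wk x p y)
    (h : ∀ d ∈ p, d.e ∈ G.ballE r b) (hx : x ∈ G.ballV r b) :
    ∃ (hy : y ∈ G.ballV r b) (p' : List (G.expl r v w).Dart),
      Wk (G := G.expl r v w) (G.copy r v w hb ⟨x, hx⟩) p' (G.copy r v w hb ⟨y, hy⟩) ∧
      p'.map Dart.down' = p ∧ ∀ d ∈ p', ∃ hd, d = explDart hb d.down' hd := by
  induction p generalizing x with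
  | nil => cases hp; exact ⟨hx, [], rfl, rfl, by simp⟩
  | cons d p ih =>
    obtain ⟨rfl, hp⟩ := hp
    have hd := h d (by simp)
    obtain ⟨hy, p', h1, h2, h3⟩ := ih hp (fun d' hd' => h d' (List.mem_cons_of_mem _ hd'))
      (mem_ballV.2 (near_of_mem_ballE hd).2)
    refine ⟨hy, explDart hb d hd :: p', ⟨rfl, h1⟩, by simp [h2], ?_⟩
    intro d' hd'
    rcases List.mem_cons.1 hd' with rfl | hd'
    · exact ⟨hd, rfl⟩
    · exact h3 d' hd'

/-! ### The punctured explorer-neighbourhood -/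

/-- Not one of the two vertices of the separator. -/
abbrev Off (v w u : G.V) : Prop := u ≠ v ∧ u ≠ w

theorem off_side {u : G.V} (h : Off v w u) (i : Bool) : u ≠ G.side v w i := by
  cases i
  · exact h.1
  · exact h.2

theorem off_iff {u : G.V} : Off v w u ↔ ∀ i, u ≠ G.side v w i :=
  ⟨off_side, fun h => ⟨h false, h true⟩⟩

theorem not_off {u : G.V} (h : ¬ Off v w u) : ∃ i, u = G.side v w i := by
  rw [off_iff] at h; push Not at h; exact h

/-- The vertex of the punctured explorer-neighbourhood given by a vertex of a ball. -/
def pz {b : G.V} (hb : b = v ∨ b = w) (u : G.V) (hu : u ∈ G.ballV r b) (ho : Off v w u) :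
    (G.puncturedExpl r v w).V :=
  ⟨G.copy r v w hb ⟨u, hu⟩,
    fun h => ho.1 (congrArg (fun z : G.ExplV r v w => z.1.1) h),
    fun h => ho.2 (congrArg (fun z : G.ExplV r v w => z.1.1) h)⟩

theorem exists_pz (hpos : ∀ e, 0 < G.len e) (hn : Near r v w) (z : (G.puncturedExpl r v w).V) :
    ∃ (b : G.V) (hb : b = v ∨ b = w) (u : G.V) (hu : u ∈ G.ballV r b) (ho : Off v w u),
      z = pz hb u hu ho := by
  obtain ⟨⟨⟨u, L⟩, b, hb, hu, hL⟩, h1, h2⟩ := z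
  change L = G.label r v w b u at hL
  subst hL
  refine ⟨b, hb, u, hu, ⟨fun h => h1 ?_, fun h => h2 ?_⟩, rfl⟩
  · exact (copy_eq_base hpos hn hb ⟨u, hu⟩ false).2 h
  · exact (copy_eq_base hpos hn hb ⟨u, hu⟩ true).2 h

theorem off_of_punctured (hpos : ∀ e, 0 < G.len e) (hn : Near r v w)
    (z : (G.puncturedExpl r v w).V) : Off v w z.1.1.1 := by
  obtain ⟨b, hb, u, hu, ho, rfl⟩ := exists_pz hpos hn z
  exact ho

theorem pz_reach {b : G.V} (hb : b = v ∨ b = w) {d : G.Dart} (hd : d.e ∈ G.ballE r b)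
    (h1 : d.src ∈ G.ballV r b) (h2 : d.tgt ∈ G.ballV r b)
    (o1 : Off v w d.src) (o2 : Off v w d.tgt) :
    (G.puncturedExpl r v w).toSimple.Reachable (pz hb d.src h1 o1) (pz hb d.tgt h2 o2) :=
  sub_reach_of_dart (d := explDart hb d hd) (pz hb d.src h1 o1).2 (pz hb d.tgt h2 o2).2
    (Set.mem_univ _)

/-- The two copies of a neighbour of `v` or `w` agree. -/
theorem pz_eq (hn : Near r v w) {i : Bool} {d : G.Dart} (hd : d.src = G.side v w i)
    (ho : Off v w d.tgt) {b b' : G.V} (hb : b = v ∨ b = w) (hb' : b' = v ∨ b' = w)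
    (h : d.e ∈ G.ballE r b) (h' : d.e ∈ G.ballE r b') (hu : d.tgt ∈ G.ballV r b)
    (hu' : d.tgt ∈ G.ballV r b') : pz hb d.tgt hu ho = pz hb' d.tgt hu' ho := by
  have hl : G.label r v w b d.tgt = G.label r v w b' d.tgt := by
    -- An edge at one separator vertex lying in the ball around the other is on a short closed walk
    -- through both, so `label_eq` applies with this edge as the first arc.
    have key : d.e ∈ G.ballE r (G.side v w !i) → G.label r v w b d.tgt = G.label r v w b' d.tgt := by
      intro hh
      obtain ⟨p, q, hs⟩ := mem_ballE.1 hh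
      obtain ⟨w1, w2⟩ := wk_split.1 hs.1
      rw [hd] at w1
      exact label_eq (W1 := [d]) (W2 := q) hn i ⟨hd, rfl⟩ w2
        (hs.right ⟨hd, w2⟩ w1) hb hb'
    rcases eq_side hb i with h3 | h3
    · rcases eq_side hb' i with h4 | h4
      · rw [h3, h4]
      · exact key (h4 ▸ h')
    · exact key (h3 ▸ h)
  apply Subtype.ext
  apply Subtype.ext
  exact Prod.ext rfl hl

/-! ### Colouring the explorer-neighbourhood by a separation -/

/-- Without loops, the start and the first edge determine the direction of that edge. Hence equal
labels, which record edges only, give equal dart walks. -/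
theorem wk_unique (hl : ∀ d : G.Dart, d.src ≠ d.tgt) {x y y' : G.V} {p q : List G.Dart}
    (hp : Wk x p y) (hq : Wk x q y') (h : p.map Dart.e = q.map Dart.e) : p = q := by
  induction p generalizing x q with
  | nil => cases q <;> simp_all
  | cons d p ih =>
    cases q with
    | nil => simp at h
    | cons d' q =>
      simp only [List.map_cons, List.cons.injEq] at h
      have : d = d' := by
        rcases Dart.eq_or_symm h.1 with h3 | h3
        · exact h3
        · subst h3
          exact absurd (hp.1.trans hq.1.symm).symm (hl d')
      subst this
      rw [ih hp.2 hq.2 h.2]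

theorem pot_walk {c : G.Dart → ℤ} (hc : Anti c) (h : Van r c) {b x y : G.V} {p : List G.Dart}
    (hp : Wk x p y) (hb : ∀ d ∈ p, d.e ∈ G.ballE r b) :
    pot r c b y = pot r c b x + csum c p := by
  rw [csum_potential (pot r c b) hp fun d hd => by rw [pot_step hc h (hb d hd)]; ring]; ring

/-- A `v`–`w` geodesic through `c` closes up to a short closed walk, so its sum is zero by the
second condition of `Bal`; the parts before and after `c` therefore cancel. -/
theorem Bal.pot_core {A B : Set G.E} (h : Bal r v A w B) (hn : Near r v w) {c : G.V}
    (hc : c ∈ G.core v w) : pot r (chi v A w B) v c = pot r (chi v A w B) w c := by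
  obtain ⟨p, q, hp, hq, hm⟩ := mem_core.1 hc
  have hs : SW r v (p ++ q) w := by
    obtain ⟨D, hD, hr⟩ := near_iff.1 hn
    have := hm D hD
    exact ⟨hp.append hq, rev D, hD.rev, le_trans_cast hr (by simp; omega)⟩
  have h1 := h.2 _ hs
  rw [csum_append] at h1
  rw [pot_eq (chi_anti _ _ _ _) h.1 (hs.left hp),
    pot_eq (chi_anti _ _ _ _) h.1 (hs.right hq hp).symm, csum_rev (chi_anti _ _ _ _)]
  omega

/-- Equal labels provide one path from the core that lies in both balls. The two potentials agree at
its start and grow by the same sum, so the potential is well defined on identified copies. -/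
theorem Bal.pot_label (hG : Good r G) {A B : Set G.E} (h : Bal r v A w B) (hn : Near r v w)
    {b b' u : G.V} (hb : b = v ∨ b = w) (hb' : b' = v ∨ b' = w) (hu : u ∈ G.ballV r b)
    (hl : G.label r v w b u = G.label r v w b' u) :
    pot r (chi v A w B) b u = pot r (chi v A w B) b' u := by
  have hbc : b ∈ G.core v w := by
    rcases hb with rfl | rfl
    · exact side_mem_core hn false
    · exact side_mem_core hn true
  obtain ⟨p, hp⟩ := mem_ballV.1 hu
  obtain ⟨q, hq, _⟩ := exists_mem_label (v := v) (w := w) (q := (b, p.map Dart.e))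
    (mem_ballPaths.2 ⟨hbc, p, rfl, hp.1, fun d hd => hp.mem_ballE_left hd⟩)
  obtain ⟨h1, P, h2, h3, h4⟩ := mem_ballPaths.1 hq.1
  obtain ⟨_, P', h2', h3', h4'⟩ := mem_ballPaths.1 (hl ▸ hq).1
  obtain rfl := wk_unique hG.noloop h3 h3' (h2.trans h2'.symm)
  rw [pot_walk (chi_anti _ _ _ _) h.1 h3 h4, pot_walk (chi_anti _ _ _ _) h.1 h3 h4']
  congr 1
  have := h.pot_core hn h1
  rcases hb with rfl | rfl <;> rcases hb' with rfl | rfl <;> simp [this]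

/-- The potential descends to the explorer-neighbourhood, and `chi` is zero on edges avoiding `v`
and `w`. Hence it is constant on local components. -/
theorem Bal.pot_reach (hG : Good r G) {A B : Set G.E} (h : Bal r v A w B) (hn : Near r v w)
    {b b' u u' : G.V} (hb : b = v ∨ b = w) (hb' : b' = v ∨ b' = w) (hu : u ∈ G.ballV r b)
    (hu' : u' ∈ G.ballV r b') (ho : Off v w u) (ho' : Off v w u')
    (hr : (G.puncturedExpl r v w).toSimple.Reachable (pz hb u hu ho) (pz hb' u' hu' ho')) :
    pot r (chi v A w B) b u = pot r (chi v A w B) b' u' := by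
  let zp : (G.puncturedExpl r v w).V → ℤ := fun z => pot r (chi v A w B) z.1.2.choose z.1.1.1
  have hzp : ∀ (b u : G.V) (hb : b = v ∨ b = w) (hu : u ∈ G.ballV r b) (ho : Off v w u),
      zp (pz hb u hu ho) = pot r (chi v A w B) b u := by
    intro b u hb hu ho
    have hs := (pz hb u hu ho).1.2.choose_spec
    exact h.pot_label hG hn hs.1 hb hs.2.1 hs.2.2.symm
  rw [← hzp b u hb hu ho, ← hzp b' u' hb' hu' ho']
  refine reach_invariant (P := fun x y => zp x = zp y) (fun _ => rfl) (fun _ _ _ => Eq.trans)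
    (fun x y hxy => ?_) hr
  obtain ⟨_, d, h1, h2, _⟩ := sub_adj.1 hxy
  obtain ⟨b, hb, d0, hd, _, rfl⟩ := exists_explDart d
  have o1 : Off v w d0.src := by
    have := off_of_punctured hG.pos hn x; rw [← h1] at this; exact this
  have o2 : Off v w d0.tgt := by
    have := off_of_punctured hG.pos hn y; rw [← h2] at this; exact this
  have n := near_of_mem_ballE hd
  have e1 : x = pz hb d0.src (mem_ballV.2 n.1) o1 := Subtype.ext h1.symm
  have e2 : y = pz hb d0.tgt (mem_ballV.2 n.2) o2 := Subtype.ext h2.symm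
  rw [e1, e2, hzp, hzp, pot_step (chi_anti _ _ _ _) h.1 hd]
  simp [chi, g, o1.1, o1.2, o2.1, o2.2]

/-! ### Local components as separations -/

/-- The component of the punctured explorer-neighbourhood containing a vertex. -/
abbrev compOf (z : (G.puncturedExpl r v w).V) : G.LocalComp r v w :=
  (G.puncturedExpl r v w).toSimple.connectedComponentMk z

/-- The edges at `v` or `w` that lead into a local component. -/
def Kset (r : ℕ∞) (v w : G.V) (k : G.LocalComp r v w) : Set G.E :=
  {e | ∃ i, G.Inherits r v w e i k}

theorem inherits_iff (hG : Good r G) (hn : Near r v w) {i : Bool} {d : G.Dart}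
    (hd : d.src = G.side v w i) (ho : Off v w d.tgt) {b : G.V} (hb : b = v ∨ b = w)
    (hE : d.e ∈ G.ballE r b) (hu : d.tgt ∈ G.ballV r b) {j : Bool} {k : G.LocalComp r v w} :
    G.Inherits r v w d.e j k ↔ G.side v w j = d.src ∧ compOf (pz hb d.tgt hu ho) = k := by
  constructor
  · rintro ⟨f, z, h1, h2, h3⟩
    obtain ⟨b', hb', d0, hd0, h4, h5⟩ := exists_explDart
      (⟨G.base r v w j, z.1, f, h2⟩ : (G.expl r v w).Dart)
    have h6 : G.base r v w j = (explDart hb' d0 hd0).src := congrArg Dart.src h5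
    have h7 : z.1 = (explDart hb' d0 hd0).tgt := congrArg Dart.tgt h5
    have h8 : G.side v w j = d0.src := congrArg (fun z : G.ExplV r v w => z.1.1) h6
    rcases Dart.eq_or_symm (h4.trans h1 : d0.e = d.e) with rfl | rfl
    · refine ⟨h8, ?_⟩
      rw [← h3]
      have hu' := mem_ballV.2 (near_of_mem_ballE hd0).2
      rw [pz_eq hn hd ho hb hb' hE hd0 hu hu']
      congr 1
      exact Subtype.ext h7.symm
    · exact absurd h8.symm (off_side ho j)
  · rintro ⟨h1, rfl⟩
    refine ⟨(explDart hb d hE).e, pz hb d.tgt hu ho, rfl, ?_, rfl⟩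
    have : G.base r v w j = G.copy r v w hb ⟨d.src, mem_ballV.2 (near_of_mem_ballE hE).1⟩ :=
      ((copy_eq_base hG.pos hn hb _ j).2 h1.symm).symm
    rw [this]
    rfl

theorem mem_Kset_iff (hG : Good r G) (hn : Near r v w) {i : Bool} {d : G.Dart}
    (hd : d.src = G.side v w i) (ho : Off v w d.tgt) {b : G.V} (hb : b = v ∨ b = w)
    (hE : d.e ∈ G.ballE r b) (hu : d.tgt ∈ G.ballV r b) {k : G.LocalComp r v w} :
    d.e ∈ Kset r v w k ↔ compOf (pz hb d.tgt hu ho) = k := by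
  constructor
  · rintro ⟨j, hj⟩
    exact ((inherits_iff hG hn hd ho hb hE hu).1 hj).2
  · intro h
    exact ⟨i, (inherits_iff hG hn hd ho hb hE hu).2 ⟨hd.symm, h⟩⟩

theorem exists_dart_of_inherits (hG : Good r G) (hn : Near r v w) {e : G.E} {j : Bool}
    {k : G.LocalComp r v w} (h : G.Inherits r v w e j k) :
    ∃ d : G.Dart, d.e = e ∧ d.src = G.side v w j ∧ Off v w d.tgt := by
  obtain ⟨f, z, h1, h2, h3⟩ := h
  obtain ⟨b', hb', d0, hd0, h4, h5⟩ := exists_explDart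
    (⟨G.base r v w j, z.1, f, h2⟩ : (G.expl r v w).Dart)
  have h6 : G.base r v w j = (explDart hb' d0 hd0).src := congrArg Dart.src h5
  have h7 : z.1 = (explDart hb' d0 hd0).tgt := congrArg Dart.tgt h5
  refine ⟨d0, h4.trans h1, (congrArg (fun z : G.ExplV r v w => z.1.1) h6).symm, ?_⟩
  have := off_of_punctured hG.pos hn z
  rw [h7] at this
  exact this

theorem exists_dart_of_mem_Kset (hG : Good r G) (hn : Near r v w) {e : G.E}
    {k : G.LocalComp r v w} (h : e ∈ Kset r v w k) :
    ∃ (d : G.Dart) (i : Bool), d.e = e ∧ d.src = G.side v w i ∧ Off v w d.tgt := by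
  obtain ⟨i, hi⟩ := h
  obtain ⟨d, h⟩ := exists_dart_of_inherits hG hn hi
  exact ⟨d, i, h⟩

/-- The local component into which an edge at `v` or `w` leads. -/
theorem exists_unique_comp (hG : Good r G) (hn : Near r v w) {i : Bool} {d : G.Dart}
    (hd : d.src = G.side v w i) (ho : Off v w d.tgt) :
    ∃ k : G.LocalComp r v w, ∀ k', d.e ∈ Kset r v w k' ↔ k = k' := by
  have hE : d.e ∈ G.ballE r (G.side v w i) := hd ▸ hG.edgeClose.mem_left d
  exact ⟨_, fun k' => mem_Kset_iff hG hn hd ho (G.side_eq v w i) hE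
    (mem_ballV.2 (near_of_mem_ballE hE).2)⟩

theorem Kset_disjoint (hG : Good r G) (hn : Near r v w) {e : G.E} {k k' : G.LocalComp r v w}
    (h : e ∈ Kset r v w k) (h' : e ∈ Kset r v w k') : k = k' := by
  obtain ⟨d, i, rfl, h2, h3⟩ := exists_dart_of_mem_Kset hG hn h
  obtain ⟨k0, hk0⟩ := exists_unique_comp hG hn h2 h3
  exact ((hk0 _).1 h).symm.trans ((hk0 _).1 h')

theorem inherits_of_mem (hG : Good r G) (hn : Near r v w) {i : Bool} {d : G.Dart}
    (hd : d.src = G.side v w i) (ho : Off v w d.tgt) {k : G.LocalComp r v w}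
    (h : d.e ∈ Kset r v w k) : G.Inherits r v w d.e i k := by
  have hE : d.e ∈ G.ballE r (G.side v w i) := hd ▸ hG.edgeClose.mem_left d
  have hu := mem_ballV.2 (near_of_mem_ballE hE).2
  exact (inherits_iff hG hn hd ho (G.side_eq v w i) hE hu).2
    ⟨hd.symm, (mem_Kset_iff hG hn hd ho (G.side_eq v w i) hE hu).1 h⟩

theorem notMem_Kset_of_sides (hG : Good r G) (hn : Near r v w) (d : G.Dart) {i j : Bool}
    (h1 : d.src = G.side v w i) (h2 : d.tgt = G.side v w j) (k : G.LocalComp r v w) :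
    d.e ∉ Kset r v w k := by
  intro h
  obtain ⟨d0, i0, h3, h4, h5⟩ := exists_dart_of_mem_Kset hG hn h
  rcases Dart.eq_or_symm h3 with rfl | rfl
  · exact off_side h5 j h2
  · exact off_side h5 i h1

open Classical in
/-- The indicator function of a local component on the explorer-neighbourhood. -/
noncomputable def compInd (k : G.LocalComp r v w) (z : (G.expl r v w).V) : ℤ :=
  if ∃ h, compOf ⟨z, h⟩ = k then 1 else 0

theorem compInd_base (k : G.LocalComp r v w) (i : Bool) : compInd k (G.base r v w i) = 0 := by
  rw [compInd, if_neg]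
  rintro ⟨⟨h1, h2⟩, _⟩
  cases i
  · exact h1 rfl
  · exact h2 rfl

theorem compInd_pz (k : G.LocalComp r v w) (z : (G.puncturedExpl r v w).V) [Decidable (compOf z = k)] :
    compInd k z.1 = if compOf z = k then 1 else 0 := by
  rw [compInd]
  congr 1
  exact propext ⟨fun ⟨_, h⟩ => h, fun h => ⟨z.2, h⟩⟩

/-- On the explorer-neighbourhood the indicator of `k` is a potential for the cochain of the edges
leading into `k`. The base vertices are outside `k`, and edges between other vertices do not leave
their component. -/
theorem chi_K (hG : Good r G) (hvw : v ≠ w) (hn : Near r v w) (k : G.LocalComp r v w)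
    (d : (G.expl r v w).Dart) :
    chi v (Kset r v w k) w (Kset r v w k) d.down' = compInd k d.tgt - compInd k d.src := by
  classical
  obtain ⟨b, hb, d, hd, _, rfl⟩ := exists_explDart d
  rw [down'_explDart]
  have n1 := mem_ballV.2 (near_of_mem_ballE hd).1
  have n2 := mem_ballV.2 (near_of_mem_ballE hd).2
  have key : ∀ (d : G.Dart) (n : d.tgt ∈ G.ballV r b), d.e ∈ G.ballE r b → ∀ i,
      d.src = G.side v w i → Off v w d.tgt →
      (if d.e ∈ Kset r v w k then (1 : ℤ) else 0) =
        compInd k (G.copy r v w hb ⟨d.tgt, n⟩) := by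
    intro d n hE i h1 h2
    have := compInd_pz k (pz hb d.tgt n h2)
    rw [show G.copy r v w hb ⟨d.tgt, n⟩ = (pz hb d.tgt n h2).1 from rfl, this]
    congr 1
    exact propext (mem_Kset_iff hG hn h1 h2 hb hE n)
  have chi_side : ∀ (d : G.Dart) (i : Bool), d.src = G.side v w i → Off v w d.tgt →
      chi v (Kset r v w k) w (Kset r v w k) d = if d.e ∈ Kset r v w k then (1 : ℤ) else 0 := by
    intro d i h1 h2
    cases i
    · have h3 : d.src ≠ w := fun h => hvw (h1.symm.trans h)
      have h1 : d.src = v := h1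
      have h4 : v ≠ w := hvw
      simp [chi, g, h1, h2.1, h2.2, h4]
    · have h1 : d.src = w := h1
      simp [chi, g, h1, h2.1, h2.2, hvw.symm]
  have base0 : ∀ (u : G.V) (n : u ∈ G.ballV r b) i, u = G.side v w i →
      compInd k (G.copy r v w hb ⟨u, n⟩) = 0 := by
    intro u n i h
    rw [(copy_eq_base hG.pos hn hb ⟨u, n⟩ i).2 h, compInd_base]
  change _ = compInd k (G.copy r v w hb ⟨d.tgt, n2⟩) - compInd k (G.copy r v w hb ⟨d.src, n1⟩)
  by_cases o1 : Off v w d.src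
  · by_cases o2 : Off v w d.tgt
    · have : compOf (pz hb d.src n1 o1) = compOf (pz hb d.tgt n2 o2) :=
        SimpleGraph.ConnectedComponent.eq.2 (pz_reach hb hd n1 n2 o1 o2)
      rw [show G.copy r v w hb ⟨d.tgt, n2⟩ = (pz hb d.tgt n2 o2).1 from rfl,
        show G.copy r v w hb ⟨d.src, n1⟩ = (pz hb d.src n1 o1).1 from rfl, compInd_pz, compInd_pz,
        this, sub_self]
      simp [chi, g, o1.1, o1.2, o2.1, o2.2]
    · obtain ⟨i, hi⟩ := not_off o2
      have e1 := key d.symm n1 hd i hi o1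
      rw [← chi_side d.symm i hi o1, chi_anti _ _ _ _ d] at e1
      have e2 := base0 _ n2 i hi
      change _ = compInd k (G.copy r v w hb ⟨d.src, n1⟩) at e1
      rw [e2, zero_sub, ← e1, neg_neg]
  · obtain ⟨i, hi⟩ := not_off o1
    rw [base0 _ n1 i hi]
    by_cases o2 : Off v w d.tgt
    · rw [← key d n2 hd i hi o2, ← chi_side d i hi o2]; ring
    · obtain ⟨j, hj⟩ := not_off o2
      rw [base0 _ n2 j hj]
      have := notMem_Kset_of_sides hG hn d hi hj k
      simp [chi, g, this]

theorem csum_chi_K (hG : Good r G) (hvw : v ≠ w) (hn : Near r v w) (k : G.LocalComp r v w)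
    {x y : (G.expl r v w).V} {p : List (G.expl r v w).Dart} (hp : Wk x p y) :
    csum (chi v (Kset r v w k) w (Kset r v w k)) (p.map Dart.down') =
      compInd k y - compInd k x := by
  rw [← csum_potential (c := fun d => chi v (Kset r v w k) w (Kset r v w k) d.down')
    (compInd k) hp fun d _ => chi_K hG hvw hn k d]
  simp [csum, Function.comp_def]

/-- A short closed walk through a base vertex stays in the ball around it, hence lifts to the
explorer-neighbourhood, where the indicator of `k` is a potential. Both base vertices have indicator
0, which also settles the walks from `v` to `w`. -/
theorem bal_K (hG : Good r G) (hvw : v ≠ w) (hn : Near r v w) (k : G.LocalComp r v w) :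
    Bal r v (Kset r v w k) w (Kset r v w k) := by
  constructor
  · refine van_of_base {u | ¬ Off v w u} ?_ ?_
    · intro x p hx hp
      obtain ⟨i, rfl⟩ := not_off hx
      obtain ⟨hy, p', h1, h2, _⟩ := exists_lift_expl (G.side_eq v w i) hp.1
        (fun d hd => hp.mem_ballE_left hd) (G.self_mem_ballV r _)
      rw [← h2, csum_chi_K hG hvw hn k h1, sub_self]
    · intro d h1 h2
      rw [Set.mem_ofPred_eq, not_not] at h1 h2
      simp [chi, g, h1.1, h1.2, h2.1, h2.2]
  · intro D hD
    obtain ⟨hy, p', h1, h2, _⟩ := exists_lift_expl (.inl rfl : v = v ∨ v = w) hD.1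
      (fun d hd => hD.mem_ballE_left hd) (G.self_mem_ballV r _)
    rw [← h2, csum_chi_K hG hvw hn k h1]
    rw [(copy_eq_base hG.pos hn _ ⟨w, hy⟩ true).2 rfl,
      (copy_eq_base hG.pos hn _ ⟨v, _⟩ false).2 rfl, compInd_base, compInd_base, sub_self]

/-- The chi-value of a dart leaving the separator. -/
theorem chi_side (hvw : v ≠ w) {A B : Set G.E} {d : G.Dart} {i : Bool}
    (h1 : d.src = G.side v w i) (h2 : Off v w d.tgt) [Decidable (d.e ∈ cond i B A)] :
    chi v A w B d = if d.e ∈ cond i B A then (1 : ℤ) else 0 := by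
  cases i
  · have h1 : d.src = v := h1
    by_cases h3 : d.e ∈ A <;> simp [chi, g, h1, h2.1, h2.2, hvw, h3]
  · have h1 : d.src = w := h1
    by_cases h3 : d.e ∈ B <;> simp [chi, g, h1, h2.1, h2.2, hvw.symm, h3]

theorem Bal.pot_side {A B : Set G.E} (h : Bal r v A w B) (hn : Near r v w) {b : G.V}
    (hb : b = v ∨ b = w) (i : Bool) : pot r (chi v A w B) b (G.side v w i) = 0 := by
  obtain ⟨p, hp⟩ := hn
  rcases hb with rfl | rfl <;> cases i
  · exact pot_self (chi_anti _ _ _ _) h.1 _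
  · rw [pot_eq (chi_anti _ _ _ _) h.1 (show SW r b p (G.side b w true) from hp), h.2 p hp]
  · rw [pot_eq (chi_anti _ _ _ _) h.1 (show SW r b (rev p) (G.side v b false) from hp.symm),
      csum_rev (chi_anti _ _ _ _), h.2 p hp, neg_zero]
  · exact pot_self (chi_anti _ _ _ _) h.1 _

/-- A separation does not split local components. -/
theorem Bal.const_on_K (hG : Good r G) (hvw : v ≠ w) {A B : Set G.E} (h : Bal r v A w B)
    (hn : Near r v w) {d d' : G.Dart} {i j : Bool} (h1 : d.src = G.side v w i)
    (h2 : Off v w d.tgt) (h1' : d'.src = G.side v w j) (h2' : Off v w d'.tgt)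
    {k : G.LocalComp r v w} (hk : d.e ∈ Kset r v w k) (hk' : d'.e ∈ Kset r v w k) :
    d.e ∈ cond i B A ↔ d'.e ∈ cond j B A := by
  classical
  have hE : d.e ∈ G.ballE r (G.side v w i) := h1 ▸ hG.edgeClose.mem_left d
  have hE' : d'.e ∈ G.ballE r (G.side v w j) := h1' ▸ hG.edgeClose.mem_left d'
  have hu := mem_ballV.2 (near_of_mem_ballE hE).2
  have hu' := mem_ballV.2 (near_of_mem_ballE hE').2
  have e1 := (mem_Kset_iff hG hn h1 h2 (G.side_eq v w i) hE hu).1 hk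
  have e2 := (mem_Kset_iff hG hn h1' h2' (G.side_eq v w j) hE' hu').1 hk'
  -- At the far end of an edge leaving the separator, the potential is 1 or 0 according to whether
  -- the edge belongs to the chosen side.
  have := h.pot_reach hG hn (G.side_eq v w i) (G.side_eq v w j) hu hu' h2 h2'
    (SimpleGraph.ConnectedComponent.eq.1 (e1.trans e2.symm))
  rw [pot_step (chi_anti _ _ _ _) h.1 hE, pot_step (chi_anti _ _ _ _) h.1 hE', h1, h1',
    h.pot_side hn (G.side_eq v w i), h.pot_side hn (G.side_eq v w j), chi_side hvw h1 h2,
    chi_side hvw h1' h2', zero_add, zero_add] at this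
  by_cases c1 : d.e ∈ cond i B A <;> by_cases c2 : d'.e ∈ cond j B A <;> simp_all

/-- On a short walk from a base vertex to a vertex of `k`, the last step that leaves the separator
enters `k`. -/
theorem exists_dart_comp (hG : Good r G) (hn : Near r v w) (k : G.LocalComp r v w) :
    ∃ (d : G.Dart) (i : Bool), d.src = G.side v w i ∧ Off v w d.tgt ∧ d.e ∈ Kset r v w k := by
  induction k using SimpleGraph.ConnectedComponent.ind with | _ z =>
  obtain ⟨b, hb, u, hu, ho, rfl⟩ := exists_pz hG.pos hn z
  obtain ⟨p, hp⟩ := mem_ballV.1 hu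
  induction p using List.reverseRecOn generalizing u with
  | nil =>
    obtain rfl := hp.1
    rcases hb with rfl | rfl
    · exact absurd rfl ho.1
    · exact absurd rfl ho.2
  | append_singleton p d ih =>
    obtain ⟨h1, h2, _⟩ := SW.prefix (q := []) hp
    obtain rfl : d.tgt = u := (wk_split.1 hp.1).2
    have hE := h2.mem_ballE_left (d := d) (by simp)
    by_cases o : Off v w d.src
    · obtain ⟨d', i, h3, h4, h5⟩ := ih d.src (mem_ballV.2 ⟨p, h1⟩) o h1
      refine ⟨d', i, h3, h4, ?_⟩
      rwa [← SimpleGraph.ConnectedComponent.eq.2 (pz_reach hb hE (mem_ballV.2 ⟨p, h1⟩) hu o ho)]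
    · obtain ⟨i, hi⟩ := not_off o
      exact ⟨d, i, hi, ho, (mem_Kset_iff hG hn hi ho hb hE hu).2 rfl⟩

/-- A local component gives a separation by `bal_K`, with edges into a second component on the other
side. Conversely a separation cannot split a component, so edges on both sides require two
components. -/
theorem isLocalSep_iff (hG : Good r G) : G.IsLocalSep r v w ↔ LS r v w := by
  rw [IsLocalSep, mem_ballV, LS]
  refine and_congr_right fun hvw => and_congr_right fun hn => ⟨?_, ?_⟩
  · intro h
    simp only [SimpleGraph.Preconnected, not_forall] at h
    obtain ⟨z, z', hz⟩ := h
    refine ⟨Kset r v w (compOf z), Kset r v w (compOf z), bal_K hG hvw hn _, ?_, ?_⟩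
    · obtain ⟨d, i, h1, h2, h3⟩ := exists_dart_comp hG hn (compOf z)
      cases i
      · exact ⟨d, .inl ⟨h1, h2.2, h3⟩⟩
      · exact ⟨d, .inr ⟨h1, h2.1, h3⟩⟩
    · obtain ⟨d, i, h1, h2, h3⟩ := exists_dart_comp hG hn (compOf z')
      have h4 : d.e ∉ Kset r v w (compOf z) := fun h =>
        hz (SimpleGraph.ConnectedComponent.eq.1 (Kset_disjoint hG hn h h3))
      cases i
      · exact ⟨d, .inl ⟨h1, h2.2, h4⟩⟩
      · exact ⟨d, .inr ⟨h1, h2.1, h4⟩⟩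
  · rintro ⟨A, B, hB, ⟨d, hd⟩, d', hd'⟩ hpre
    have conv : ∀ (P Q : Prop) (d : G.Dart), (d.src = v ∧ d.tgt ≠ w ∧ P ∨ d.src = w ∧ d.tgt ≠ v ∧ Q) →
        ∃ i, d.src = G.side v w i ∧ Off v w d.tgt ∧ cond i Q P := by
      rintro P Q d (⟨h1, h2, h3⟩ | ⟨h1, h2, h3⟩)
      · exact ⟨false, h1, ⟨fun h => hG.noloop d (h1.trans h.symm), h2⟩, h3⟩
      · exact ⟨true, h1, ⟨h2, fun h => hG.noloop d (h1.trans h.symm)⟩, h3⟩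
    obtain ⟨i, h1, h2, h3⟩ := conv _ _ d hd
    obtain ⟨j, h1', h2', h3'⟩ := conv _ _ d' hd'
    obtain ⟨k, hk⟩ := exists_unique_comp hG hn h1 h2
    obtain ⟨k', hk'⟩ := exists_unique_comp hG hn h1' h2'
    have : k = k' := by
      induction k using SimpleGraph.ConnectedComponent.ind with | _ z =>
      induction k' using SimpleGraph.ConnectedComponent.ind with | _ z' =>
      exact SimpleGraph.ConnectedComponent.eq.2 (hpre z z')
    subst this
    have := hB.const_on_K hG hvw hn h1 h2 h1' h2' ((hk k).2 rfl) ((hk' k).2 rfl)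
    cases i <;> cases j <;> simp_all

/-! ### Torso lengths -/

/-- Lifting `P` to the explorer-neighbourhood, the indicator of `k` starts at 0 and never changes,
so the lift avoids `k`. The witness is kept in the conclusion because the infimum is meaningful only
for a nonempty set. -/
theorem torsoLen_le (hG : Good r G) (hvw : v ≠ w) (hn : Near r v w) (k : G.LocalComp r v w)
    {P : List G.Dart} (hP : SW r v P w) (hK : ∀ d ∈ P, d.e ∉ Kset r v w k) :
    (∃ p, (G.expl r v w).IsWalk (G.base r v w false) p (G.base r v w true) ∧
      (G.expl r v w).length p = plen P ∧ ∀ f ∈ p, ∀ z : (G.puncturedExpl r v w).V,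
      z.1 ∈ (G.expl r v w).ends f → compOf z ≠ k) ∧ G.torsoLen r v w k ≤ plen P := by
  classical
  have hmem : ∃ p, (G.expl r v w).IsWalk (G.base r v w false) p (G.base r v w true) ∧
      (G.expl r v w).length p = plen P ∧ ∀ f ∈ p, ∀ z : (G.puncturedExpl r v w).V,
      z.1 ∈ (G.expl r v w).ends f → compOf z ≠ k := by
    obtain ⟨hy, p', h1, h2, h3⟩ := exists_lift_expl (.inl rfl : v = v ∨ v = w) hP.1
      (fun d hd => hP.mem_ballE_left hd) (G.self_mem_ballV r _)
    rw [(copy_eq_base hG.pos hn _ ⟨w, hy⟩ true).2 rfl,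
      (copy_eq_base hG.pos hn _ ⟨v, _⟩ false).2 rfl] at h1
    refine ⟨p'.map Dart.e, isWalk_iff.2 ⟨p', h1, rfl⟩, by rw [length_map_e, ← h2, plen_down'], ?_⟩
    intro f hf z hz
    obtain ⟨d, hd, rfl⟩ := List.mem_map.1 hf
    rw [d.h] at hz
    obtain ⟨p1, p2, rfl⟩ := List.append_of_mem hd
    have zero : ∀ q : List (G.expl r v w).Dart, (∀ d' ∈ q, d' ∈ p1 ++ d :: p2) →
        csum (chi v (Kset r v w k) w (Kset r v w k)) (q.map Dart.down') = 0 := by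
      intro q hq
      refine csum_eq_zero fun d' hd' => ?_
      have : d'.e ∉ Kset r v w k := by
        apply hK
        obtain ⟨d'', hd'', h6⟩ := List.mem_map.1 hd'
        rw [← h2, ← h6]
        exact List.mem_map_of_mem (f := Dart.down') (hq d'' hd'')
      simp [chi, g_of_notMem this]
    have hz0 : compInd k z.1 = 0 := by
      obtain ⟨h4, h5⟩ := wk_split.1 h1
      rcases Sym2.mem_iff.1 hz with h | h
      · have := csum_chi_K hG hvw hn k h4
        rw [zero p1 (fun d' hd' => by simp [hd']), compInd_base] at this
        rw [h]; omega
      · have := csum_chi_K hG hvw hn k h5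
        rw [zero p2 (fun d' hd' => by simp [hd']), compInd_base] at this
        rw [h]; omega
    rw [compInd_pz] at hz0
    by_contra hc
    simp [hc] at hz0
  exact ⟨hmem, Nat.sInf_le hmem⟩

/-- The infimum is attained in the explorer-neighbourhood. Projecting a minimiser gives a walk no
longer than `P`, so whatever closes up `P` closes it up too. -/
theorem exists_torso_walk (hG : Good r G) (hvw : v ≠ w) (hn : Near r v w)
    (k : G.LocalComp r v w) {P : List G.Dart} (hP : SW r v P w)
    (hK : ∀ d ∈ P, d.e ∉ Kset r v w k) :
    ∃ T, SW r v T w ∧ plen T = G.torsoLen r v w k ∧ ∀ d ∈ T, d.e ∉ Kset r v w k := by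
  obtain ⟨hmem, hle⟩ := torsoLen_le hG hvw hn k hP hK
  have hne : {n | ∃ p, (G.expl r v w).IsWalk (G.base r v w false) p (G.base r v w true) ∧
      (G.expl r v w).length p = n ∧ ∀ f ∈ p, ∀ z : (G.puncturedExpl r v w).V,
      z.1 ∈ (G.expl r v w).ends f → compOf z ≠ k}.Nonempty := ⟨_, hmem⟩
  obtain ⟨q, h1, h2, h3⟩ := Nat.sInf_mem hne
  obtain ⟨p, h4, rfl⟩ := isWalk_iff.1 h1
  have h5 : plen (p.map Dart.down') = G.torsoLen r v w k := by
    rw [plen_down', ← length_map_e, h2]; rfl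
  refine ⟨p.map Dart.down', ?_, h5, ?_⟩
  · obtain ⟨_, q, hq, hr⟩ := hP
    exact ⟨h4.down', q, hq, le_trans_cast hr (by omega)⟩
  · intro d0 hd0 hK0
    obtain ⟨d, hd, rfl⟩ := List.mem_map.1 hd0
    obtain ⟨b, hb, d, hE, _, rfl⟩ := exists_explDart d
    rw [down'_explDart] at hK0
    have n1 := mem_ballV.2 (near_of_mem_ballE hE).1
    have n2 := mem_ballV.2 (near_of_mem_ballE hE).2
    obtain ⟨d', i, h6, h7, h8⟩ := exists_dart_of_mem_Kset hG hn hK0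
    rcases Dart.eq_or_symm h6 with rfl | rfl
    · refine h3 _ (List.mem_map_of_mem hd) (pz hb d'.tgt n2 h8) ?_
        ((mem_Kset_iff hG hn h7 h8 hb hE n2).1 hK0)
      rw [(explDart hb d' hE).h]; exact Sym2.mem_mk_right _ _
    · refine h3 _ (List.mem_map_of_mem hd) (pz hb d.src n1 h8) ?_
        ((mem_Kset_iff (d := d.symm) hG hn h7 h8 hb hE n1).1 hK0)
      rw [(explDart hb d hE).h]; exact Sym2.mem_mk_left _ _

theorem artLen (hG : Good r G) (hn : Near r v w) :
    (∃ T, Wk v T w ∧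
      plen T = sInf {n | (G.expl r v w).HasWalk (G.base r v w false) (G.base r v w true) n}) ∧
    ∀ q, SW r v q w →
      sInf {n | (G.expl r v w).HasWalk (G.base r v w false) (G.base r v w true) n} ≤ plen q := by
  have key : ∀ q, SW r v q w →
      (G.expl r v w).HasWalk (G.base r v w false) (G.base r v w true) (plen q) := by
    intro q hq
    obtain ⟨hy, p', h1, h2, h3⟩ := exists_lift_expl (.inl rfl : v = v ∨ v = w) hq.1
      (fun d hd => hq.mem_ballE_left hd) (G.self_mem_ballV r _)
    rw [(copy_eq_base hG.pos hn _ ⟨w, hy⟩ true).2 rfl,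
      (copy_eq_base hG.pos hn _ ⟨v, _⟩ false).2 rfl] at h1
    exact hasWalk_iff.2 ⟨p', h1, by rw [← h2, plen_down']⟩
  refine ⟨?_, fun q hq => Nat.sInf_le (key q hq)⟩
  obtain ⟨q, hq⟩ := hn
  obtain ⟨p, h1, h2⟩ := hasWalk_iff.1 (Nat.sInf_mem
    (s := {n | (G.expl r v w).HasWalk (G.base r v w false) (G.base r v w true) n}) ⟨_, key q hq⟩)
  exact ⟨p.map Dart.down', h1.down', by rw [plen_down', h2]⟩

end LenGraph

namespace LenGraph
variable {G : LenGraph.{u}} {r : ℕ∞} {v w : G.V}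

/-! ### Proper separations and alternation of crossing pairs. -/

theorem g_eq_univ {A : Set G.E} (h : ∀ d : G.Dart, d.src = v → d.e ∈ A) :
    g v A = g v Set.univ := by
  funext d
  have h2 : d.tgt = v → d.e ∈ A := fun h3 => h d.symm h3
  by_cases h3 : d.src = v <;> by_cases h4 : d.tgt = v <;> simp_all [g]

theorem g_eq_zero {A : Set G.E} (h : ∀ d : G.Dart, d.src = v → d.e ∉ A) (d : G.Dart) :
    g v A d = 0 := by
  have h2 : d.tgt = v → d.e ∉ A := fun h3 => h d.symm h3
  by_cases h3 : d.src = v <;> by_cases h4 : d.tgt = v <;> simp_all [g]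

theorem not_proper {A : Set G.E} (h : ¬ Proper v A) :
    (∀ d : G.Dart, d.src = v → d.e ∈ A) ∨ ∀ d : G.Dart, d.src = v → d.e ∉ A := by
  by_contra hcon
  push Not at hcon
  obtain ⟨⟨d, h1, h2⟩, d', h3, h4⟩ := hcon
  exact h ⟨⟨d', h3, h4⟩, d, h1, h2⟩

theorem van_of_not_proper {A : Set G.E} (h : ¬ Proper v A) : Van r (g v A) := by
  classical
  intro x p hp
  rcases not_proper h with h | h
  · rw [g_eq_univ h, g_univ hp.1, sub_self]
  · exact csum_eq_zero fun d _ => g_eq_zero h d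

/-- On short closed walks the two cut cochains are negatives of each other. An improper set has
vanishing cochain there, and `link` forbids this for a proper one. -/
theorem Bal.proper_iff (hG : Good r G) {A B : Set G.E} (h : Van r (chi v A w B)) :
    Proper v A ↔ Proper w B := by
  have key : ∀ {v w : G.V} {A B : Set G.E}, Van r (chi v A w B) → Proper v A → Proper w B := by
    intro v w A B h hp
    by_contra hcon
    refine hG.link v A hp fun x p hx => ?_
    have h1 := h x p hx
    rw [csum_chi, van_of_not_proper hcon x p hx] at h1
    omega
  exact ⟨key h, key (chi_comm v A w B ▸ h)⟩

/-- A nontrivial separation splits the edges at both vertices. -/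
theorem Bal.proper (hG : Good r G) (hvw : v ≠ w) (hn : Near r v w) {A B : Set G.E}
    (h : Bal r v A w B) {d d' : G.Dart} (hd : (d.src = v ∧ d.e ∈ A) ∨ (d.src = w ∧ d.e ∈ B))
    (hd' : (d'.src = v ∧ d'.e ∉ A) ∨ (d'.src = w ∧ d'.e ∉ B)) : Proper v A := by
  classical
  by_contra hcon
  have hcon' := fun h' => hcon ((Bal.proper_iff hG h.1).2 h')
  obtain ⟨D, hD⟩ := hn
  have hsum := h.2 D hD
  rw [csum_chi] at hsum
  -- If one of the sets is full at its vertex and the other empty, a short `v`–`w` walk has sum 1 or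
  -- -1 instead of 0. If both are full or both empty, one of the sides contains no edge.
  rcases not_proper hcon with h1 | h1 <;> rcases not_proper hcon' with h2 | h2
  · rcases hd' with ⟨h3, h4⟩ | ⟨h3, h4⟩
    · exact h4 (h1 _ h3)
    · exact h4 (h2 _ h3)
  · rw [g_eq_univ h1, g_univ hD.1, csum_eq_zero fun d _ => g_eq_zero h2 d] at hsum
    simp [hvw.symm] at hsum
  · rw [g_eq_univ h2, g_univ hD.1, csum_eq_zero fun d _ => g_eq_zero h1 d] at hsum
    simp [hvw] at hsum
  · rcases hd with ⟨h3, h4⟩ | ⟨h3, h4⟩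
    · exact h1 _ h3 h4
    · exact h2 _ h3 h4

theorem LS.exists_proper (hG : Good r G) (h : LS r v w) :
    ∃ A B, Bal r v A w B ∧ Proper v A ∧ Proper w B := by
  obtain ⟨h1, h2, A, B, h3, ⟨d, hd⟩, d', hd'⟩ := h
  have hp := h3.proper hG h1 h2 (hd.imp (fun h => ⟨h.1, h.2.2⟩) fun h => ⟨h.1, h.2.2⟩)
    (hd'.imp (fun h => ⟨h.1, h.2.2⟩) fun h => ⟨h.1, h.2.2⟩)
  exact ⟨A, B, h3, hp, (Bal.proper_iff hG h3.1).1 hp⟩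

/-- If the two cut cochains agree on short closed walks, then they form a separation. -/
theorem Bal.of_van (hG : Good r G) {A B : Set G.E} (hvw : v ≠ w)
    (h : Van r (chi v A w B)) (hp : Proper v A) : Bal r v A w B := by
  refine ⟨h, fun D hD => ?_⟩
  by_contra hs
  have hF := pot_eq (chi_anti _ _ _ _) h hD
  have hF0 := pot_self (chi_anti _ _ _ _) h v
  set F := pot r (chi v A w B) v with hFdef
  set s := csum (chi v A w B) D
  refine hG.link v A hp ?_
  refine van_of_base {v} ?_ fun d h1 h2 => g_of_ne h1 h2
  rintro x p rfl hx
  have hst : ∀ d ∈ p, F d.tgt = F d.src + chi x A w B d := fun d hd =>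
    pot_step (chi_anti _ _ _ _) h (hx.mem_ballE_left hd)
  have hnl := hG.noloop
  -- The potential takes values in `{0, 1}` next to `v` and in `{s, s + 1}` at and next to `w`. For
  -- `s < 0`, truncating below at 0 erases the jumps at `w` and keeps those at `v`; for `s > 0`,
  -- truncating above at 1 does. The truncation is then a potential for `g v A` alone, contradicting
  -- `link`.
  rcases lt_or_gt_of_ne hs with hs | hs
  · rw [csum_potential (fun u => max (F u) 0) hx.1, sub_self]
    intro d hd
    have h1 := hst d hd
    have h2 := hnl d
    by_cases c1 : d.src = x <;> by_cases c2 : d.tgt = x <;> by_cases c3 : d.src = w <;>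
      by_cases c4 : d.tgt = w <;> by_cases c5 : d.e ∈ A <;> by_cases c6 : d.e ∈ B <;>
      simp [chi, g, c1, c2, c3, c4, c5, c6, hF, hF0, hvw, hvw.symm] at h1 h2 ⊢ <;> grind
  · rw [csum_potential (fun u => min (F u) 1) hx.1, sub_self]
    intro d hd
    have h1 := hst d hd
    have h2 := hnl d
    by_cases c1 : d.src = x <;> by_cases c2 : d.tgt = x <;> by_cases c3 : d.src = w <;>
      by_cases c4 : d.tgt = w <;> by_cases c5 : d.e ∈ A <;> by_cases c6 : d.e ∈ B <;>
      simp [chi, g, c1, c2, c3, c4, c5, c6, hF, hF0, hvw, hvw.symm] at h1 h2 ⊢ <;> grind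

/-- A walk that does not visit `a` as the start of a step or at its end. -/
theorem csum_g_of_notMem {a x y : G.V} {p : List G.Dart} (hp : Wk x p y)
    (h : ∀ d ∈ p, d.src ≠ a) (hy : y ≠ a) (A : Set G.E) : csum (g a A) p = 0 := by
  refine csum_eq_zero fun d hd => g_of_ne (h d hd) fun h1 => ?_
  obtain ⟨d', h2, h3⟩ := hp.exists_src_of_tgt hd h1 hy
  exact h d' h2 h3

theorem exists_src_of_chi {A B : Set G.E} {x y : G.V} {p : List G.Dart} (hp : Wk x p y)
    (hy : Off v w y) (h : csum (chi v A w B) p ≠ 0) : ∃ d ∈ p, ∃ i, d.src = G.side v w i := by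
  by_contra hcon
  push Not at hcon
  refine h ?_
  rw [csum_chi, csum_g_of_notMem (a := v) hp (fun d hd => hcon d hd false) hy.1,
    csum_g_of_notMem (a := w) hp (fun d hd => hcon d hd true) hy.2, add_zero]

/-- Crossing separations alternate on a short cycle. -/
theorem cross_cycle (hG : Good r G) {A B A' B' : Set G.E} {a b : G.V}
    (hX : Bal r v A w B) (ha : Off v w a) (hb : Off v w b) (hab : a ≠ b) (hY : Bal r a A' b B')
    (hp : Proper a A') {D : List G.Dart} (hD : SW r a D b)
    (hne : csum (chi v A w B) D ≠ 0) :
    ∃ i R1 R2, Wk (G.side v w i) R1 (G.side v w !i) ∧ Wk (G.side v w !i) R2 (G.side v w i) ∧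
      Cyc r (G.side v w i) (R1 ++ R2) ∧ (∃ d ∈ R1, d.src = b) ∧ (∃ d ∈ R2, d.src = a) ∧
      csum (chi a A' b B') R1 ≠ 0 := by
  obtain ⟨x, C, hC, hCg⟩ := exists_cyc (g_anti _ _) (hG.link a A' hp)
  obtain ⟨d0, hd0, h0⟩ := exists_src_of_csum_g_ne hC.1.1 hCg
  obtain ⟨q, hq, hperm⟩ := hC.rotate_to hd0
  rw [← csum_perm _ hperm] at hCg
  rw [h0] at hq
  clear hperm hC hd0 C
  -- The two cut cochains of `{a, b}` cancel on short closed walks, so the cycle passes through `b`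
  -- as well.
  have hgb : csum (g b B') (d0 :: q) ≠ 0 := by
    have := hY.1 _ _ hq.1
    rw [csum_chi] at this; omega
  obtain ⟨d1, hd1, h1⟩ := exists_src_of_csum_g_ne hq.1.1 hgb
  have hd1q : d1 ∈ q := by
    rcases List.mem_cons.1 hd1 with rfl | h
    · exact absurd (h0.symm.trans h1) hab
    · exact h
  obtain ⟨q1, q2, rfl⟩ := List.append_of_mem hd1q
  have hs : SW r a ((d0 :: q1) ++ (d1 :: q2)) a := hq.1
  obtain ⟨w1, w2⟩ := wk_append.1 hs.1
  obtain ⟨w2, w3⟩ := w2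
  obtain rfl : d1.src = w1 := w3.1
  rw [h1] at w2 w3
  have s1 := hs.left w2
  have s2 := hs.right w3 w2
  -- By `Van.eq` each arc of the cycle between `a` and `b` has, up to sign, the same nonzero sum as
  -- `D`, so each arc visits the separator.
  have e1 : csum (chi v A w B) (d0 :: q1) ≠ 0 := by
    rw [hX.1.eq (chi_anti _ _ _ _) s1 hD]; exact hne
  have e2 : csum (chi v A w B) (d1 :: q2) ≠ 0 := by
    have := hX.1.eq (chi_anti _ _ _ _) s2 hD.symm
    rw [csum_rev (chi_anti _ _ _ _)] at this
    rw [this]; exact neg_ne_zero.2 hne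
  obtain ⟨f1, hf1, i, hi⟩ := exists_src_of_chi s1.1 hb e1
  obtain ⟨f2, hf2, j, hj⟩ := exists_src_of_chi s2.1 ha e2
  have hf1' : f1 ∈ q1 := by
    rcases List.mem_cons.1 hf1 with rfl | h
    · exact absurd (h0.symm.trans hi) (off_side ha i)
    · exact h
  have hf2' : f2 ∈ q2 := by
    rcases List.mem_cons.1 hf2 with rfl | h
    · exact absurd (h1.symm.trans hj) (off_side hb j)
    · exact h
  obtain ⟨q3, q4, rfl⟩ := List.append_of_mem hf1'
  obtain ⟨q5, q6, rfl⟩ := List.append_of_mem hf2'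
  have hnd := hq.2.2.1
  -- The two visits are different positions of a simple cycle, hence one is `v` and the other is
  -- `w`.
  have hij : j = !i := by
    have hne : f1.src ≠ f2.src := by
      intro h
      simp [List.nodup_append] at hnd
      grind
    rw [hi, hj] at hne
    cases i <;> cases j <;> simp_all
  subst hij
  have hrot : Cyc r f1.src (f1 :: (q4 ++ d1 :: (q5 ++ f2 :: q6)) ++ (d0 :: q3)) :=
    Cyc.rotate (p := d0 :: q3) (by simpa using hq)
  rw [hi] at hrot
  have hrot' : Cyc r (G.side v w i) ((f1 :: q4 ++ d1 :: q5) ++ (f2 :: q6 ++ d0 :: q3)) := by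
    simpa using hrot
  obtain ⟨z, z1, z2⟩ := wk_append.1 hrot'.1.1
  obtain rfl : f2.src = z := z2.1
  rw [hj] at z1 z2
  refine ⟨i, _, _, z1, z2, hrot', ⟨d1, by simp, h1⟩, ⟨d0, by simp, h0⟩, ?_⟩
  have hnd2 := hrot'.2.2.1
  rw [List.map_append, List.nodup_append] at hnd2
  obtain ⟨-, -, hdis⟩ := hnd2
  -- The arc `R1` misses `a` and `R2` misses `b`. So the sum of the full cochain over `R1` is the
  -- contribution of `b` to the whole cycle, which is nonzero.
  rw [csum_chi, csum_g_of_notMem z1 ?_ (off_side ha _).symm, zero_add]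
  · intro h
    apply hgb
    have hp : csum (g b B') (d0 :: (q3 ++ f1 :: q4 ++ d1 :: (q5 ++ f2 :: q6))) =
        csum (g b B') (f1 :: q4 ++ d1 :: q5) + csum (g b B') (f2 :: q6 ++ d0 :: q3) := by
      simp; ring
    rw [hp, h, zero_add]
    refine csum_g_of_notMem z2 ?_ (off_side hb i).symm B'
    intro d hd h3
    exact hdis d1.src (List.mem_map_of_mem (by simp)) d.src (List.mem_map_of_mem hd)
      (h1.trans h3.symm)
  · intro d hd h3
    exact hdis d.src (List.mem_map_of_mem hd) d0.src (List.mem_map_of_mem (by simp))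
      (h3.trans h0.symm)

/-- By `cross_cycle` the arc between `v` and `w` through `b` has nonzero sum for a separation at
`{a, b}`. -/
theorem LS.scross_symm (hG : Good r G) {a b : G.V} (hY : LS r a b)
    (h : SCross r v w a b) : SCross r a b v w := by
  obtain ⟨h1, h2, h3, h4, A, B, hX, D, hD, hne⟩ := h
  obtain ⟨A', B', hB', hp, _⟩ := hY.exists_proper hG
  obtain ⟨i, R1, R2, w1, w2, hC, -, -, hne'⟩ := cross_cycle hG hX ⟨h1, h2⟩ ⟨h3, h4⟩ hY.1 hB' hp hD hne
  have hs := hC.1.left w1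
  cases i
  · exact ⟨h1.symm, h3.symm, h2.symm, h4.symm, A', B', hB', R1, hs, hne'⟩
  · exact SCross.swap_right ⟨h2.symm, h4.symm, h1.symm, h3.symm, A', B', hB', R1, hs, hne'⟩

/-! ### Products of potentials -/

/-- The arc of `C` between `s` and `t` has as its sum a difference of potentials relative to `x`,
and by `Van.eq` any other short walk with the same ends has the same sum. This provides one
potential for all vertices of `C`. -/
theorem closed_pot {c : G.Dart → ℤ} (hc : Anti c) (h : Van r c) {x : G.V} {C : List G.Dart}
    (hC : SW r x C x) {s t : G.V} (hs : ∃ d ∈ C, d.src = s) (ht : ∃ d ∈ C, d.src = t)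
    {q : List G.Dart} (hq : SW r s q t) : csum c q = pot r c x t - pot r c x s := by
  have key : ∀ {s t : G.V} {p1 m p2 q : List G.Dart}, C = p1 ++ m ++ p2 → Wk x p1 s → Wk s m t →
      SW r s q t → csum c q = pot r c x t - pot r c x s := by
    intro s t p1 m p2 q hC' w1 w2 hq
    rw [hC'] at hC
    have h1 := hC.left (w1.append w2)
    rw [pot_eq hc h h1, pot_eq hc h (h1.left w1), h.eq hc hq (h1.right w2 w1)]
    simp
  obtain ⟨d, hd, rfl⟩ := hs
  obtain ⟨d', hd', rfl⟩ := ht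
  obtain ⟨p1, p2, hp⟩ := List.append_of_mem hd
  have w1 := hC.1
  rw [hp, wk_split] at w1
  obtain ⟨w1, w2⟩ := w1
  have hd'' : d' ∈ p1 ∨ d' ∈ d :: p2 := by rw [hp] at hd'; exact List.mem_append.1 hd'
  rcases hd'' with h' | h'
  · obtain ⟨p3, p4, rfl⟩ := List.append_of_mem h'
    obtain ⟨w3, w4⟩ := wk_split.1 w1
    have := key (p1 := p3) (m := d' :: p4) (p2 := d :: p2) (q := rev q) (by simp [hp]) w3
      ⟨rfl, w4⟩ hq.symm
    rw [csum_rev hc] at this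
    omega
  · obtain ⟨p3, p4, hp'⟩ := List.append_of_mem h'
    have w3 : Wk d.src (p3 ++ d' :: p4) x := by rw [← hp']; exact ⟨rfl, w2⟩
    exact key (p1 := p1) (m := p3) (p2 := d' :: p4) (by rw [hp, hp']; simp) w1
      (wk_split.1 w3).1 hq

/-- The product of the potentials of two separations. -/
theorem product_van {A B A' B' : Set G.E} {a b : G.V} (hvw : v ≠ w) (hab : a ≠ b)
    (ha : Off v w a) (hb : Off v w b) (κ l : G.V → ℤ) (hl : ∀ d : G.Dart, d.src ≠ d.tgt)
    (hκ : ∀ s t q, s ∈ ({v, w, a, b} : Set G.V) → t ∈ ({v, w, a, b} : Set G.V) → SW r s q t →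
      csum (chi v A w B) q = κ t - κ s)
    (hL : ∀ s t q, s ∈ ({v, w, a, b} : Set G.V) → t ∈ ({v, w, a, b} : Set G.V) → SW r s q t →
      csum (chi a A' b B') q = l t - l s)
    (kv : κ v = 0) (kw : κ w = 0) (la : l a = 0) (lb : l b = 0) :
    Van r (fun d => (l v * g v A d + l w * g w B d) + (κ a * g a A' d + κ b * g b B' d)) := by
  have five : ∀ s : G.V, s = v ∨ s = w ∨ s = a ∨ s = b ∨ (s ≠ v ∧ s ≠ w ∧ s ≠ a ∧ s ≠ b) := by
    intro s
    by_cases c1 : s = v <;> by_cases c2 : s = w <;> by_cases c3 : s = a <;> simp [c1, c2, c3, em]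
  refine van_of_base {v, w, a, b} ?_ ?_
  · intro x p hx hp
    -- When a dart leaves `v` for an ordinary vertex, the first factor changes by `g v A` and the
    -- second keeps the value `l v`; the other three vertices behave alike. On a dart joining one
    -- pair to the other, both factors change, but the product is zero at both ends and the two
    -- terms of the formula cancel.
    rw [csum_telescope (fun q => (κ x + csum (chi v A w B) q) * (l x + csum (chi a A' b B') q)) p]
    · rw [hκ x x p hx hx hp, hL x x p hx hx hp]; simp
    · rintro q d s rfl
      obtain ⟨h1, h2, _⟩ := hp.prefix
      have f1 := hκ x d.src q hx
      have f2 := hL x d.src q hx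
      have f3 := hκ x d.tgt (q ++ [d]) hx
      have f4 := hL x d.tgt (q ++ [d]) hx
      simp only [h1, h2, forall_const, csum_append, csum_cons, csum_nil, add_zero] at f1 f2 f3 f4 ⊢
      have hs := five d.src
      have ht := five d.tgt
      have hloop := hl d
      obtain ⟨a1, a2⟩ := ha
      obtain ⟨b1, b2⟩ := hb
      have n1 := a1.symm
      have n2 := a2.symm
      have n3 := b1.symm
      have n4 := b2.symm
      have n5 := hab.symm
      have n6 := hvw.symm
      have g1 := @g_of_ne G v A d
      have g2 := @g_of_ne G w B d
      have g3 := @g_of_ne G a A' d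
      have g4 := @g_of_ne G b B' d
      simp only [chi] at f1 f2 f3 f4 ⊢
      generalize csum (fun d => g v A d + g w B d) q = K0 at *
      generalize csum (fun d => g a A' d + g b B' d) q = L0 at *
      generalize g v A d = gv at *
      generalize g w B d = gw at *
      generalize g a A' d = ga at *
      generalize g b B' d = gb at *
      generalize d.src = s at *
      generalize d.tgt = t at *
      clear hκ hL h1 h2 hp hl
      simp only [Set.mem_insert_iff, Set.mem_singleton_iff] at f1 f2 f3 f4
      rcases hs with c | c | c | c | ⟨c1, c2, c3, c4⟩ <;> rcases ht with e | e | e | e | ⟨e1, e2, e3, e4⟩ <;>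
        (try subst c) <;> (try subst e) <;>
        simp_all only [ne_eq, not_false_eq_true, not_true_eq_false, or_true, or_false, forall_const, false_implies, zero_add, add_zero, mul_zero, or_self] <;>
        grind
  · intro d h1 h2
    simp only [Set.mem_insert_iff, Set.mem_singleton_iff, not_or] at h1 h2
    rw [g_of_ne h1.1 h2.1, g_of_ne h1.2.1 h2.2.1, g_of_ne h1.2.2.1 h2.2.2.1,
      g_of_ne h1.2.2.2 h2.2.2.2]
    simp

end LenGraph

namespace LenGraph
variable {G : LenGraph.{u}} {r : ℕ∞} {v w : G.V}

/-! ### Cut cochains of crossing separations. -/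

/-- Any two vertices of a short closed walk are near. -/
theorem near_of_closed {x : G.V} {C : List G.Dart} (hC : SW r x C x) {s t : G.V}
    (hs : ∃ d ∈ C, d.src = s) (ht : ∃ d ∈ C, d.src = t) : Near r s t := by
  obtain ⟨d, hd, rfl⟩ := hs
  obtain ⟨d', hd', rfl⟩ := ht
  obtain ⟨p1, p2, rfl⟩ := List.append_of_mem hd
  obtain ⟨w1, w2⟩ := wk_split.1 hC.1
  have hrot : SW r d.src (d :: p2 ++ p1) d.src := SW.of_closed (Wk.append ⟨rfl, w2⟩ w1)
    (le_trans_cast hC.closed_le (by simp; omega))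
  have hd2 : d' ∈ d :: p2 ++ p1 := by simp at hd' ⊢; tauto
  obtain ⟨q1, q2, h⟩ := List.append_of_mem hd2
  rw [h] at hrot
  exact ⟨q1, hrot.prefix.1⟩

/-- All four vertices lie on the cycle of `cross_cycle`, so both separations have common potentials
there, normalised to vanish on their own pair. The values `l v` and `l w` differ because an arc of
this cycle joining `v` and `w` has nonzero sum for the separation at `{a, b}`. -/
theorem cross_pots (hG : Good r G) {A B A' B' : Set G.E} {a b : G.V} (hvw : v ≠ w)
    (hab : a ≠ b) (hc : SCross r v w a b) (hX : Bal r v A w B)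
    (hY : Bal r a A' b B') (hp : Proper a A') :
    ∃ κ l : G.V → ℤ,
      (∀ s t q, s ∈ ({v, w, a, b} : Set G.V) → t ∈ ({v, w, a, b} : Set G.V) → SW r s q t →
        csum (chi v A w B) q = κ t - κ s) ∧
      (∀ s t q, s ∈ ({v, w, a, b} : Set G.V) → t ∈ ({v, w, a, b} : Set G.V) → SW r s q t →
        csum (chi a A' b B') q = l t - l s) ∧
      κ v = 0 ∧ κ w = 0 ∧ l a = 0 ∧ l b = 0 ∧ (κ a = 0 ∨ κ a = 1) ∧ (κ b = 0 ∨ κ b = 1) ∧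
      (l v = 0 ∨ l v = 1) ∧ (l w = 0 ∨ l w = 1) ∧ l v ≠ l w ∧
      (∀ s t, s ∈ ({v, w, a, b} : Set G.V) → t ∈ ({v, w, a, b} : Set G.V) → Near r s t) := by
  obtain ⟨h1, h2, h3, h4, A0, B0, hX0, D0, hD0, hne⟩ := hc
  obtain ⟨i, R1, R2, w1, w2, hC, hb1, ha2, hneR⟩ :=
    cross_cycle hG hX0 ⟨h1, h2⟩ ⟨h3, h4⟩ hab hY hp hD0 hne
  have hsrc : ∀ j, ∃ d ∈ R1 ++ R2, d.src = G.side v w j := by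
    have k1 : ∀ {x y : G.V} {R : List G.Dart}, Wk x R y → x ≠ y → ∃ d ∈ R, d.src = x := by
      intro x y R hR hxy
      cases R with
      | nil => exact absurd hR hxy
      | cons d R => exact ⟨d, by simp, hR.1⟩
    have hside : ∀ j, G.side v w j ≠ G.side v w !j := by
      intro j; cases j
      · exact hvw
      · exact hvw.symm
    obtain ⟨d, hd, hd'⟩ := k1 w1 (hside i)
    obtain ⟨e, he, he'⟩ := k1 w2 (by simpa using (hside i).symm)
    intro j
    by_cases hj : j = i
    · subst hj; exact ⟨d, by simp [hd], hd'⟩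
    · obtain rfl : j = !i := by cases i <;> cases j <;> simp_all
      exact ⟨e, by simp [he], he'⟩
  have hmem : ∀ s, s ∈ ({v, w, a, b} : Set G.V) → ∃ d ∈ R1 ++ R2, d.src = s := by
    rintro s (rfl | rfl | rfl | rfl)
    · exact hsrc false
    · exact hsrc true
    · obtain ⟨d, hd, h⟩ := ha2; exact ⟨d, by simp [hd], h⟩
    · obtain ⟨d, hd, h⟩ := hb1; exact ⟨d, by simp [hd], h⟩
  have hnear : ∀ s t, s ∈ ({v, w, a, b} : Set G.V) → t ∈ ({v, w, a, b} : Set G.V) → Near r s t :=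
    fun s t hs ht => near_of_closed hC.1 (hmem s hs) (hmem t ht)
  set x := G.side v w i
  let κ : G.V → ℤ := fun t => pot r (chi v A w B) x t - pot r (chi v A w B) x v
  let l : G.V → ℤ := fun t => pot r (chi a A' b B') x t - pot r (chi a A' b B') x a
  have hκ : ∀ s t q, s ∈ ({v, w, a, b} : Set G.V) → t ∈ ({v, w, a, b} : Set G.V) → SW r s q t →
        csum (chi v A w B) q = κ t - κ s := by
    intro s t q hs ht hq
    rw [closed_pot (chi_anti _ _ _ _) hX.1 hC.1 (hmem s hs) (hmem t ht) hq]
    simp only [κ]; ring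
  have hl : ∀ s t q, s ∈ ({v, w, a, b} : Set G.V) → t ∈ ({v, w, a, b} : Set G.V) → SW r s q t →
        csum (chi a A' b B') q = l t - l s := by
    intro s t q hs ht hq
    rw [closed_pot (chi_anti _ _ _ _) hY.1 hC.1 (hmem s hs) (hmem t ht) hq]
    simp only [l]; ring
  have kv : κ v = 0 := sub_self _
  have la : l a = 0 := sub_self _
  have m1 : v ∈ ({v, w, a, b} : Set G.V) := by simp
  have m2 : w ∈ ({v, w, a, b} : Set G.V) := by simp
  have m3 : a ∈ ({v, w, a, b} : Set G.V) := by simp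
  have m4 : b ∈ ({v, w, a, b} : Set G.V) := by simp
  have kw : κ w = 0 := by
    obtain ⟨q, hq⟩ := hnear v w m1 m2
    have := hκ v w q m1 m2 hq
    rw [hX.2 q hq, kv] at this; omega
  have lb : l b = 0 := by
    obtain ⟨q, hq⟩ := hnear a b m3 m4
    have := hl a b q m3 m4 hq
    rw [hY.2 q hq, la] at this; omega
  have k01 : ∀ t ∈ ({v, w, a, b} : Set G.V), t ≠ v → t ≠ w → κ t = 0 ∨ κ t = 1 := by
    intro t ht e1 e2
    obtain ⟨q, hq⟩ := hnear v t m1 ht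
    have := hκ v t q m1 ht hq
    rw [kv, sub_zero] at this
    rw [← this]
    exact hX.pot01 hvw hq e1 e2
  have l01 : ∀ t ∈ ({v, w, a, b} : Set G.V), t ≠ a → t ≠ b → l t = 0 ∨ l t = 1 := by
    intro t ht e1 e2
    obtain ⟨q, hq⟩ := hnear a t m3 ht
    have := hl a t q m3 ht hq
    rw [la, sub_zero] at this
    rw [← this]
    exact hY.pot01 hab hq e1 e2
  refine ⟨κ, l, hκ, hl, kv, kw, la, lb, k01 a m3 h1 h2, k01 b m4 h3 h4, l01 v m1 h1.symm h3.symm,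
    l01 w m2 h2.symm h4.symm, ?_, hnear⟩
  intro hlv
  apply hneR
  have hR1 := hC.1.left w1
  cases i
  · rw [hl v w R1 m1 m2 hR1, hlv, sub_self]
  · rw [hl w v R1 m2 m1 hR1, hlv, sub_self]

theorem csum_chi_compl {A B : Set G.E} {x y : G.V} {p : List G.Dart} (hp : Wk x p y)
    [DecidableEq G.V] :
    csum (chi v Aᶜ w Bᶜ) p = (if x = v then 1 else 0) - (if y = v then 1 else 0) +
      ((if x = w then 1 else 0) - (if y = w then 1 else 0)) - csum (chi v A w B) p := by
  rw [csum_chi, csum_chi, csum_g_compl, csum_g_compl, g_univ hp, g_univ hp]; ring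

/-- If `{a, b}` crosses `{v, w}`, then it does so with respect to all separations. -/
theorem SCross.ne_zero (hG : Good r G) {A B : Set G.E} {a b : G.V} (hvw : v ≠ w)
    (hY : LS r a b) (hc : SCross r v w a b) (hX : Bal r v A w B) (hp : Proper v A)
    {D : List G.Dart} (hD : SW r a D b) : csum (chi v A w B) D ≠ 0 := by
  classical
  intro h0
  obtain ⟨A', B', hY', hp', -⟩ := hY.exists_proper hG
  have m1 : v ∈ ({v, w, a, b} : Set G.V) := by simp
  have m3 : a ∈ ({v, w, a, b} : Set G.V) := by simp
  have m4 : b ∈ ({v, w, a, b} : Set G.V) := by simp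
  obtain ⟨n1, n2, n3, n4, -⟩ := id hc
  -- If the potential is zero at `a` and at `b`, the product relation reduces to `l v * g v A + l w
  -- * g w B`, where one coefficient is 1 and the other 0. This contradicts `link`.
  have aux : ∀ {A B : Set G.E}, Bal r v A w B → Proper v A → csum (chi v A w B) D = 0 →
      (∀ P, SW r v P a → csum (chi v A w B) P = 0) → False := by
    intro A B hX hp h0 hP
    obtain ⟨κ, l, hκ, hl, kv, kw, la, lb, ka, kb, lv, lw, hne, hnear⟩ :=
      cross_pots hG hvw hY.1 hc hX hY' hp'
    have hka : κ a = 0 := by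
      obtain ⟨P, hPs⟩ := hnear v a m1 m3
      have := hκ v a P m1 m3 hPs
      rw [hP P hPs] at this; omega
    have hkb : κ b = 0 := by
      have := hκ a b D m3 m4 hD
      omega
    have hvan := product_van hvw hY.1 ⟨n1, n2⟩ ⟨n3, n4⟩ κ l hG.noloop hκ hl kv kw la lb
    simp only [hka, hkb, zero_mul, add_zero] at hvan
    rcases lv with lv | lv <;> rcases lw with lw | lw
    · exact hne (lv.trans lw.symm)
    · simp only [lv, lw, zero_mul, one_mul, zero_add] at hvan
      exact hG.link w B ((Bal.proper_iff hG hX.1).1 hp) hvan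
    · simp only [lv, lw, zero_mul, one_mul, add_zero] at hvan
      exact hG.link v A hp hvan
    · exact hne (lv.trans lw.symm)
  obtain ⟨κ, l, hκ, hl, kv, kw, la, lb, ka, kb, lv, lw, hne, hnear⟩ :=
      cross_pots hG hvw hY.1 hc hX hY' hp'
  have hP : ∀ P, SW r v P a → csum (chi v A w B) P = κ a := by
    intro P hPs
    have := hκ v a P m1 m3 hPs
    omega
  -- A common value 1 at `a` and `b` is turned into 0 by passing to the complementary separation.
  rcases ka with ka | ka
  · exact aux hX hp h0 fun P hPs => (hP P hPs).trans ka
  · refine aux (hX.compl hvw) hp.compl ?_ fun P hPs => ?_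
    · rw [csum_chi_compl hD.1, h0]; simp [n1, n2, n3, n4]
    · rw [csum_chi_compl hPs.1, hP P hPs, ka]; simp [n1, n2, hvw]

/-- Crossing separations have the same cut cochain up to sign. -/
theorem SCross.van (hG : Good r G) {A B A' B' : Set G.E} {a b : G.V} (hvw : v ≠ w)
    (hY : LS r a b) (hc : SCross r v w a b) (hX : Bal r v A w B) (hp : Proper v A)
    (hY' : Bal r a A' b B') (hp' : Proper a A') :
    (∀ x p, SW r x p x → csum (g a A') p = csum (g v A) p) ∨
      ∀ x p, SW r x p x → csum (g a A') p = - csum (g v A) p := by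
  obtain ⟨n1, n2, n3, n4, -⟩ := id hc
  obtain ⟨κ, l, hκ, hl, kv, kw, la, lb, ka, kb, lv, lw, hne, hnear⟩ :=
      cross_pots hG hvw hY.1 hc hX hY' hp'
  have hvan := product_van hvw hY.1 ⟨n1, n2⟩ ⟨n3, n4⟩ κ l hG.noloop hκ hl kv kw la lb
  have hk : κ a ≠ κ b := by
    obtain ⟨D, hD⟩ := hnear a b (by simp) (by simp)
    have := hκ a b D (by simp) (by simp) hD
    have := hc.ne_zero hG hvw hY hX hp hD
    omega
  have e1 : ∀ x p, SW r x p x → csum (g w B) p = - csum (g v A) p := by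
    intro x p h; have := hX.1 x p h; rw [csum_chi] at this; omega
  have e2 : ∀ x p, SW r x p x → csum (g b B') p = - csum (g a A') p := by
    intro x p h; have := hY'.1 x p h; rw [csum_chi] at this; omega
  -- Substituting `e1` and `e2` turns this into `(l v - l w) * g v A + (κ a - κ b) * g a A' = 0` on
  -- short closed walks, with both differences equal to 1 or -1.
  have hsum : ∀ x p, SW r x p x → (l v * csum (g v A) p + l w * csum (g w B) p) +
      (κ a * csum (g a A') p + κ b * csum (g b B') p) = 0 := by
    intro x p h
    have h1 := hvan x p h
    have hmul : ∀ (m : ℤ) (c : G.Dart → ℤ), csum (fun d => m * c d) p = m * csum c p := by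
      intro m c; clear h h1
      induction p with
      | nil => simp
      | cons d p ih => simp [ih]; ring
    rw [csum_add (fun d => l v * g v A d + l w * g w B d)
      (fun d => κ a * g a A' d + κ b * g b B' d), csum_add (fun d => l v * g v A d),
      csum_add (fun d => κ a * g a A' d), hmul, hmul, hmul, hmul] at h1
    exact h1
  rcases lv with lv | lv <;> rcases lw with lw | lw <;> rcases ka with ka | ka <;>
    rcases kb with kb | kb <;> first
    | exact absurd (lv.trans lw.symm) hne
    | exact absurd (ka.trans kb.symm) hk
    | (left; intro x p h
       have h1 := hsum x p h; have h2 := e1 x p h; have h3 := e2 x p h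
       rw [lv, lw, ka, kb] at h1
       omega)
    | (right; intro x p h
       have h1 := hsum x p h; have h2 := e1 x p h; have h3 := e2 x p h
       rw [lv, lw, ka, kb] at h1
       omega)

end LenGraph

namespace LenGraph
variable {G : LenGraph.{u}} {r : ℕ∞} {v w : G.V}

/-- From a cycle in the explorer-neighbourhood, the separation by the component of `a'` detects the
crossing. Conversely, the separation at `{a, b}` provides the short cycle of `cross_cycle` through
`v` and `w`, which lies in one ball and therefore lifts; the potential tells the components of `a`
and `b` apart. -/
theorem crosses_iff (hG : Good r G) {a b : G.V} (hvw : v ≠ w) (hn : Near r v w) (hY : LS r a b) :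
    G.Crosses r a b v w ↔ SCross r v w a b := by
  classical
  constructor
  · rintro ⟨hab, a', b', rfl, rfl, hre, i, n, c, e, hcyc, hlen, hsub⟩
    obtain ⟨p, hp, -, hsrc⟩ := hcyc.exists_walk hlen
    have hm : ∀ z ∈ ({a'.1, b'.1, G.base r v w i} : Set (G.expl r v w).V),
        ∃ d ∈ p, d.src = z := by
      intro z hz
      obtain ⟨j, rfl⟩ := hsub hz
      have : c j ∈ p.map Dart.src := by rw [hsrc]; exact List.mem_ofFn.2 ⟨j, rfl⟩
      simpa using this
    obtain ⟨q, hq⟩ := near_of_closed hp (hm a'.1 (by simp)) (hm b'.1 (by simp))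
    obtain ⟨q2, hq2⟩ := hq.2
    have oa := off_of_punctured hG.pos hn a'
    have ob := off_of_punctured hG.pos hn b'
    refine ⟨oa.1, oa.2, ob.1, ob.2, _, _, bal_K hG hvw hn (compOf a'), q.map Dart.down',
      ⟨hq.1.down', q2.map Dart.down', hq2.1.down', by rw [plen_down', plen_down']; exact hq2.2⟩, ?_⟩
    rw [csum_chi_K hG hvw hn _ hq.1, compInd_pz, compInd_pz, if_pos rfl, if_neg]
    · norm_num
    · intro h
      exact hre (SimpleGraph.ConnectedComponent.exact h.symm)
  · rintro ⟨h1, h2, h3, h4, A, B, hX, D, hD, hne⟩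
    obtain ⟨A', B', hY', hp', -⟩ := hY.exists_proper hG
    obtain ⟨i, R1, R2, w1, w2, hC, ⟨db, hdb, hb⟩, ⟨da, hda, ha⟩, -⟩ :=
      cross_cycle hG hX ⟨h1, h2⟩ ⟨h3, h4⟩ hY.1 hY' hp' hD hne
    have hda' : da ∈ R1 ++ R2 := by simp [hda]
    have hdb' : db ∈ R1 ++ R2 := by simp [hdb]
    have hstart : ∃ d ∈ R1 ++ R2, d.src = G.side v w i := by
      obtain ⟨d, l, hl⟩ := List.exists_cons_of_ne_nil hC.2.1
      rw [hl] at hC ⊢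
      exact ⟨d, by simp, hC.1.1.1⟩
    obtain ⟨hy, p', q1, q2, q3⟩ := exists_lift_expl (G.side_eq v w i) hC.1.1
      (fun d hd => hC.1.mem_ballE_left hd) (G.self_mem_ballV r _)
    have hcyc : Cyc r (G.base r v w i) p' := by
      refine ⟨SW.of_closed q1 ?_, ?_, ?_, ?_⟩
      · rw [← plen_down', q2]; exact hC.1.closed_le
      · rintro rfl; exact hC.2.1 q2.symm
      · have := hC.2.2.1
        rw [← q2, List.map_map] at this
        exact List.Nodup.of_map (fun z : (G.expl r v w).V => (z : G.ExplV r v w).1.1)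
          (by simp only [List.map_map]; exact this)
      · have := hC.2.2.2
        rw [← q2, List.map_map] at this
        exact List.Nodup.of_map (fun z : (G.expl r v w).E => (z : G.ExplE r v w).1.1)
          (by simp only [List.map_map]; exact this)
    have na := near_of_closed hC.1 hstart ⟨da, hda', ha⟩
    have nb := near_of_closed hC.1 hstart ⟨db, hdb', hb⟩
    have hm : ∀ d ∈ R1 ++ R2, ∀ u (hu : u ∈ G.ballV r (G.side v w i)), d.src = u →
        ∃ d' ∈ p', d'.src = G.copy r v w (G.side_eq v w i) ⟨u, hu⟩ := by
      rintro d hd u hu rfl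
      rw [← q2] at hd
      obtain ⟨d', hd', rfl⟩ := List.mem_map.1 hd
      obtain ⟨hh, he⟩ := q3 d' hd'
      exact ⟨d', hd', congrArg Dart.src he⟩
    refine ⟨hY.1, pz (G.side_eq v w i) a (mem_ballV.2 na) ⟨h1, h2⟩,
      pz (G.side_eq v w i) b (mem_ballV.2 nb) ⟨h3, h4⟩, rfl, rfl, ?_, i,
      hcyc.hasCycleThrough ?_⟩
    · intro hre
      have := hX.pot_reach hG hn _ _ _ _ _ _ hre
      apply hne
      rw [closed_pot (chi_anti _ _ _ _) hX.1 hC.1 ⟨da, hda', ha⟩ ⟨db, hdb', hb⟩ hD, this, sub_self]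
    · rintro s (rfl | rfl | rfl)
      · exact hm da hda' _ _ ha
      · exact hm db hdb' _ _ hb
      · obtain ⟨d, hd, hd'⟩ := hstart
        exact hm d hd _ _ hd'

/-! ### Components all of whose separators are crossed -/

theorem exists_first {α : Type*} {P : α → Prop} {l : List α} (h : ∃ d ∈ l, P d) :
    ∃ l1 d l2, l = l1 ++ d :: l2 ∧ P d ∧ ∀ d' ∈ l1, ¬ P d' := by
  induction l with
  | nil => simp at h
  | cons a l ih =>
    by_cases ha : P a
    · exact ⟨[], a, l, rfl, ha, by simp⟩
    · obtain ⟨l1, d, l2, rfl, h1, h2⟩ := ih (by simpa [ha] using h)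
      exact ⟨a :: l1, d, l2, rfl, h1, by simpa [ha] using h2⟩

/-- The order in which `m` passes through `p` and `q` is not known, hence the two cases. -/
theorem exists_subarc {x y p q : G.V} {u m : List G.Dart} (h : SW r x (u ++ m) y)
    (hp : ∃ d ∈ m, d.src = p) (hq : ∃ d ∈ m, d.src = q) :
    ∃ D : List G.Dart, (∀ d ∈ D, d ∈ m) ∧ (SW r p D q ∨ SW r q D p) := by
  have key : ∀ {d d' : G.Dart} {s1 s2 : List G.Dart}, m = s1 ++ d :: s2 → d' ∈ d :: s2 →
      ∃ D : List G.Dart, (∀ d ∈ D, d ∈ m) ∧ SW r d.src D d'.src := by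
    intro d d' s1 s2 hm hd'
    obtain ⟨t1, t2, ht⟩ := List.append_of_mem hd'
    rw [ht] at hm
    obtain ⟨z, h1, h2⟩ := SW.split (p := u ++ s1) (q := t1 ++ d' :: t2) (by simpa [hm] using h)
    have h3 := h2.prefix.1
    have h4 : z = d.src := by
      rw [← ht] at h2
      exact h2.1.1.symm
    exact ⟨t1, fun e he => by rw [hm]; simp [he], h4 ▸ h3⟩
  obtain ⟨d, hd, rfl⟩ := hp
  obtain ⟨d', hd', rfl⟩ := hq
  obtain ⟨s1, s2, hm⟩ := List.append_of_mem hd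
  have h2 := hd'
  rw [hm] at h2
  rcases List.mem_append.1 h2 with h2 | h2
  · obtain ⟨t1, t2, ht⟩ := List.append_of_mem hd'
    obtain ⟨o1, o2, ho⟩ := List.append_of_mem h2
    obtain ⟨D, hD, hD'⟩ := key (d := d') (d' := d) (s1 := o1) (s2 := o2 ++ d :: s2)
      (by rw [hm, ho]; simp) (by simp)
    exact ⟨D, hD, .inr hD'⟩
  · obtain ⟨D, hD, hD'⟩ := key hm h2
    exact ⟨D, hD, .inl hD'⟩

/-- The edge set `A` splits the edges at `x` and its cut cochain is `ω` on short closed walks. -/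
def Cuts (r : ℕ∞) (ω : G.Dart → ℤ) (x : G.V) (A : Set G.E) : Prop :=
  Proper x A ∧ ∀ y p, SW r y p y → csum (g x A) p = csum ω p

theorem Cuts.of_neg {ω : G.Dart → ℤ} {x : G.V} {A : Set G.E} (hp : Proper x A)
    (h : ∀ y p, SW r y p y → csum (g x A) p = - csum ω p) : Cuts r ω x Aᶜ := by
  classical
  refine ⟨hp.compl, fun y p hy => ?_⟩
  rw [csum_g_compl, g_univ hy.1, h y p hy]; ring

/-- By `SCross.van` the cut at `a` has cochain `ω` or `-ω`; in the second case the complementary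
edge set works. -/
theorem SCross.cuts (hG : Good r G) {ω : G.Dart → ℤ} {A B : Set G.E} {a b : G.V} (hvw : v ≠ w)
    (hY : LS r a b) (hc : SCross r v w a b) (hX : Bal r v A w B) (hA : Cuts r ω v A) :
    ∃ A', Cuts r ω a A' := by
  obtain ⟨A', B', hY', hp', -⟩ := hY.exists_proper hG
  rcases hc.van hG hvw hY hX hA.1 hY' hp' with h | h
  · exact ⟨A', hp', fun y p hy => (h y p hy).trans (hA.2 y p hy)⟩
  · exact ⟨A'ᶜ, Cuts.of_neg hp' fun y p hy => by rw [h y p hy, hA.2 y p hy]⟩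

/-- A cycle passes through its first vertex once, leaving by its first edge and returning by its
last. -/
theorem csum_g_cyc_eq {x : G.V} {A : Set G.E} {d dl : G.Dart} {q : List G.Dart}
    (hnl : ∀ d : G.Dart, d.src ≠ d.tgt) (hC : Cyc r x (d :: (q ++ [dl]))) [Decidable (d.e ∈ A)]
    [Decidable (dl.e ∈ A)] :
    csum (g x A) (d :: (q ++ [dl])) = (if d.e ∈ A then 1 else 0) - if dl.e ∈ A then 1 else 0 := by
  obtain ⟨w1, w2⟩ := hC.1.1
  obtain ⟨w2, w3⟩ := wk_split.1 w2
  have hnd := hC.2.2.1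
  simp only [List.map_cons, List.map_append, List.map_nil, List.nodup_cons, w1] at hnd
  have h1 : ∀ d' ∈ q, d'.src ≠ x := fun d' hd' h => hnd.1 (by
    rw [← h]; exact List.mem_append_left _ (List.mem_map_of_mem hd'))
  have h2 : dl.src ≠ x := fun h => hnd.1 (by rw [← h]; simp)
  rw [csum_cons, csum_append, csum_cons, csum_nil, csum_g_of_notMem w2 h1 h2]
  have h3 : d.tgt ≠ x := fun h => hnl d (w1.trans h.symm)
  have h4 : dl.tgt = x := w3
  by_cases c1 : d.e ∈ A <;> by_cases c2 : dl.e ∈ A <;> simp [g, w1, h2, h3, h4, c1, c2]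

theorem csum_g_cyc {x : G.V} {A : Set G.E} {d dl : G.Dart} {q : List G.Dart}
    (hnl : ∀ d : G.Dart, d.src ≠ d.tgt) (hC : Cyc r x (d :: (q ++ [dl])))
    (h : 0 < csum (g x A) (d :: (q ++ [dl]))) : d.e ∈ A ∧ dl.e ∉ A := by
  classical
  rw [csum_g_cyc_eq hnl hC] at h
  by_cases c1 : d.e ∈ A <;> by_cases c2 : dl.e ∈ A <;> simp_all

/-- Let `y` be the next vertex after `x` on the cycle that has a cut with cochain `ω`. The two cuts
form a separation at `{x, y}` by `Bal.of_van`. If an edge other than an `x`–`y` edge lay on its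
inner side, `{x, y}` would be a local separator and hence crossed, by vertices which again have cuts
with cochain `ω`. These lie on the cycle outside the arc from `x` to `y`, which is incompatible with
crossing. So the inner side consists of edges between `x` and `y`, among them the first edge of the
cycle. -/
theorem cuts_next (hG : Good r G) (hall : ∀ v w : G.V, LS r v w → ∃ a b, LS r a b ∧ SCross r v w a b)
    {ω : G.Dart → ℤ} (h3 : ∀ x y : G.V, ∃ z A, z ≠ x ∧ z ≠ y ∧ Cuts r ω z A)
    {x : G.V} {A : Set G.E} (hx : Cuts r ω x A) {d dl : G.Dart} {q : List G.Dart}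
    (hC : Cyc r x (d :: (q ++ [dl]))) (hpos : 0 < csum ω (d :: (q ++ [dl]))) :
    ∃ A', Cuts r ω d.tgt A' ∧ ∀ A', Cuts r ω d.tgt A' →
      (∀ d' : G.Dart, d'.src = x → d'.e ∈ A → d'.tgt = d.tgt) ∧
      ∀ d' : G.Dart, d'.src = d.tgt → d'.e ∉ A' → d'.tgt = x := by
  have hvis : ∀ z A, Cuts r ω z A → ∃ d' ∈ d :: (q ++ [dl]), d'.src = z := fun z A hz =>
    exists_src_of_csum_g_ne (A := A) hC.1.1 (by rw [hz.2 _ _ hC.1]; omega)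
  have hdx : d.src = x := hC.1.1.1
  have hdl : dl.tgt = x := by
    have := hC.1.1.2
    exact (wk_split.1 this).2
  obtain ⟨hdA, hdlA⟩ := csum_g_cyc hG.noloop hC (by rw [hx.2 _ _ hC.1]; exact hpos)
  have hex : ∃ d' ∈ q ++ [dl], ∃ A', Cuts r ω d'.src A' := by
    obtain ⟨z, A', hz, -, hA'⟩ := h3 x x
    obtain ⟨d', hd', rfl⟩ := hvis z A' hA'
    rcases List.mem_cons.1 hd' with rfl | h
    · exact absurd hdx hz
    · exact ⟨d', h, A', hA'⟩
  obtain ⟨q1, dy, q2, hq, ⟨Ay, hAy⟩, hfirst⟩ := exists_first hex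
  have hnd := hC.2.2.1
  rw [hq] at hC hnd
  have hyx : dy.src ≠ x := by
    rintro h
    simp [hdx, h] at hnd
  have hmem2 : ∀ z A', z ≠ x → z ≠ dy.src → Cuts r ω z A' → ∃ d' ∈ q2, d'.src = z := by
    intro z A' hzx hzy hz
    obtain ⟨d', hd', rfl⟩ := hvis z A' hz
    rw [hq] at hd'
    simp only [List.mem_cons, List.mem_append] at hd'
    rcases hd' with rfl | h | rfl | h
    · exact absurd hdx hzx
    · exact absurd ⟨A', hz⟩ (hfirst d' h)
    · exact absurd rfl hzy
    · exact ⟨d', h, rfl⟩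
  have hndy : ∀ d' ∈ q2, d'.src ≠ dy.src := by
    intro d' hd' h
    simp [List.nodup_append] at hnd
    grind
  have hndx : ∀ d' ∈ q2, d'.src ≠ x := by
    intro d' hd' h
    simp [hdx] at hnd
    grind
  -- A third vertex with a cut lies beyond `y`, so the last edge of the cycle does not start at `y`.
  -- This edge later serves as the one on the outer side.
  have hdlq2 : dl ∈ q2 := by
    obtain ⟨z, A', h1, h2, h4⟩ := h3 x dy.src
    obtain ⟨d', hd', -⟩ := hmem2 z A' h1 h2 h4
    have h5 : (q1 ++ dy :: q2).getLast? = some dl := by rw [← hq]; simp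
    cases q2 with
    | nil => simp at hd'
    | cons e q2 =>
      rw [List.getLast?_append_of_ne_nil _ (by simp), List.getLast?_cons_cons] at h5
      exact List.mem_of_getLast? h5
  have hmain : ∀ A', Cuts r ω dy.src A' →
      (∀ d' : G.Dart, d'.src = x → d'.e ∈ A → d'.tgt = dy.src) ∧
      ∀ d' : G.Dart, d'.src = dy.src → d'.e ∉ A' → d'.tgt = x := by
    intro A' hA'
    by_contra hcon
    have hex : ∃ d' : G.Dart, (d'.src = x ∧ d'.tgt ≠ dy.src ∧ d'.e ∈ A) ∨
        (d'.src = dy.src ∧ d'.tgt ≠ x ∧ d'.e ∈ A'ᶜ) := by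
      by_contra hno
      push Not at hno
      refine hcon ⟨fun d' h1 h2 => ?_, fun d' h1 h2 => ?_⟩
      · by_contra h4; exact (hno d').1 h1 h4 h2
      · by_contra h4; exact (hno d').2 h1 h4 h2
    have hvan : Van r (chi x A dy.src A'ᶜ) := by
      classical
      intro z p hz
      rw [csum_chi, csum_g_compl, g_univ hz.1, hx.2 z p hz, hA'.2 z p hz]; ring
    have hbal := Bal.of_van hG hyx.symm hvan hx.1
    have hLS : LS r x dy.src := by
      refine ⟨hyx.symm, near_of_closed hC.1 ⟨d, by simp, hdx⟩ ⟨dy, by simp, rfl⟩, A, A'ᶜ, hbal,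
        hex, dl.symm, .inl ⟨hdl, hndy dl hdlq2, hdlA⟩⟩
    obtain ⟨a, b, hab, hc⟩ := hall _ _ hLS
    obtain ⟨n1, n2, n3, n4, -⟩ := id hc
    obtain ⟨Aa, hAa⟩ := hc.cuts hG hyx.symm hab hbal hx
    obtain ⟨Ab, hAb⟩ := hc.swap_right.cuts hG hyx.symm hab.symm hbal hx
    -- Both `a` and `b` come after `y` on the cycle, so an arc missing `x` and `y` joins them. The
    -- separation has sum zero on this arc, contrary to `SCross.ne_zero`.
    obtain ⟨D, hD1, hD2⟩ := exists_subarc (u := d :: q1 ++ [dy]) (m := q2) (by simpa using hC.1)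
      (hmem2 a Aa n1 n2 hAa) (hmem2 b Ab n3 n4 hAb)
    have hz : ∀ {s t : G.V}, Wk s D t → t ≠ x → t ≠ dy.src → csum (chi x A dy.src A'ᶜ) D = 0 := by
      intro s t hw h1 h2
      rw [csum_chi, csum_g_of_notMem hw (fun d' hd' => hndx d' (hD1 d' hd')) h1,
        csum_g_of_notMem hw (fun d' hd' => hndy d' (hD1 d' hd')) h2, add_zero]
    rcases hD2 with hD2 | hD2
    · exact hc.ne_zero hG hyx.symm hab hbal hx.1 hD2 (hz hD2.1 n3 n4)
    · exact hc.swap_right.ne_zero hG hyx.symm hab.symm hbal hx.1 hD2 (hz hD2.1 n1 n2)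
  have hdy : d.tgt = dy.src := (hmain Ay hAy).1 d hdx hdA
  rw [hdy]
  exact ⟨Ay, hAy, hmain⟩

/-- If every local separator is crossed, then those occurring in separators form cycles. -/
theorem exists_ring (hG : Good r G)
    (hall : ∀ v w : G.V, LS r v w → ∃ a b, LS r a b ∧ SCross r v w a b) (h : LS r v w) :
    ∃ C, Cyc r v C ∧ ∀ d : G.Dart, (∃ d' ∈ C, d'.src = d.src) → d.e ∈ C.map Dart.e := by
  obtain ⟨A0, B0, hX, hp, hpB⟩ := h.exists_proper hG
  obtain ⟨x0, C0, hC0, hne⟩ := exists_cyc (g_anti v A0) (hG.link v A0 hp)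
  obtain ⟨d0, hd0, hd0v⟩ := exists_src_of_csum_g_ne hC0.1.1 hne
  obtain ⟨q0, hq0, hperm⟩ := hC0.rotate_to hd0
  rw [← csum_perm _ hperm] at hne
  rw [hd0v] at hq0
  -- Complementing changes the sign of the cut cochain on closed walks, so the cycle may be assumed
  -- to leave `v` through `A`.
  obtain ⟨A, B, hX, hp, hpos⟩ : ∃ A B, Bal r v A w B ∧ Proper v A ∧
      0 < csum (g v A) (d0 :: q0) := by
    classical
    rcases lt_or_gt_of_ne hne with h1 | h1
    · refine ⟨A0ᶜ, B0ᶜ, hX.compl h.1, hp.compl, ?_⟩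
      rw [csum_g_compl, g_univ hq0.1.1]; omega
    · exact ⟨A0, B0, hX, hp, h1⟩
  have hpB := (Bal.proper_iff hG hX.1).1 hp
  set ω := g v A with hω
  have hv : Cuts r ω v A := ⟨hp, fun _ _ _ => rfl⟩
  have hw : Cuts r ω w Bᶜ := Cuts.of_neg hpB fun y p hy => by
    have := hX.1 y p hy; rw [csum_chi] at this; rw [hω]; omega
  obtain ⟨a, b, hab, hc⟩ := hall v w h
  obtain ⟨n1, n2, n3, n4, -⟩ := id hc
  obtain ⟨Aa, hAa⟩ := hc.cuts hG h.1 hab hX hv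
  -- The vertices `v`, `w` and `a` are three distinct ones with cuts of cochain `ω`, so one of them
  -- avoids any given pair.
  have h3 : ∀ x y : G.V, ∃ z A, z ≠ x ∧ z ≠ y ∧ Cuts r ω z A := by
    have hvw := h.1
    intro x y
    by_cases c1 : v ≠ x ∧ v ≠ y
    · exact ⟨v, A, c1.1, c1.2, hv⟩
    · by_cases c2 : w ≠ x ∧ w ≠ y
      · exact ⟨w, _, c2.1, c2.2, hw⟩
      · refine ⟨a, Aa, ?_, ?_, hAa⟩
        · rintro rfl; grind
        · rintro rfl; grind
  have hlast : ∀ {x : G.V} {d : G.Dart} {q : List G.Dart}, Cyc r x (d :: q) → ∃ q' dl, q = q' ++ [dl] := by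
    intro x d q hC
    rcases List.eq_nil_or_concat q with rfl | ⟨q', dl, rfl⟩
    · have := hC.1.1
      exact absurd (this.1.trans this.2.symm) (hG.noloop d)
    · exact ⟨q', dl, by simp⟩
  -- Applying `cuts_next` step by step around the cycle shows that each of its vertices has a cut
  -- with cochain `ω`.
  have hcuts : ∀ p1 d p2, d0 :: q0 = p1 ++ d :: p2 → ∃ A', Cuts r ω d.src A' := by
    intro p1
    induction p1 using List.reverseRecOn with
    | nil =>
      intro d p2 he
      simp only [List.nil_append, List.cons.injEq] at he
      obtain ⟨rfl, rfl⟩ := he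
      have : d0.src = v := hq0.1.1.1
      exact ⟨A, this ▸ hv⟩
    | append_singleton p1 e ih =>
      intro d p2 he
      obtain ⟨Ae, hAe⟩ := ih e (d :: p2) (by simpa using he)
      have he2 : d0 :: q0 = p1 ++ e :: (d :: p2) := by simpa using he
      have hw := hq0.1.1
      rw [he2, wk_split] at hw
      have hed : d.src = e.tgt := hw.2.1
      have hcs := hpos
      rw [he2] at hq0 hcs
      have hrot := hq0.rotate
      rw [csum_perm ω (List.perm_append_comm : (p1 ++ e :: (d :: p2)).Perm _)] at hcs
      have hrot' : Cyc r e.src (e :: (d :: p2 ++ p1)) := by simpa using hrot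
      obtain ⟨q', dl, hq'⟩ := hlast hrot'
      rw [hq'] at hrot'
      have hcs' : 0 < csum ω (e :: (q' ++ [dl])) := by rw [← hq']; simpa using hcs
      obtain ⟨A', hA', -⟩ := cuts_next hG hall h3 hAe hrot' hcs'
      exact ⟨A', hed ▸ hA'⟩
  refine ⟨d0 :: q0, hq0, ?_⟩
  rintro d' ⟨d, hd, hdd⟩
  obtain ⟨p1, p2, he⟩ := List.append_of_mem hd
  obtain ⟨A', hA'⟩ := hcuts p1 d p2 he
  have hrot := hq0
  have hcs := hpos
  have hpm : (d0 :: q0).Perm (d :: (p2 ++ p1)) := by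
    rw [he]; exact (List.perm_append_comm : (p1 ++ d :: p2).Perm _)
  rw [he] at hrot
  have hrot := hrot.rotate
  rw [csum_perm ω hpm] at hcs
  have hrot' : Cyc r d.src (d :: (p2 ++ p1)) := by simpa using hrot
  have hsub : ∀ f ∈ d :: (p2 ++ p1), f.e ∈ (d0 :: q0).map Dart.e := fun f hf =>
    List.mem_map_of_mem (hpm.mem_iff.2 hf)
  obtain ⟨q', dl, hq'⟩ := hlast hrot'
  rw [hq'] at hrot' hcs hsub
  obtain ⟨-, -, hn1⟩ := cuts_next hG hall h3 hA' hrot' hcs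
  obtain ⟨Ay, hAy, -⟩ := cuts_next hG hall h3 hA' hrot' hcs
  have hn1 := (hn1 Ay hAy).1
  obtain ⟨hdA, hdlA⟩ := csum_g_cyc hG.noloop hrot' (by rw [hA'.2 _ _ hrot'.1]; exact hcs)
  have hrot2 : Cyc r dl.src (dl :: (d :: q')) := by
    have := Cyc.rotate (p := d :: q') (d := dl) (q := []) (by simpa using hrot')
    simpa using this
  have hdl : dl.tgt = d.src := hrot2.1.1.2.1.symm
  have hpm2 : (d :: (q' ++ [dl])).Perm (dl :: (d :: q')) :=
    (List.perm_append_comm : ((d :: q') ++ [dl]).Perm _)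
  obtain ⟨Az, hAz⟩ : ∃ Az, Cuts r ω dl.src Az := by
    have : dl ∈ d0 :: q0 := hpm.mem_iff.2 (by rw [hq']; simp)
    obtain ⟨o1, o2, ho⟩ := List.append_of_mem this
    exact hcuts o1 dl o2 ho
  have hn2 : ∀ f : G.Dart, f.src = d.src → f.e ∉ A' → f.tgt = dl.src := by
    obtain ⟨q'', dl', hq''⟩ := hlast hrot2
    have hcs2 := hcs
    rw [csum_perm ω hpm2, hq''] at hcs2
    rw [hq''] at hrot2
    obtain ⟨-, -, h⟩ := cuts_next hG hall h3 hAz hrot2 hcs2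
    rw [hdl] at h
    exact (h A' hA').2
  -- Edges in `A'` lead to the next vertex of the cycle and all others to the previous one. An edge
  -- off the cycle would be parallel to a cycle edge, and then `par` leaves no room for the other
  -- cycle edge at this vertex.
  by_cases hmem : d'.e ∈ A'
  · by_cases heq : d'.e = d.e
    · rw [heq]; exact hsub d (by simp)
    · exfalso
      have ht := hn1 d' hdd.symm hmem
      rcases hG.par d d' dl.symm hdd ht.symm (fun h => heq h.symm) hdl with h | h
      · exact hdlA (by rw [← Dart.symm_e dl, h]; exact hdA)
      · exact hdlA (by rw [← Dart.symm_e dl, h]; exact hmem)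
  · by_cases heq : d'.e = dl.e
    · rw [heq]; exact hsub dl (by simp)
    · exfalso
      have ht := hn2 d' hdd.symm hmem
      rcases hG.par d' dl.symm d (hdd.symm.trans hdl.symm) ht heq hdd with h | h
      · exact hmem (h ▸ hdA)
      · exact hdlA (h ▸ hdA)

end LenGraph

namespace LenGraph
variable {G : LenGraph.{u}} {r : ℕ∞} {v w : G.V}

/-! ### The edges of the cut graph -/

/-- A vertex outside the separator, as a vertex of the cut graph. -/
abbrev cOld (r : ℕ∞) (x : G.V) (hx : Off v w x) : (G.cut r v w).V := CutV.old x hx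

/-- A slice, as a vertex of the cut graph. -/
abbrev cSlice (k : G.LocalComp r v w) (i : Bool) : (G.cut r v w).V := CutV.slice k i

/-- A vertex of an artificial component. -/
abbrev cArt (r : ℕ∞) (e : G.E) (he : G.ends e = s(v, w)) (i : Bool) : (G.cut r v w).V :=
  CutV.art e he i

/-- The vertex of the original graph below a vertex of the cut graph. -/
def proj : (G.cut r v w).V → G.V
  | .old x _ => x
  | .slice _ i => G.side v w i
  | .art _ _ i => G.side v w i

@[simp] theorem proj_cOld (x : G.V) (hx : Off v w x) : proj (cOld r x hx) = x := rfl
@[simp] theorem proj_cSlice (k : G.LocalComp r v w) (i : Bool) :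
    proj (cSlice k i) = G.side v w i := rfl

/-- The vertex does not belong to an artificial component. -/
def Main (x : (G.cut r v w).V) : Prop := ∀ e he i, x ≠ cArt r e he i

theorem main_cOld (x : G.V) (hx : Off v w x) : Main (cOld r x hx) := fun _ _ _ h => by cases h
theorem main_cSlice (k : G.LocalComp r v w) (i : Bool) : Main (cSlice k i) :=
  fun _ _ _ h => by cases h

theorem cut_cases (x : (G.cut r v w).V) :
    (∃ u hu, x = cOld r u hu) ∨ (∃ k i, x = cSlice k i) ∨ ∃ e he i, x = cArt r e he i := by
  cases x with
  | old u hu => exact .inl ⟨u, hu, rfl⟩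
  | slice k i => exact .inr (.inl ⟨k, i, rfl⟩)
  | art e he i => exact .inr (.inr ⟨e, he, i, rfl⟩)

theorem Main.cases {x : (G.cut r v w).V} (h : Main x) :
    (∃ u hu, x = cOld r u hu) ∨ ∃ k i, x = cSlice k i := by
  rcases cut_cases x with h1 | h1 | ⟨e, he, i, h1⟩
  · exact .inl h1
  · exact .inr h1
  · exact absurd h1 (h e he i)

theorem cOld_congr {x y : G.V} {hx : Off v w x} {hy : Off v w y} (h : x = y) :
    cOld r x hx = cOld r y hy := by cases h; rfl

theorem cSlice_inj {k k' : G.LocalComp r v w} {i j : Bool} (h : cSlice k i = cSlice k' j) :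
    k = k' ∧ i = j := by cases h; exact ⟨rfl, rfl⟩

theorem side_inj (hvw : v ≠ w) {i j : Bool} (h : G.side v w i = G.side v w j) : i = j := by
  cases i <;> cases j <;> first | rfl | exact absurd h hvw | exact absurd h.symm hvw

/-- A dart avoiding the separator. -/
def oldDart (r : ℕ∞) (d : G.Dart) (h1 : Off v w d.src) (h2 : Off v w d.tgt) :
    (G.cut r v w).Dart where
  src := cOld r d.src h1
  tgt := cOld r d.tgt h2
  e := CutE.old d.e (by rw [d.h]; intro x hx; rcases Sym2.mem_iff.1 hx with rfl | rfl <;> assumption)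
  h := by
    show Sym2.map _ _ = _
    rw [attachWith_eq _ h1 h2 d.h]; rfl

/-- A dart leaving the separator, at the slice inheriting it. -/
def inhDart (d : G.Dart) (i : Bool) (hs : d.src = G.side v w i) (ho : Off v w d.tgt)
    (k : G.LocalComp r v w) (hk : G.Inherits r v w d.e i k) : (G.cut r v w).Dart where
  src := cSlice k i
  tgt := cOld r d.tgt ho
  e := CutE.inherited d.e i d.tgt ho (by rw [← hs]; exact d.h) k hk
  h := rfl

/-- A torso edge. -/
def torDart (k : G.LocalComp r v w) (i : Bool) : (G.cut r v w).Dart where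
  src := cSlice k i
  tgt := cSlice k !i
  e := CutE.torso k
  h := by
    cases i
    · rfl
    · show s(_, _) = s(_, _); rw [Sym2.eq_swap]; rfl

/-- An edge between the two separator vertices, in its artificial component. -/
def artDart (r : ℕ∞) (e : G.E) (he : G.ends e = s(v, w)) (i : Bool) : (G.cut r v w).Dart where
  src := cArt r e he i
  tgt := cArt r e he !i
  e := CutE.artOld e he
  h := by
    cases i
    · rfl
    · show s(_, _) = s(_, _); rw [Sym2.eq_swap]; rfl

/-- The torso edge of an artificial component. -/
def artTorDart (r : ℕ∞) (e : G.E) (he : G.ends e = s(v, w)) (i : Bool) : (G.cut r v w).Dart where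
  src := cArt r e he i
  tgt := cArt r e he !i
  e := CutE.artTorso e he
  h := by
    cases i
    · rfl
    · show s(_, _) = s(_, _); rw [Sym2.eq_swap]; rfl

/-- The dart of the cut graph comes from the given dart of the original graph. -/
inductive DR : (G.cut r v w).Dart → G.Dart → Prop
  | old (d : G.Dart) (h1 : Off v w d.src) (h2 : Off v w d.tgt) : DR (oldDart r d h1 h2) d
  | inh (d : G.Dart) (i : Bool) (hs : d.src = G.side v w i) (ho : Off v w d.tgt)
      (k : G.LocalComp r v w) (hk : G.Inherits r v w d.e i k) : DR (inhDart d i hs ho k hk) d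
  | inh_symm (d : G.Dart) (i : Bool) (hs : d.src = G.side v w i) (ho : Off v w d.tgt)
      (k : G.LocalComp r v w) (hk : G.Inherits r v w d.e i k) :
      DR (inhDart d i hs ho k hk).symm d.symm

theorem DR.symm {d' : (G.cut r v w).Dart} {d : G.Dart} (h : DR d' d) : DR d'.symm d.symm := by
  cases h with
  | old d h1 h2 => exact DR.old d.symm h2 h1
  | inh d i hs ho k hk => exact .inh_symm d i hs ho k hk
  | inh_symm d i hs ho k hk => exact .inh d i hs ho k hk

theorem DR.src {d' : (G.cut r v w).Dart} {d : G.Dart} (h : DR d' d) : proj d'.src = d.src := by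
  cases h with
  | old d h1 h2 => rfl
  | inh d i hs ho k hk => exact hs.symm
  | inh_symm d i hs ho k hk => rfl

theorem DR.tgt {d' : (G.cut r v w).Dart} {d : G.Dart} (h : DR d' d) : proj d'.tgt = d.tgt :=
  h.symm.src

theorem DR.main {d' : (G.cut r v w).Dart} {d : G.Dart} (h : DR d' d) : Main d'.src := by
  cases h with
  | old d h1 h2 => exact main_cOld _ _
  | inh d i hs ho k hk => exact main_cSlice _ _
  | inh_symm d i hs ho k hk => exact main_cOld _ _

theorem DR.len {d' : (G.cut r v w).Dart} {d : G.Dart} (h : DR d' d) :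
    (G.cut r v w).len d'.e = G.len d.e := by
  cases h <;> rfl

theorem DR.off {d' : (G.cut r v w).Dart} {d : G.Dart} (h : DR d' d) :
    Off v w d.src ∨ Off v w d.tgt := by
  cases h with
  | old d h1 h2 => exact .inl h1
  | inh d i hs ho k hk => exact .inr ho
  | inh_symm d i hs ho k hk => exact .inl ho

/-- The edge of the original graph below an edge of the cut graph. -/
def cutEdge : (G.cut r v w).E → Option G.E
  | .old e _ => some e
  | .inherited e _ _ _ _ _ _ => some e
  | .torso _ => none
  | .artOld _ _ => none
  | .artTorso _ _ => none

theorem DR.edge {d' : (G.cut r v w).Dart} {d : G.Dart} (h : DR d' d) :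
    cutEdge d'.e = some d.e := by
  cases h <;> rfl

theorem DR.src_off {d' : (G.cut r v w).Dart} {d : G.Dart} (h : DR d' d) (ho : Off v w d.src) :
    d'.src = cOld r d.src ho := by
  cases h with
  | old d h1 h2 => rfl
  | inh d i hs ho' k hk => exact absurd hs (off_side ho i)
  | inh_symm d i hs ho k hk => rfl

theorem DR.src_side {d' : (G.cut r v w).Dart} {d : G.Dart} (h : DR d' d) (hvw : v ≠ w) {i : Bool}
    (hi : d.src = G.side v w i) : ∃ k, d'.src = cSlice k i ∧ d.e ∈ Kset r v w k := by
  cases h with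
  | old d h1 h2 => exact absurd hi (off_side h1 i)
  | inh d j hs ho k hk =>
    obtain rfl := side_inj hvw (hi.symm.trans hs)
    exact ⟨k, rfl, _, hk⟩
  | inh_symm d j hs ho k hk => exact absurd hi (off_side ho i)

/-- The lift of a dart is unique. -/
theorem DR.functional (hG : Good r G) (hvw : v ≠ w) (hn : Near r v w)
    {d1 d2 : (G.cut r v w).Dart} {d : G.Dart} (h1 : DR d1 d) (h2 : DR d2 d) : d1 = d2 := by
  have key : ∀ {d1 d2 : (G.cut r v w).Dart} {d : G.Dart}, DR d1 d → DR d2 d →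
      ∀ i, d.src = G.side v w i → d1 = d2 := by
    intro d1 d2 d h1 h2 i hi
    cases h1 with
    | old d a b => exact absurd hi (off_side a i)
    | inh d j hs ho k hk =>
      cases h2 with
      | old _ a b => exact absurd hi (off_side a i)
      | inh d j' hs' ho' k' hk' =>
        obtain rfl := side_inj hvw (hs.symm.trans hs')
        obtain rfl := Kset_disjoint hG hn ⟨_, hk⟩ ⟨_, hk'⟩
        rfl
      | inh_symm d j' hs' ho' k' hk' => exact absurd hi (off_side ho' i)
    | inh_symm d j hs ho k hk => exact absurd hi (off_side ho i)
  by_cases hs : Off v w d.src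
  · by_cases ht : Off v w d.tgt
    · cases h1 with
      | old d a b =>
        cases h2 with
        | old d a b => rfl
        | inh d j' hs' ho' k' hk' => exact absurd hs' (off_side hs j')
        | inh_symm d j' hs' ho' k' hk' => exact absurd hs' (off_side ht j')
      | inh d j hs' ho k hk => exact absurd hs' (off_side hs j)
      | inh_symm d j hs' ho k hk => exact absurd hs' (off_side ht j)
    · obtain ⟨i, hi⟩ := not_off ht
      have := key h1.symm h2.symm i hi
      exact congrArg Dart.symm this
  · obtain ⟨i, hi⟩ := not_off hs
    exact key h1 h2 i hi

theorem exists_DR_side (hG : Good r G) (hn : Near r v w) {d : G.Dart} {i : Bool}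
    (h1 : d.src = G.side v w i) (h2 : Off v w d.tgt) {k : G.LocalComp r v w}
    (hk : d.e ∈ Kset r v w k) :
    ∃ d' : (G.cut r v w).Dart, DR d' d ∧ d'.src = cSlice k i ∧ d'.tgt = cOld r d.tgt h2 :=
  ⟨_, .inh d i h1 h2 k (inherits_of_mem hG hn h1 h2 hk), rfl, rfl⟩

theorem exists_DR (hG : Good r G) (hn : Near r v w) {d : G.Dart}
    (h : Off v w d.src ∨ Off v w d.tgt) : ∃ d' : (G.cut r v w).Dart, DR d' d := by
  have key : ∀ d : G.Dart, Off v w d.tgt → ∃ d' : (G.cut r v w).Dart, DR d' d := by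
    intro d ho
    by_cases hs : Off v w d.src
    · exact ⟨_, .old d hs ho⟩
    · obtain ⟨i, hi⟩ := not_off hs
      obtain ⟨k, hk⟩ := exists_unique_comp hG hn hi ho
      obtain ⟨d', h, -⟩ := exists_DR_side hG hn hi ho ((hk k).2 rfl)
      exact ⟨d', h⟩
  rcases h with h | h
  · obtain ⟨d', h'⟩ := key d.symm h
    exact ⟨d'.symm, h'.symm⟩
  · exact key d h

/-- Classification of the darts of the cut graph. -/
theorem cut_dart_cases (d' : (G.cut r v w).Dart) :
    (∃ d, DR d' d) ∨ (∃ k i, d' = torDart k i) ∨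
      ∃ e he i, d' = artDart r e he i ∨ d' = artTorDart r e he i := by
  obtain ⟨x, y, e, h⟩ := d'
  cases e with
  | old e he =>
    left
    obtain ⟨d, rfl⟩ := exists_dart e
    have h1 : Off v w d.src := he _ (by rw [d.h]; exact Sym2.mem_mk_left _ _)
    have h2 : Off v w d.tgt := he _ (by rw [d.h]; exact Sym2.mem_mk_right _ _)
    rcases Dart.eq_or_symm (d := ⟨x, y, _, h⟩) (d' := oldDart r d h1 h2) rfl with h3 | h3
    · exact ⟨d, h3 ▸ .old d h1 h2⟩
    · exact ⟨d.symm, h3 ▸ (DR.old d h1 h2).symm⟩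
  | inherited e i z hz he k hk =>
    left
    rcases Dart.eq_or_symm (d := ⟨x, y, _, h⟩)
      (d' := inhDart ⟨G.side v w i, z, e, he⟩ i rfl hz k hk) rfl with h3 | h3
    · exact ⟨⟨G.side v w i, z, e, he⟩, h3 ▸ DR.inh ⟨G.side v w i, z, e, he⟩ i rfl hz k hk⟩
    · exact ⟨Dart.symm ⟨G.side v w i, z, e, he⟩,
        h3 ▸ DR.inh_symm ⟨G.side v w i, z, e, he⟩ i rfl hz k hk⟩
  | torso k =>
    right; left
    rcases Dart.eq_or_symm (d := ⟨x, y, _, h⟩) (d' := torDart k false) rfl with h3 | h3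
    · exact ⟨k, false, h3⟩
    · exact ⟨k, true, h3⟩
  | artOld e he =>
    right; right
    rcases Dart.eq_or_symm (d := ⟨x, y, _, h⟩) (d' := artDart r e he false) rfl with h3 | h3
    · exact ⟨e, he, false, .inl h3⟩
    · exact ⟨e, he, true, .inl h3⟩
  | artTorso e he =>
    right; right
    rcases Dart.eq_or_symm (d := ⟨x, y, _, h⟩) (d' := artTorDart r e he false) rfl with h3 | h3
    · exact ⟨e, he, false, .inr h3⟩
    · exact ⟨e, he, true, .inr h3⟩

theorem main_dart_cases {d' : (G.cut r v w).Dart} (h : Main d'.src) :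
    (∃ d, DR d' d) ∨ ∃ k i, d' = torDart k i := by
  rcases cut_dart_cases d' with h1 | h1 | ⟨e, he, i, rfl | rfl⟩
  · exact .inl h1
  · exact .inr h1
  · exact absurd rfl (h e he i)
  · exact absurd rfl (h e he i)

/-- The cochain on the cut graph agrees with the one on the original graph. -/
def Compat (c' : (G.cut r v w).Dart → ℤ) (c : G.Dart → ℤ) : Prop := ∀ d' d, DR d' d → c' d' = c d

theorem Compat.csum {c' : (G.cut r v w).Dart → ℤ} {c : G.Dart → ℤ} (h : Compat c' c)
    {p' : List (G.cut r v w).Dart} {p : List G.Dart} (hp : List.Forall₂ DR p' p) :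
    csum c' p' = csum c p := by
  induction hp with
  | nil => rfl
  | cons h1 _ ih => rw [csum_cons, csum_cons, h _ _ h1, ih]

theorem plen_of_DR {p' : List (G.cut r v w).Dart} {p : List G.Dart} (hp : List.Forall₂ DR p' p) :
    plen p' = plen p := by
  induction hp with
  | nil => rfl
  | cons h1 _ ih => rw [plen_cons, plen_cons, h1.len, ih]

/-! ### Arcs between the separator vertices -/

/-- A local separator has a second local component, and edges into that component are outside `Kset
r v w k`. -/
theorem LS.proper_K (hG : Good r G) (h : LS r v w) (k : G.LocalComp r v w) :
    Proper v (Kset r v w k) ∧ Proper w (Kset r v w k) := by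
  obtain ⟨hvw, hn, -⟩ := id h
  have h1 := ((isLocalSep_iff hG).2 h).2.2
  obtain ⟨k', hk'⟩ : ∃ k', k' ≠ k := by
    by_contra hcon
    push Not at hcon
    refine h1 fun z z' => SimpleGraph.ConnectedComponent.eq.1 ?_
    exact (hcon (compOf z)).trans (hcon (compOf z')).symm
  obtain ⟨d, i, a1, a2, a3⟩ := exists_dart_comp hG hn k
  obtain ⟨d', i', b1, b2, b3⟩ := exists_dart_comp hG hn k'
  have b4 : d'.e ∉ Kset r v w k := fun h => hk' (Kset_disjoint hG hn b3 h)
  have hb := bal_K hG hvw hn k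
  have hp := hb.proper hG hvw hn (d := d) (d' := d')
    (by cases i; exacts [.inl ⟨a1, a3⟩, .inr ⟨a1, a3⟩])
    (by cases i'; exacts [.inl ⟨b1, b4⟩, .inr ⟨b1, b4⟩])
  exact ⟨hp, (Bal.proper_iff hG hb.1).1 hp⟩

theorem LS.proper_K_side (hG : Good r G) (h : LS r v w) (k : G.LocalComp r v w) (i : Bool) :
    Proper (G.side v w i) (Kset r v w k) := by
  cases i
  exacts [(h.proper_K hG k).1, (h.proper_K hG k).2]

theorem bal_K_side (hG : Good r G) (hvw : v ≠ w) (hn : Near r v w) (k : G.LocalComp r v w) (i : Bool) :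
    Bal r (G.side v w i) (Kset r v w k) (G.side v w !i) (Kset r v w k) := by
  cases i
  exacts [bal_K hG hvw hn k, (bal_K hG hvw hn k).swap]

theorem side_ne (hvw : v ≠ w) (i : Bool) : G.side v w i ≠ G.side v w !i := by
  cases i
  exacts [hvw, hvw.symm]

theorem off_of_src_tail {x y : G.V} {d : G.Dart} {q : List G.Dart} (hw : Wk x (d :: q) y)
    (hq : ∀ d' ∈ q, Off v w d'.src) (hy : ¬ Off v w y) (ht : Off v w d.tgt) :
    ∃ m d2, q = m ++ [d2] ∧ d2.tgt = y ∧ Off v w d2.src ∧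
      ∀ d' ∈ m, Off v w d'.src ∧ Off v w d'.tgt := by
  rcases List.eq_nil_or_concat q with rfl | ⟨m, d2, rfl⟩
  · exact absurd (hw.2 ▸ ht) hy
  · rw [List.concat_eq_append] at hq hw
    obtain ⟨w1, w2⟩ := wk_split.1 hw.2
    refine ⟨m, d2, by simp, w2, hq d2 (by simp), fun d' hd' => ⟨hq d' (by simp [hd']), ?_⟩⟩
    obtain ⟨m1, m2, rfl⟩ := List.append_of_mem hd'
    obtain ⟨_, w3⟩ := wk_split.1 w1
    cases m2 with
    | nil => exact w3.symm ▸ hq d2 (by simp)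
    | cons e m2 => exact w3.1 ▸ hq e (by simp)

theorem chi_off {A B : Set G.E} {d : G.Dart} (h1 : Off v w d.src) (h2 : Off v w d.tgt) :
    chi v A w B d = 0 := by
  rw [chi, g_of_ne h1.1 h2.1, g_of_ne h1.2 h2.2, add_zero]

/-- An arc between vertices of the separator that otherwise avoids it stays in one local
component. -/
theorem arc_comp (hG : Good r G) (hvw : v ≠ w) (hn : Near r v w) {i j : Bool} {d1 d2 : G.Dart}
    {m : List G.Dart} (hP : SW r (G.side v w i) (d1 :: (m ++ [d2])) (G.side v w j))
    (h1 : Off v w d1.tgt) (h2 : Off v w d2.src)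
    (hm : ∀ d ∈ m, Off v w d.src ∧ Off v w d.tgt) :
    ∃ k, d1.e ∈ Kset r v w k ∧ d2.e ∈ Kset r v w k := by
  classical
  obtain ⟨k, hk⟩ := exists_unique_comp hG hn hP.1.1 h1
  have hk1 := (hk k).2 rfl
  refine ⟨k, hk1, ?_⟩
  have hb := bal_K hG hvw hn k
  -- Inside the arc nothing contributes, so this sum compares the membership of the first and the
  -- last edge in the same component.
  have h0 : csum (chi v (Kset r v w k) w (Kset r v w k)) (d1 :: (m ++ [d2])) = 0 := by
    cases i <;> cases j
    · exact hb.1 _ _ hP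
    · exact hb.2 _ hP
    · rw [chi_comm]; exact hb.swap.2 _ hP
    · exact hb.1 _ _ hP
  have hd2 : d2.tgt = G.side v w j := (wk_split.1 hP.1.2).2
  rw [csum_cons, csum_append, csum_eq_zero (p := m) fun d hd => chi_off (hm d hd).1 (hm d hd).2,
    chi_side hvw hP.1.1 h1, csum_cons, csum_nil, ← Dart.symm_symm d2, chi_anti,
    chi_side (d := d2.symm) hvw hd2 h2] at h0
  simp only [Bool.cond_self, Dart.symm_e] at h0
  by_contra hcon
  simp [hk1, hcon] at h0

end LenGraph

namespace LenGraph
variable {G : LenGraph.{u}} {r : ℕ∞} {v w : G.V}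

/-! ### Lifting cycles to the cut graph -/

theorem mem_of_rev {d : G.Dart} {p : List G.Dart} (h : d ∈ rev p) : d.symm ∈ p := by
  have := rev_mem h
  simpa [rev, List.map_reverse] using this

theorem lift_old (r : ℕ∞) {x y : G.V} {m : List G.Dart} (hw : Wk x m y) (hx : Off v w x)
    (hm : ∀ d ∈ m, Off v w d.src ∧ Off v w d.tgt) :
    ∃ (hy : Off v w y) (m' : List (G.cut r v w).Dart), List.Forall₂ DR m' m ∧
      Wk (cOld r x hx) m' (cOld r y hy) := by
  induction m generalizing x with
  | nil => obtain rfl := hw; exact ⟨hx, [], .nil, rfl⟩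
  | cons d m ih =>
    obtain ⟨rfl, hw⟩ := hw
    obtain ⟨h1, h2⟩ := hm d (by simp)
    obtain ⟨hy, m', h3, h4⟩ := ih hw h2 fun e he => hm e (by simp [he])
    exact ⟨hy, oldDart r d h1 h2 :: m', .cons (.old d h1 h2) h3, rfl, h4⟩

theorem lift_arc (hG : Good r G) (hn : Near r v w) {i j : Bool} {d1 d2 : G.Dart}
    {m : List G.Dart} (hP : Wk (G.side v w i) (d1 :: (m ++ [d2])) (G.side v w j))
    (h1 : Off v w d1.tgt) (h2 : Off v w d2.src)
    (hm : ∀ d ∈ m, Off v w d.src ∧ Off v w d.tgt) {k : G.LocalComp r v w}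
    (k1 : d1.e ∈ Kset r v w k) (k2 : d2.e ∈ Kset r v w k) :
    ∃ P', List.Forall₂ DR P' (d1 :: (m ++ [d2])) ∧ Wk (cSlice k i) P' (cSlice k j) := by
  obtain ⟨w1, w2⟩ := hP
  obtain ⟨w2, w3⟩ := wk_split.1 w2
  obtain ⟨hy, m', f1, f2⟩ := lift_old r w2 h1 hm
  obtain ⟨d1', a1, a2, a3⟩ := exists_DR_side hG hn w1 h1 k1
  obtain ⟨d2', b1, b2, b3⟩ := exists_DR_side (d := d2.symm) hG hn w3 h2 k2
  refine ⟨d1' :: (m' ++ [d2'.symm]), .cons a1 ?_, a2, wk_split.2 ⟨?_, b2⟩⟩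
  · exact List.rel_append f1 (.cons b1.symm .nil)
  · show Wk d1'.tgt m' d2'.tgt
    rw [a3, b3]; exact f2

/-- The option records the local component through which the arc runs; it is `none` exactly for a
single edge between `v` and `w`. In the first case the arc lifts to the slices of that component. -/
theorem arc_spec (hG : Good r G) (hvw : v ≠ w) (hn : Near r v w) {i : Bool} {d : G.Dart}
    {q : List G.Dart} (hP : SW r (G.side v w i) (d :: q) (G.side v w !i))
    (hq : ∀ d' ∈ q, Off v w d'.src) :
    ∃ o : Option (G.LocalComp r v w),
      (∀ k, o ≠ some k → ∀ d' ∈ d :: q, d'.e ∉ Kset r v w k) ∧ (o = none → q = []) ∧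
      ∀ k, o = some k →
        (∀ d' ∈ d :: q, ¬ Off v w d'.src ∨ ¬ Off v w d'.tgt → d'.e ∈ Kset r v w k) ∧
        ∃ P', List.Forall₂ DR P' (d :: q) ∧ Wk (cSlice k i) P' (cSlice k !i) := by
  by_cases ht : Off v w d.tgt
  · obtain ⟨m, d2, rfl, h1, h2, hm⟩ := off_of_src_tail hP.1 hq (fun h => off_side h _ rfl) ht
    obtain ⟨k, k1, k2⟩ := arc_comp hG hvw hn hP ht h2 hm
    refine ⟨some k, ?_, by simp, ?_⟩
    · intro k' hk' d' hd' hK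
      simp only [List.mem_cons, List.mem_append, List.not_mem_nil, or_false] at hd'
      rcases hd' with rfl | hd' | rfl
      · exact hk' (congrArg some (Kset_disjoint hG hn k1 hK))
      · obtain ⟨e, j, e1, e2, e3⟩ := exists_dart_of_mem_Kset hG hn hK
        obtain ⟨o1, o2⟩ := hm d' hd'
        rcases Dart.eq_or_symm e1 with rfl | rfl
        · exact off_side o1 j e2
        · exact off_side o2 j e2
      · exact hk' (congrArg some (Kset_disjoint hG hn k2 hK))
    · rintro k' hk'
      obtain rfl := Option.some.inj hk'
      refine ⟨?_, lift_arc hG hn hP.1 ht h2 hm k1 k2⟩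
      intro d' hd' hno
      simp only [List.mem_cons, List.mem_append, List.not_mem_nil, or_false] at hd'
      rcases hd' with rfl | hd' | rfl
      · exact k1
      · obtain ⟨o1, o2⟩ := hm d' hd'
        tauto
      · exact k2
  · obtain ⟨j, hj⟩ := not_off ht
    have hq0 : q = [] := by
      cases q with
      | nil => rfl
      | cons e q =>
        have : e.src = d.tgt := hP.1.2.1
        exact absurd (hq e (by simp)) (by rw [this]; exact ht)
    subst hq0
    refine ⟨none, ?_, fun _ => rfl, by simp⟩
    intro k _ d' hd'
    rw [List.mem_singleton] at hd'
    subst hd'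
    exact notMem_Kset_of_sides hG hn d' hP.1.1 hj k

/-- A short cycle through both separator vertices consists of two arcs. -/
theorem Cyc.split (hvw : v ≠ w) {x : G.V} {C : List G.Dart} (hC : Cyc r x C) (i : Bool)
    (h1 : ∃ d ∈ C, d.src = G.side v w i) (h2 : ∃ d ∈ C, d.src = G.side v w !i) :
    ∃ (d e : G.Dart) (q1 q2 : List G.Dart), (d :: q1 ++ e :: q2).Perm C ∧
      Cyc r (G.side v w i) (d :: q1 ++ e :: q2) ∧
      SW r (G.side v w i) (d :: q1) (G.side v w !i) ∧
      SW r (G.side v w !i) (e :: q2) (G.side v w i) ∧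
      (∀ d' ∈ q1, Off v w d'.src) ∧ ∀ d' ∈ q2, Off v w d'.src := by
  obtain ⟨d, hd, hdi⟩ := h1
  obtain ⟨q, hq, hp⟩ := hC.rotate_to hd
  obtain ⟨e, he, hei⟩ := h2
  rw [← hp.mem_iff] at he
  have he' : e ∈ q := by
    rcases List.mem_cons.1 he with rfl | h
    · exact absurd (hdi.symm.trans hei) (side_ne hvw i)
    · exact h
  obtain ⟨q1, q2, rfl⟩ := List.append_of_mem he'
  rw [hdi] at hq
  have hs : SW r (G.side v w i) ((d :: q1) ++ e :: q2) (G.side v w i) := hq.1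
  obtain ⟨w1, w2⟩ := wk_split.1 hs.1
  have hnd := hq.2.2.1
  have hoff : ∀ d' : G.Dart, d'.src ≠ G.side v w i → d'.src ≠ G.side v w (!i) → Off v w d'.src := by
    intro d' a b
    cases i
    exacts [⟨a, b⟩, ⟨b, a⟩]
  have hw := hs.1
  rw [hei] at w1
  have w2' : Wk (G.side v w !i) (e :: q2) (G.side v w i) := ⟨hei, w2⟩
  refine ⟨d, e, q1, q2, by simpa using hp, hq, hs.left w1, hs.right w2' w1, ?_, ?_⟩
  · intro d' hd'
    refine hoff d' ?_ ?_
    · intro h; rw [← hdi] at h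
      simp [List.nodup_append] at hnd
      grind
    · intro h; rw [← hei] at h
      simp [List.nodup_append] at hnd
      grind
  · intro d' hd'
    refine hoff d' ?_ ?_
    · intro h; rw [← hdi] at h
      simp [List.nodup_append] at hnd
      grind
    · intro h; rw [← hei] at h
      simp [List.nodup_append] at hnd
      grind

theorem torsoLen_le_side (hG : Good r G) (hvw : v ≠ w) (hn : Near r v w) (k : G.LocalComp r v w)
    {i : Bool} {P : List G.Dart} (hP : SW r (G.side v w i) P (G.side v w !i))
    (hK : ∀ d ∈ P, d.e ∉ Kset r v w k) : G.torsoLen r v w k ≤ plen P := by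
  cases i
  · exact (torsoLen_le hG hvw hn k hP hK).2
  · rw [← plen_rev]
    refine (torsoLen_le hG hvw hn k hP.symm ?_).2
    intro d hd
    exact hK d.symm (mem_of_rev hd)

/-- An arc between the separator vertices that is either an edge or lifts to a short cycle through
a torso edge. -/
def Piece (r : ℕ∞) (v w : G.V) (i : Bool) (P : List G.Dart) : Prop :=
  SW r (G.side v w i) P (G.side v w !i) ∧
    ((∃ d, P = [d]) ∨ ∃ (k : G.LocalComp r v w) (P' : List (G.cut r v w).Dart),
      List.Forall₂ DR P' P ∧ Wk (cSlice k i) P' (cSlice k !i) ∧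
      ((plen P + G.torsoLen r v w k : ℕ) : ℕ∞) ≤ r)

/-- A cycle meeting the separator at most once stays in one component and lifts, and so does one
whose two arcs run through the same component. Otherwise an arc running through `k` has an opposite
arc avoiding `k`, which is therefore at least as long as the torso edge of `k`; replacing it by the
torso edge leaves a closed walk of length at most `r`. -/
theorem lift_cyc (hG : Good r G) (hvw : v ≠ w) (hn : Near r v w) {x : G.V} {C : List G.Dart}
    (hC : Cyc r x C) :
    (∃ (C2 : List G.Dart) (x' : (G.cut r v w).V) (p' : List (G.cut r v w).Dart), C2.Perm C ∧
      Wk x' p' x' ∧ List.Forall₂ DR p' C2) ∨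
    ∃ i P1 P2, (P1 ++ P2).Perm C ∧ Piece r v w i P1 ∧ Piece r v w (!i) P2 := by
  by_cases h0 : ∃ d ∈ C, ¬ Off v w d.src
  · obtain ⟨d0, hd0, h0⟩ := h0
    obtain ⟨i, hi⟩ := not_off h0
    by_cases h1 : ∃ d ∈ C, d.src = G.side v w !i
    · obtain ⟨d, e, q1, q2, hp, hcyc, s1, s2, t1, t2⟩ := hC.split hvw i ⟨d0, hd0, hi⟩ h1
      have s2' : SW r (G.side v w !i) (e :: q2) (G.side v w !!i) := by rwa [Bool.not_not]
      obtain ⟨o1, a1, a2, a3⟩ := arc_spec hG hvw hn s1 t1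
      obtain ⟨o2, b1, b2, b3⟩ := arc_spec hG hvw hn s2' t2
      by_cases ho : ∃ k, o1 = some k ∧ o2 = some k
      · obtain ⟨k, rfl, rfl⟩ := ho
        obtain ⟨-, P1, f1, g1⟩ := a3 k rfl
        obtain ⟨-, P2, f2, g2⟩ := b3 k rfl
        rw [Bool.not_not] at g2
        exact .inl ⟨_, _, P1 ++ P2, hp, g1.append g2, List.rel_append f1 f2⟩
      · right
        have hl := hcyc.1.closed_le
        rw [plen_append] at hl
        refine ⟨i, _, _, hp, ⟨s1, ?_⟩, ⟨s2', ?_⟩⟩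
        · cases o1 with
          | none => exact .inl ⟨d, by rw [a2 rfl]⟩
          | some k =>
            obtain ⟨-, P1, f1, g1⟩ := a3 k rfl
            refine .inr ⟨k, P1, f1, g1, le_trans_cast hl ?_⟩
            have := torsoLen_le_side hG hvw hn k s2' (b1 k fun h => ho ⟨k, rfl, h⟩)
            omega
        · cases o2 with
          | none => exact .inl ⟨e, by rw [b2 rfl]⟩
          | some k =>
            obtain ⟨-, P2, f2, g2⟩ := b3 k rfl
            refine .inr ⟨k, P2, f2, g2, le_trans_cast hl ?_⟩
            have := torsoLen_le_side hG hvw hn k s1 (a1 k fun h => ho ⟨k, h, rfl⟩)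
            omega
    · left
      obtain ⟨q, hq, hp⟩ := hC.rotate_to hd0
      rw [hi] at hq
      have hnd := hq.2.2.1
      have hoff : ∀ d' ∈ q, Off v w d'.src := by
        intro d' hd'
        have e1 : d'.src ≠ G.side v w i := by
          intro h
          rw [List.map_cons, List.nodup_cons, hi, ← h] at hnd
          exact hnd.1 (List.mem_map_of_mem hd')
        have e2 : d'.src ≠ G.side v w !i := fun h => h1 ⟨d', hp.mem_iff.1 (by simp [hd']), h⟩
        cases i
        exacts [⟨e1, e2⟩, ⟨e2, e1⟩]
      have ht : Off v w d0.tgt := by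
        by_contra hcon
        obtain ⟨j, hj⟩ := not_off hcon
        cases q with
        | nil =>
          have : d0.tgt = G.side v w i := hq.1.1.2
          exact hG.noloop d0 (hi.trans this.symm)
        | cons e q =>
          have : e.src = d0.tgt := hq.1.1.2.1
          exact off_side (hoff e (by simp)) j (this.trans hj)
      obtain ⟨m, d2, rfl, k1, k2, hm⟩ := off_of_src_tail hq.1.1 hoff (fun h => off_side h _ rfl) ht
      obtain ⟨k, l1, l2⟩ := arc_comp hG hvw hn hq.1 ht k2 hm
      obtain ⟨P', f1, f2⟩ := lift_arc hG hn hq.1.1 ht k2 hm l1 l2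
      exact ⟨_, _, P', hp, f2, f1⟩
  · left
    push Not at h0
    have h0 : ∀ d ∈ C, Off v w d.src := fun d hd => by
      by_contra h; exact h (h0 d hd)
    obtain ⟨d, q, rfl⟩ := List.exists_cons_of_ne_nil hC.2.1
    have hx : Off v w x := by
      have : d.src = x := hC.1.1.1
      rw [← this]; exact h0 d (by simp)
    have ht : ∀ d' ∈ d :: q, Off v w d'.tgt := by
      intro d' hd'
      by_cases h : d'.tgt = x
      · rw [h]; exact hx
      · obtain ⟨p1, p2, hp⟩ := List.append_of_mem hd'
        have hw := hC.1.1
        rw [hp] at hw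
        obtain ⟨_, w2⟩ := wk_split.1 hw
        cases p2 with
        | nil => exact absurd w2 h
        | cons f p2 => exact w2.1 ▸ h0 f (by rw [hp]; simp)
    obtain ⟨hy, m', f1, f2⟩ := lift_old r hC.1.1 hx fun d' hd' => ⟨h0 d' hd', ht d' hd'⟩
    exact ⟨_, _, m', .refl _, f2, f1⟩

/-! ### Walks replacing torso edges -/

/-- On some short cycle the cut at `v` into `k` has nonzero sum, so the cycle passes through both
`v` and `w`. One of its two arcs avoids `k`, which shows that the torso length is the length of an
actual short walk. -/
theorem exists_torso (hG : Good r G) (h : LS r v w) (k : G.LocalComp r v w) :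
    ∃ T, SW r v T w ∧ plen T = G.torsoLen r v w k := by
  obtain ⟨hvw, hn, -⟩ := id h
  obtain ⟨hp1, hp2⟩ := h.proper_K hG k
  obtain ⟨x, C, hC, hne⟩ := exists_cyc (g_anti _ _) (hG.link v _ hp1)
  have hb := bal_K hG hvw hn k
  have hne2 : csum (g w (Kset r v w k)) C ≠ 0 := by
    have := hb.1 _ _ hC.1
    rw [csum_chi] at this; omega
  obtain ⟨d, e, q1, q2, hp, hcyc, s1, s2, t1, t2⟩ := hC.split hvw false
    (exists_src_of_csum_g_ne hC.1.1 hne) (exists_src_of_csum_g_ne hC.1.1 hne2)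
  obtain ⟨o1, a1, a2, a3⟩ := arc_spec hG hvw hn s1 t1
  obtain ⟨o2, b1, b2, b3⟩ := arc_spec (i := true) hG hvw hn s2 t2
  by_cases c1 : o1 = some k
  · by_cases c2 : o2 = some k
    -- If both arcs ran through `k`, all edges of the cycle at `v` would lead into `k`, and the sum
    -- would be zero.
    · exfalso
      apply hne
      classical
      rw [← csum_perm _ hp]
      have : csum (g v (Kset r v w k)) (d :: q1 ++ e :: q2) =
          csum (g v Set.univ) (d :: q1 ++ e :: q2) := by
        refine csum_congr fun f hf => ?_
        by_cases hv : f.src = v ∨ f.tgt = v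
        · have hK : f.e ∈ Kset r v w k := by
            have hno : ¬ Off v w f.src ∨ ¬ Off v w f.tgt :=
              hv.imp (fun h1 h2 => h2.1 h1) fun h1 h2 => h2.1 h1
            rcases List.mem_append.1 hf with hf | hf
            · exact (a3 k c1).1 f hf hno
            · exact (b3 k c2).1 f hf hno
          simp [g, hK]
        · push Not at hv
          rw [g_of_ne hv.1 hv.2, g_of_ne hv.1 hv.2]
      rw [this, g_univ hcyc.1.1, sub_self]
    · obtain ⟨T, h1, h2, -⟩ := exists_torso_walk hG hvw hn k s2.symm (fun f hf => by
        exact b1 k c2 f.symm (mem_of_rev hf))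
      exact ⟨T, h1, h2⟩
  · obtain ⟨T, h1, h2, -⟩ := exists_torso_walk hG hvw hn k s1 (a1 k c1)
    exact ⟨T, h1, h2⟩

/-- Shortest walks that may replace the torso edges. -/
def TorsoWalks (r : ℕ∞) (v w : G.V) (T : G.LocalComp r v w → List G.Dart) : Prop :=
  ∀ k, SW r v (T k) w ∧ plen (T k) = G.torsoLen r v w k

theorem exists_torsoWalks (hG : Good r G) (h : LS r v w) : ∃ T, TorsoWalks r v w T := by
  choose T h1 h2 using exists_torso hG h
  exact ⟨T, fun k => ⟨h1 k, h2 k⟩⟩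

/-- Walks in the cut graph yield walks in the original graph. -/
theorem push {T : G.LocalComp r v w → List G.Dart} (hT : TorsoWalks r v w T)
    {x y : (G.cut r v w).V} {p' : List (G.cut r v w).Dart} (hp : Wk x p' y) (hx : Main x) :
    Main y ∧ ∃ p, Wk (proj x) p (proj y) ∧ plen p = plen p' ∧
      ∀ (c' : (G.cut r v w).Dart → ℤ) (c : G.Dart → ℤ), Anti c' → Anti c → Compat c' c →
        (∀ k, c' (torDart k false) = csum c (T k)) → csum c p = csum c' p' := by
  induction p' generalizing x with
  | nil => obtain rfl := hp; exact ⟨hx, [], rfl, rfl, fun _ _ _ _ _ _ => rfl⟩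
  | cons d' p' ih =>
    obtain ⟨rfl, hp⟩ := hp
    rcases main_dart_cases hx with ⟨d, hd⟩ | ⟨k, i, rfl⟩
    · obtain ⟨h1, p, h2, h3, h4⟩ := ih hp hd.symm.main
      refine ⟨h1, d :: p, ⟨hd.src.symm, hd.tgt ▸ h2⟩, ?_, ?_⟩
      · rw [plen_cons, plen_cons, h3, hd.len]
      · intro c' c a' a hc ht
        rw [csum_cons, csum_cons, h4 c' c a' a hc ht, hc _ _ hd]
    · obtain ⟨h1, p, h2, h3, h4⟩ := ih hp (main_cSlice _ _)
      cases i
      · refine ⟨h1, T k ++ p, (hT k).1.1.append h2, ?_, ?_⟩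
        · rw [plen_append, plen_cons, h3, (hT k).2]; rfl
        · intro c' c a' a hc ht
          rw [csum_append, csum_cons, h4 c' c a' a hc ht, ht]
      · refine ⟨h1, rev (T k) ++ p, (hT k).1.1.rev.append h2, ?_, ?_⟩
        · rw [plen_append, plen_rev, plen_cons, h3, (hT k).2]; rfl
        · intro c' c a' a hc ht
          have : (torDart k true : (G.cut r v w).Dart) = (torDart k false).symm := rfl
          rw [csum_append, csum_cons, h4 c' c a' a hc ht, csum_rev a, this, a', ht]

theorem push_sw {T : G.LocalComp r v w → List G.Dart} (hT : TorsoWalks r v w T)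
    {x y : (G.cut r v w).V} {p' : List (G.cut r v w).Dart} (hp : SW r x p' y) (hx : Main x) :
    Main y ∧ ∃ p, SW r (proj x) p (proj y) ∧
      ∀ (c' : (G.cut r v w).Dart → ℤ) (c : G.Dart → ℤ), Anti c' → Anti c → Compat c' c →
        (∀ k, c' (torDart k false) = csum c (T k)) → csum c p = csum c' p' := by
  obtain ⟨h1, q', h2, h3⟩ := hp
  obtain ⟨hy, p, e1, e2, e3⟩ := push hT h1 hx
  obtain ⟨-, q, f1, f2, -⟩ := push hT h2 hy
  exact ⟨hy, p, ⟨e1, q, f1, by rwa [e2, f2]⟩, e3⟩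

/-- Short closed walks of the main part push down to short closed walks with the same sum. A walk
not in the main part stays in an artificial component, where the cochain is zero. -/
theorem van_cut {T : G.LocalComp r v w → List G.Dart} (hT : TorsoWalks r v w T)
    {c' : (G.cut r v w).Dart → ℤ} {c : G.Dart → ℤ} (a' : Anti c') (a : Anti c) (hc : Compat c' c)
    (ht : ∀ k, c' (torDart k false) = csum c (T k)) (ha : ∀ d', ¬ Main d'.src → c' d' = 0)
    (h : Van r c) : Van r c' := by
  intro x p' hp
  by_cases hx : Main x
  · obtain ⟨-, p, h1, h2⟩ := push_sw hT hp hx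
    rw [← h2 c' c a' a hc ht]
    exact h _ _ h1
  · refine csum_eq_zero fun d' hd' => ha d' fun hm => hx ?_
    obtain ⟨p1, p2, rfl⟩ := List.append_of_mem hd'
    exact (push hT (wk_split.1 hp.1).1.rev hm).1

/-- Cochains vanishing on torso edges and on edges inside the separator. -/
theorem van_of_cut (hG : Good r G) (hvw : v ≠ w) (hn : Near r v w)
    {c' : (G.cut r v w).Dart → ℤ} {c : G.Dart → ℤ} (a' : Anti c') (a : Anti c) (hc : Compat c' c)
    (ht : ∀ k, c' (torDart k false) = 0) (h0 : ∀ d : G.Dart, d.src = v → d.tgt = w → c d = 0)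
    (h : Van r c') : Van r c := by
  by_contra hcon
  obtain ⟨x, C, hC, hne⟩ := exists_cyc a hcon
  have ht' : ∀ k i, c' (torDart k i) = 0 := by
    intro k i
    cases i
    · exact ht k
    · rw [show (torDart k true : (G.cut r v w).Dart) = (torDart k false).symm from rfl, a', ht,
        neg_zero]
  -- Such an arc is an edge on which the cochain is zero, or it is closed up by a torso edge on
  -- which the lifted cochain is zero.
  have hpiece : ∀ i P, Piece r v w i P → csum c P = 0 := by
    rintro i P ⟨hs, ⟨d, rfl⟩ | ⟨k, P', f1, f2, f3⟩⟩
    · have e1 : d.src = G.side v w i := hs.1.1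
      have e2 : d.tgt = G.side v w !i := hs.1.2
      rw [csum_cons, csum_nil, add_zero]
      cases i
      · exact h0 d e1 e2
      · have := h0 d.symm e2 e1
        rw [a] at this; omega
    · have hw : Wk (cSlice k i) (P' ++ [torDart k !i]) (cSlice k i) :=
        f2.append ⟨rfl, by show cSlice k (!!i) = _; rw [Bool.not_not]⟩
      have hl : plen [torDart k !i] = G.torsoLen r v w k := by
        rw [plen_cons, plen_nil, add_zero]; rfl
      have := h _ _ (SW.of_closed hw (by rw [plen_append, plen_of_DR f1, hl]; exact f3))
      rw [csum_append, csum_cons, csum_nil, ht', hc.csum f1] at this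
      omega
  rcases lift_cyc hG hvw hn hC with ⟨C2, x', p', hp, hw, hf⟩ | ⟨i, P1, P2, hp, h1, h2⟩
  · apply hne
    rw [← csum_perm c hp, ← hc.csum hf]
    refine h _ _ (SW.of_closed hw ?_)
    rw [plen_of_DR hf]
    have : plen C2 = plen C := (hp.map _).sum_eq
    rw [this]; exact hC.1.closed_le
  · apply hne
    rw [← csum_perm c hp, csum_append, hpiece _ _ h1, hpiece _ _ h2, add_zero]

/-! ### Slices and local components -/

/-- The potential on the cut graph that is `-σ k` on the slices for `k`. -/
def slPot (σ : G.LocalComp r v w → ℤ) : (G.cut r v w).V → ℤ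
  | .old _ _ => 0
  | .slice k _ => - σ k
  | .art _ _ _ => 0

/-- A separation is constant on local components. On the main part of the cut graph its cochain thus
becomes the difference of a potential that only depends on the slices, so sums along short walks can
be read off from the ends. -/
theorem push_pot (hT : ∃ T, TorsoWalks r v w T) {A B : Set G.E} (hb : Bal r v A w B)
    {σ : G.LocalComp r v w → ℤ}
    (hσ : ∀ (d : G.Dart) i k, d.src = G.side v w i → Off v w d.tgt → d.e ∈ Kset r v w k →
      chi v A w B d = σ k)
    {x y : (G.cut r v w).V} {p' : List (G.cut r v w).Dart} (hp : SW r x p' y) (hx : Main x) :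
    ∃ p, SW r (proj x) p (proj y) ∧ csum (chi v A w B) p = slPot σ y - slPot σ x := by
  obtain ⟨T, hT⟩ := hT
  obtain ⟨-, p, h1, h2⟩ := push_sw hT hp hx
  refine ⟨p, h1, ?_⟩
  rw [h2 (fun d => slPot σ d.tgt - slPot σ d.src) _ (fun d => by simp) (chi_anti _ _ _ _) ?_ ?_]
  · exact csum_potential _ hp.1 fun _ _ => rfl
  · intro d' d h
    cases h with
    | old d a b => rw [chi_off a b]; rfl
    | inh d i hs ho k hk =>
      rw [hσ d i k hs ho ⟨i, hk⟩]
      show (0 : ℤ) - - σ k = σ k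
      ring
    | inh_symm d i hs ho k hk =>
      rw [chi_anti, hσ d i k hs ho ⟨i, hk⟩]
      show - σ k - (0 : ℤ) = - σ k
      ring
  · intro k
    rw [hb.2 _ (hT k).1]
    show - σ k - - σ k = 0
    ring

open Classical in
theorem push_pot_K (hG : Good r G) (h : LS r v w) (k0 : G.LocalComp r v w)
    {x y : (G.cut r v w).V} {p' : List (G.cut r v w).Dart} (hp : SW r x p' y) (hx : Main x) :
    ∃ p, SW r (proj x) p (proj y) ∧ csum (chi v (Kset r v w k0) w (Kset r v w k0)) p =
      slPot (fun k => if k = k0 then 1 else 0) y - slPot (fun k => if k = k0 then 1 else 0) x := by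
  refine push_pot (exists_torsoWalks hG h) (bal_K hG h.1 h.2.1 k0) ?_ hp hx
  intro d i k h1 h2 h3
  rw [chi_side h.1 h1 h2]
  simp only [Bool.cond_self]
  congr 1
  exact propext ⟨fun h' => Kset_disjoint hG h.2.1 h3 h', fun h' => h' ▸ h3⟩

theorem main_of_near (hG : Good r G) (h : LS r v w) {x y : (G.cut r v w).V} (hn : Near r x y)
    (hx : Main x) : Main y := by
  obtain ⟨T, hT⟩ := exists_torsoWalks hG h
  obtain ⟨p, hp⟩ := hn
  exact (push_sw hT hp hx).1

theorem near_proj (hG : Good r G) (h : LS r v w) {x y : (G.cut r v w).V} (hn : Near r x y)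
    (hx : Main x) : Near r (proj x) (proj y) := by
  obtain ⟨T, hT⟩ := exists_torsoWalks hG h
  obtain ⟨p, hp⟩ := hn
  obtain ⟨-, p, h1, -⟩ := push_sw hT hp hx
  exact ⟨p, h1⟩

/-- The separation by `k` has sum zero between separator vertices, while slices for different
components would differ in the potential of `push_pot_K`. -/
theorem near_slice (hG : Good r G) (h : LS r v w) {k k' : G.LocalComp r v w} {i j : Bool}
    (hn : Near r (cSlice k i) (cSlice k' j)) : k = k' := by
  classical
  obtain ⟨p', hp⟩ := hn
  obtain ⟨p, h1, h2⟩ := push_pot_K hG h k hp (main_cSlice _ _)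
  have hb := bal_K hG h.1 h.2.1 k
  have h0 : csum (chi v (Kset r v w k) w (Kset r v w k)) p = 0 := by
    cases i <;> cases j
    · exact hb.1 _ _ h1
    · exact hb.2 _ h1
    · rw [chi_comm]; exact hb.swap.2 _ h1
    · exact hb.1 _ _ h1
  rw [h0] at h2
  by_contra hne
  simp [slPot, Ne.symm hne] at h2

open Classical in
theorem near_slice_old (hG : Good r G) (h : LS r v w) {k : G.LocalComp r v w} {i : Bool}
    {t : G.V} {ht : Off v w t} (hn : Near r (cSlice k i) (cOld r t ht)) (k0 : G.LocalComp r v w)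
    {D : List G.Dart} (hD : SW r (G.side v w i) D t) :
    csum (chi v (Kset r v w k0) w (Kset r v w k0)) D = if k = k0 then 1 else 0 := by
  obtain ⟨p', hp⟩ := hn
  obtain ⟨p, h1, h2⟩ := push_pot_K hG h k0 hp (main_cSlice _ _)
  rw [(bal_K hG h.1 h.2.1 k0).1.eq (chi_anti _ _ _ _) hD h1, h2]
  simp [slPot]

/-- Lifts are determined by a near vertex. -/
theorem near_unique (hG : Good r G) (h : LS r v w) {x y : (G.cut r v w).V} (hn : Near r x y)
    (hx : Main x) (hp : proj x = proj y) : x = y := by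
  rcases hx.cases with ⟨u, hu, rfl⟩ | ⟨k, i, rfl⟩ <;>
    rcases (main_of_near hG h hn hx).cases with ⟨t, ht, rfl⟩ | ⟨k', j, rfl⟩
  · exact cOld_congr hp
  · exact absurd hp (off_side hu j)
  · exact absurd hp.symm (off_side ht i)
  · obtain rfl := near_slice hG h hn
    obtain rfl := side_inj h.1 hp
    rfl

/-- For a fixed short walk from the separator vertex to `t`, the sum of the separation by `k` is 1
for the component whose slice is near `t` and 0 for all others. -/
theorem near_unique' (hG : Good r G) (h : LS r v w) {x y : (G.cut r v w).V} {t : G.V}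
    {ht : Off v w t} (hx : Main x) (hy : Main y) (h1 : Near r x (cOld r t ht))
    (h2 : Near r y (cOld r t ht)) (hp : proj x = proj y) : x = y := by
  classical
  rcases hx.cases with ⟨u, hu, rfl⟩ | ⟨k, i, rfl⟩ <;> rcases hy.cases with ⟨s, hs, rfl⟩ | ⟨k', j, rfl⟩
  · exact cOld_congr hp
  · exact absurd hp (off_side hu j)
  · exact absurd hp.symm (off_side hs i)
  · obtain rfl := side_inj h.1 hp
    obtain ⟨D, hD⟩ := near_proj hG h h1 hx
    have e1 := near_slice_old hG h h1 k hD
    have e2 := near_slice_old hG h h2 k hD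
    rw [e1] at e2
    by_cases hk : k' = k
    · rw [hk]
    · simp [hk] at e2

end LenGraph

namespace LenGraph
variable {G : LenGraph.{u}} {r : ℕ∞} {v w : G.V}

/-! ### The cut graph is again good -/

/-- The edges below the edges in `A'` at the vertex `x`. -/
def downSet (x : (G.cut r v w).V) (A' : Set (G.cut r v w).E) : Set G.E :=
  {e | ∃ d' d, DR d' d ∧ d'.src = x ∧ d'.e ∈ A' ∧ d.e = e}

/-- The edges at the vertex `x` above the edges in `A`. -/
def upSet (x : (G.cut r v w).V) (A : Set G.E) : Set (G.cut r v w).E :=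
  {e | ∃ d' d, DR d' d ∧ d'.src = x ∧ d.e ∈ A ∧ d'.e = e}

theorem downSet_src (hG : Good r G) {x : (G.cut r v w).V} {A' : Set (G.cut r v w).E} {d : G.Dart}
    (hs : d.src = proj x) (h : d.e ∈ downSet x A') : ∃ d', DR d' d ∧ d'.src = x ∧ d'.e ∈ A' := by
  obtain ⟨d2', d2, h1, h2, h3, h4⟩ := h
  rcases Dart.eq_or_symm h4 with rfl | rfl
  · exact ⟨d2', h1, h2, h3⟩
  · have := h1.src
    rw [h2, ← hs] at this
    exact absurd this (hG.noloop d)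

theorem downSet_iff (hG : Good r G) (hvw : v ≠ w) (hn : Near r v w) {x : (G.cut r v w).V}
    {A' : Set (G.cut r v w).E} {d' : (G.cut r v w).Dart} {d : G.Dart} (hd : DR d' d)
    (hs : d'.src = x) : d.e ∈ downSet x A' ↔ d'.e ∈ A' := by
  constructor
  · intro h
    obtain ⟨d2', h1, h2, h3⟩ := downSet_src hG (by rw [← hd.src, hs]) h
    rwa [hd.functional hG hvw hn h1]
  · exact fun h => ⟨d', d, hd, hs, h, rfl⟩

theorem compat_downSet (hG : Good r G) (hvw : v ≠ w) (hn : Near r v w) (x : (G.cut r v w).V)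
    (A' : Set (G.cut r v w).E) : Compat (g x A') (g (proj x) (downSet x A')) := by
  have key : ∀ {d' : (G.cut r v w).Dart} {d : G.Dart}, DR d' d →
      ((d'.src = x ∧ d'.e ∈ A') ↔ (d.src = proj x ∧ d.e ∈ downSet x A')) := by
    intro d' d hd
    constructor
    · rintro ⟨rfl, h⟩
      exact ⟨hd.src.symm, (downSet_iff hG hvw hn hd rfl).2 h⟩
    · rintro ⟨h1, h2⟩
      obtain ⟨d2', h3, h4, h5⟩ := downSet_src hG h1 h2
      obtain rfl := hd.functional hG hvw hn h3
      exact ⟨h4, h5⟩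
  intro d' d hd
  have k1 := key hd
  have k2 := key hd.symm
  simp only [Dart.symm_src, Dart.symm_e] at k2
  clear key
  unfold g
  split_ifs <;> first | rfl | (exfalso; tauto)

theorem compat_upSet {x : (G.cut r v w).V} {A : Set G.E}
    (hA : ∀ d' d, DR d' d → d.src = proj x → d.e ∈ A → d'.src = x) :
    Compat (g x (upSet x A)) (g (proj x) A) := by
  have key : ∀ {d' : (G.cut r v w).Dart} {d : G.Dart}, DR d' d →
      ((d'.src = x ∧ d'.e ∈ upSet x A) ↔ (d.src = proj x ∧ d.e ∈ A)) := by
    intro d' d hd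
    constructor
    · rintro ⟨rfl, d2', d2, h1, h2, h3, h4⟩
      have := h1.edge
      rw [h4, hd.edge] at this
      exact ⟨hd.src.symm, by rwa [Option.some.inj this]⟩
    · rintro ⟨h1, h2⟩
      exact ⟨hA d' d hd h1 h2, d', d, hd, hA d' d hd h1 h2, h2, rfl⟩
  intro d' d hd
  have k1 := key hd
  have k2 := key hd.symm
  simp only [Dart.symm_src, Dart.symm_e] at k2
  clear key
  unfold g
  split_ifs <;> first | rfl | (exfalso; tauto)

theorem tor_notMem_upSet (x : (G.cut r v w).V) (A : Set G.E) (k : G.LocalComp r v w) (i : Bool) :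
    (torDart k i).e ∉ upSet x A := by
  rintro ⟨d', d, h1, -, -, h2⟩
  have := h1.edge
  rw [h2] at this
  cases this

theorem sep_notMem_downSet {x : (G.cut r v w).V} {A' : Set (G.cut r v w).E} {d : G.Dart}
    (h1 : d.src = v) (h2 : d.tgt = w) : d.e ∉ downSet x A' := by
  rintro ⟨d2', d2, e1, -, -, e2⟩
  have := e1.off
  rcases Dart.eq_or_symm e2 with rfl | rfl
  · rcases this with h | h
    exacts [h.1 h1, h.2 h2]
  · rcases this with h | h
    exacts [h.2 h2, h.1 h1]

theorem downSet_K (hG : Good r G) (hvw : v ≠ w) {k : G.LocalComp r v w} {i : Bool}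
    {A' : Set (G.cut r v w).E} {d : G.Dart} (hs : d.src = G.side v w i)
    (h : d.e ∈ downSet (cSlice k i) A') : d.e ∈ Kset r v w k := by
  obtain ⟨d', h1, h2, -⟩ := downSet_src hG (x := cSlice k i) hs h
  obtain ⟨k', h3, h4⟩ := h1.src_side hvw hs
  obtain ⟨rfl, -⟩ := cSlice_inj (h2.symm.trans h3)
  exact h4

/-- If the edge outside `A'` is a torso edge, it has no counterpart below. An edge of the separator
vertex outside `k` takes its place, since the slice for `k` does not inherit it. -/
theorem downSet_proper (hG : Good r G) (h : LS r v w) {x : (G.cut r v w).V} (hx : Main x)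
    {A' : Set (G.cut r v w).E} (hp : Proper x A')
    (ht : ∀ k i, cSlice k i = x → (torDart k i).e ∉ A') : Proper (proj x) (downSet x A') := by
  obtain ⟨hvw, hn, -⟩ := id h
  obtain ⟨⟨d', rfl, h2⟩, d'', h3, h4⟩ := hp
  constructor
  · rcases main_dart_cases hx with ⟨d, hd⟩ | ⟨k, i, rfl⟩
    · exact ⟨d, hd.src.symm, (downSet_iff hG hvw hn hd rfl).2 h2⟩
    · exact absurd h2 (ht k i rfl)
  · rcases main_dart_cases (d' := d'') (h3 ▸ hx) with ⟨d, hd⟩ | ⟨k, i, rfl⟩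
    · exact ⟨d, by rw [← hd.src, h3], fun h => h4 ((downSet_iff hG hvw hn hd h3).1 h)⟩
    · obtain ⟨d, h5, h6⟩ := (h.proper_K_side hG k i).2
      rw [← h3]
      exact ⟨d, h5, fun h => h6 (downSet_K hG hvw h5 h)⟩

theorem g_tor {x : (G.cut r v w).V} {A' : Set (G.cut r v w).E}
    (ht : ∀ k i, cSlice k i = x → (torDart k i).e ∉ A') (k : G.LocalComp r v w) :
    g x A' (torDart k false) = 0 := by
  by_cases h1 : (torDart k false : (G.cut r v w).Dart).src = x
  · exact g_of_notMem (ht k false h1)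
  · by_cases h2 : (torDart k false : (G.cut r v w).Dart).tgt = x
    · exact g_of_notMem (ht k true h2)
    · exact g_of_ne h1 h2

theorem tor_of_slice {k0 : G.LocalComp r v w} {i0 : Bool} {A' : Set (G.cut r v w).E}
    (h0 : (CutE.torso k0 : (G.cut r v w).E) ∉ A') (k : G.LocalComp r v w) (i : Bool)
    (h : (cSlice k i : (G.cut r v w).V) = cSlice k0 i0) : (torDart k i).e ∉ A' := by
  obtain ⟨rfl, rfl⟩ := cSlice_inj h
  exact h0

/-- Up to complementing, the torso edge at a slice is not in `A'`. Then the cochain is zero on torso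
edges and `van_of_cut` turns `x` into a local cutvertex of the original graph. -/
theorem cut_link (hG : Good r G) (h : LS r v w) {x : (G.cut r v w).V} (hx : Main x)
    {A' : Set (G.cut r v w).E} (hp : Proper x A') : ¬ Van r (g x A') := by
  obtain ⟨hvw, hn, -⟩ := id h
  have aux : ∀ {A' : Set (G.cut r v w).E}, Proper x A' →
      (∀ k i, cSlice k i = x → (torDart k i).e ∉ A') → ¬ Van r (g x A') := by
    intro A' hp ht hv
    exact hG.link _ _ (downSet_proper hG h hx hp ht) (van_of_cut hG hvw hn (g_anti _ _) (g_anti _ _)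
      (compat_downSet hG hvw hn x A') (g_tor ht)
      (fun d h1 h2 => g_of_notMem (sep_notMem_downSet h1 h2)) hv)
  intro hv
  rcases hx.cases with ⟨u, hu, rfl⟩ | ⟨k, i, rfl⟩
  · exact aux hp (fun k i h => by cases h) hv
  · by_cases ht : (CutE.torso k : (G.cut r v w).E) ∈ A'
    · refine aux hp.compl (tor_of_slice fun h => h ht) ?_
      classical
      intro y p hy
      rw [csum_g_compl, g_univ hy.1, hv y p hy]; ring
    · exact aux hp (tor_of_slice ht) hv

theorem finite_localComp (hG : Good r G) (hn : Near r v w) : Finite (G.LocalComp r v w) := by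
  have := hG.finE
  choose d i h1 h2 h3 using fun k => exists_dart_comp hG hn k
  exact Finite.of_injective (fun k => (d k).e) fun k k' h =>
    Kset_disjoint hG hn (h3 k) (by have : (d k).e = (d k').e := h; rw [this]; exact h3 k')

theorem finite_cutV (hG : Good r G) (hn : Near r v w) : Finite (G.cut r v w).V := by
  have := hG.finV
  have := hG.finE
  have := finite_localComp hG hn
  let f : G.CutV r v w → G.V ⊕ (G.LocalComp r v w × Bool) ⊕ (G.E × Bool) := fun x => match x with
    | .old x _ => .inl x
    | .slice k i => .inr (.inl (k, i))
    | .art e _ i => .inr (.inr (e, i))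
  have hf : Function.Injective f := by
    intro x y h
    cases x <;> cases y <;> simp_all [f]
  exact Finite.of_injective (α := G.CutV r v w) f hf

theorem finite_cutE (hG : Good r G) (hn : Near r v w) : Finite (G.cut r v w).E := by
  have := hG.finV
  have := hG.finE
  have := finite_localComp hG hn
  let f : G.CutE r v w → G.E ⊕ (G.E × Bool × G.V × G.LocalComp r v w) ⊕ G.LocalComp r v w ⊕ G.E ⊕ G.E :=
    fun x => match x with
    | .old x _ => .inl x
    | .inherited e i y _ _ k _ => .inr (.inl (e, i, y, k))
    | .torso k => .inr (.inr (.inl k))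
    | .artOld e _ => .inr (.inr (.inr (.inl e)))
    | .artTorso e _ => .inr (.inr (.inr (.inr e)))
  have hf : Function.Injective f := by
    intro x y h
    cases x <;> cases y <;> simp_all [f]
  exact Finite.of_injective (α := G.CutE r v w) f hf

theorem cArt_inj {e e' : G.E} {he : G.ends e = s(v, w)} {he' : G.ends e' = s(v, w)} {i j : Bool}
    (h : cArt r e he i = cArt r e' he' j) : e = e' ∧ i = j := by cases h; exact ⟨rfl, rfl⟩

theorem cut_noloop (hG : Good r G) (d' : (G.cut r v w).Dart) : d'.src ≠ d'.tgt := by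
  rcases cut_dart_cases d' with ⟨d, hd⟩ | ⟨k, i, rfl⟩ | ⟨e, he, i, rfl | rfl⟩
  · intro h
    apply hG.noloop d
    rw [← hd.src, ← hd.tgt, h]
  · intro h
    have := (cSlice_inj h).2
    cases i <;> cases this
  · intro h
    have := (cArt_inj h).2
    cases i <;> cases this
  · intro h
    have := (cArt_inj h).2
    cases i <;> cases this

theorem plen_pos (hpos : ∀ e, 0 < G.len e) (hvw : v ≠ w) {p : List G.Dart} (h : Wk v p w) :
    0 < plen p := by
  cases p with
  | nil => exact absurd h hvw
  | cons d p => rw [plen_cons]; have := hpos d.e; omega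

theorem cut_pos (hG : Good r G) (h : LS r v w) (e' : (G.cut r v w).E) : 0 < (G.cut r v w).len e' := by
  obtain ⟨T, hT⟩ := exists_torsoWalks hG h
  cases e' with
  | old e _ => exact hG.pos e
  | inherited e _ _ _ _ _ _ => exact hG.pos e
  | torso k =>
    show 0 < G.torsoLen r v w k
    rw [← (hT k).2]
    exact plen_pos hG.pos h.1 (hT k).1.1
  | artOld e _ => exact hG.pos e
  | artTorso e he =>
    obtain ⟨⟨T, h1, h2⟩, -⟩ := artLen hG h.2.1
    show 0 < sInf _
    rw [← h2]
    exact plen_pos hG.pos h.1 h1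

/-- The edges at a vertex of an artificial component. -/
theorem art_dart {d' : (G.cut r v w).Dart} {e : G.E} {he : G.ends e = s(v, w)} {i : Bool}
    (h : d'.src = cArt r e he i) : d' = artDart r e he i ∨ d' = artTorDart r e he i := by
  rcases cut_dart_cases d' with ⟨d, hd⟩ | ⟨k, j, rfl⟩ | ⟨e', he', j, rfl | rfl⟩
  · exact absurd h (hd.main e he i)
  · cases h
  · obtain ⟨rfl, rfl⟩ := cArt_inj h
    exact .inl rfl
  · obtain ⟨rfl, rfl⟩ := cArt_inj h
    exact .inr rfl

/-- A `v`–`w` edge lies on a short closed walk. Its remaining part is a short walk between `v` and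
`w`, so it is at least as long as the artificial torso edge. -/
theorem art_short (hG : Good r G) (h : LS r v w) {e : G.E} (he : G.ends e = s(v, w)) (i : Bool) :
    SW r (cArt r e he i) [artDart r e he i, (artTorDart r e he i).symm] (cArt r e he i) := by
  refine SW.of_closed ⟨rfl, rfl, rfl⟩ ?_
  obtain ⟨-, q, h1, h2⟩ := hG.edgeClose ⟨v, w, e, he⟩
  have h3 : SW r v (rev q) w := by
    refine SW.symm ⟨h1, [⟨v, w, e, he⟩], ⟨rfl, rfl⟩, by rwa [add_comm]⟩
  have h4 := (artLen hG h.2.1).2 _ h3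
  rw [plen_rev] at h4
  refine le_trans_cast h2 ?_
  simp only [plen_cons, plen_nil, add_zero]
  have e1 : (G.cut r v w).len (artDart r e he i).e = G.len e := rfl
  have e2 : (G.cut r v w).len (artTorDart r e he i).symm.e =
    sInf {n | (G.expl r v w).HasWalk (G.base r v w false) (G.base r v w true) n} := rfl
  rw [e1, e2]
  exact Nat.add_le_add_left h4 _

/-- Parallel edges of the main part come from parallel edges below. At a slice for `k` these would
be all edges of the separator vertex and would all lead into `k`, although `Kset r v w k` is proper.
A torso edge has no parallel, because edges between `v` and `w` are moved to artificial components.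
-/
theorem cut_par (hG : Good r G) (h : LS r v w) (d d' d'' : (G.cut r v w).Dart)
    (hs : d.src = d'.src) (ht : d.tgt = d'.tgt) (hne : d.e ≠ d'.e) (hs' : d''.src = d.src) :
    d''.e = d.e ∨ d''.e = d'.e := by
  obtain ⟨hvw, hn, -⟩ := id h
  by_cases hm : Main d.src
  · rcases main_dart_cases hm with ⟨f, hf⟩ | ⟨k, i, rfl⟩
    · rcases main_dart_cases (d' := d') (hs ▸ hm) with ⟨f', hf'⟩ | ⟨k, i, rfl⟩
      · have e1 : f.src = f'.src := by rw [← hf.src, ← hf'.src, hs]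
        have e2 : f.tgt = f'.tgt := by rw [← hf.tgt, ← hf'.tgt, ht]
        have e3 : f.e ≠ f'.e := by
          intro h3
          obtain rfl := Dart.ext' e1 e2 h3
          exact hne (congrArg Dart.e (hf.functional hG hvw hn hf'))
        have key : ∀ {d d' : (G.cut r v w).Dart} {f f' : G.Dart}, DR d f → DR d' f' →
            d.src = d'.src → f.src = f'.src → f.tgt = f'.tgt → f.e ≠ f'.e → Off v w f.src := by
          intro d d' f f' hf hf' hs e1 e2 e3
          by_contra hcon
          obtain ⟨i, hi⟩ := not_off hcon
          obtain ⟨k, h1, h2⟩ := hf.src_side hvw hi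
          obtain ⟨k', h1', h2'⟩ := hf'.src_side hvw (e1 ▸ hi)
          rw [hs, h1'] at h1
          obtain ⟨rfl, -⟩ := cSlice_inj h1
          obtain ⟨f3, h3, h4⟩ := (h.proper_K_side hG k' i).2
          rcases hG.par f f' f3 e1 e2 e3 (h3.trans hi.symm) with h5 | h5
          · exact h4 (h5 ▸ h2)
          · exact h4 (h5 ▸ h2')
        have o1 := key hf hf' hs e1 e2 e3
        rcases main_dart_cases (d' := d'') (hs' ▸ hm) with ⟨f3, hf3⟩ | ⟨k, i, rfl⟩
        · have e4 : f3.src = f.src := by rw [← hf.src, ← hf3.src, hs']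
          rcases hG.par f f' f3 e1 e2 e3 e4 with h5 | h5
          · left
            rcases Dart.eq_or_symm h5 with rfl | rfl
            · exact congrArg Dart.e (hf3.functional hG hvw hn hf)
            · exact absurd e4.symm (hG.noloop f)
          · right
            rcases Dart.eq_or_symm h5 with rfl | rfl
            · exact congrArg Dart.e (hf3.functional hG hvw hn hf')
            · exact absurd (e4.trans e1).symm (hG.noloop f')
        · rw [hf.src_off o1] at hs'
          cases hs'
      · exfalso
        have e1 : f.src = G.side v w i := by rw [← hf.src, hs]; rfl
        have e2 : f.tgt = G.side v w !i := by rw [← hf.tgt, ht]; rfl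
        rcases hf.off with h | h
        exacts [off_side h _ e1, off_side h _ e2]
    · rcases main_dart_cases (d' := d') (hs ▸ hm) with ⟨f', hf'⟩ | ⟨k', i', rfl⟩
      · exfalso
        have e1 : f'.src = G.side v w i := by rw [← hf'.src, ← hs]; rfl
        have e2 : f'.tgt = G.side v w !i := by rw [← hf'.tgt, ← ht]; rfl
        rcases hf'.off with h | h
        exacts [off_side h _ e1, off_side h _ e2]
      · obtain ⟨rfl, rfl⟩ := cSlice_inj hs
        exact absurd rfl hne
  · simp only [Main, not_forall, not_not] at hm
    obtain ⟨e, he, i, hi⟩ := hm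
    rcases art_dart hi with rfl | rfl <;> rcases art_dart (hs ▸ hi) with rfl | rfl <;>
      rcases art_dart (hs'.trans hi) with rfl | rfl <;> first
      | exact .inl rfl
      | exact .inr rfl
      | exact absurd rfl hne

theorem Good.cut (hG : Good r G) (h : LS r v w) : Good r (G.cut r v w) where
  finV := finite_cutV hG h.2.1
  finE := finite_cutE hG h.2.1
  noloop := cut_noloop hG
  pos := cut_pos hG h
  link := by
    intro x A' hp
    by_cases hx : Main x
    · exact cut_link hG h hx hp
    · simp only [Main, not_forall, not_not] at hx
      obtain ⟨e, he, i, rfl⟩ := hx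
      intro hv
      have h0 := hv _ _ (art_short hG h he i)
      have hii : i ≠ !i := by cases i <;> simp
      have hne : cArt r e he (!i) ≠ cArt r e he i := fun h => hii (cArt_inj h).2.symm
      have e1 : (artDart r e he i).src = cArt r e he i := rfl
      have e2 : (artDart r e he i).tgt = cArt r e he !i := rfl
      have e3 : (artTorDart r e he i).src = cArt r e he i := rfl
      have e4 : (artTorDart r e he i).tgt = cArt r e he !i := rfl
      rw [csum_cons, csum_cons, csum_nil] at h0
      simp only [g, Dart.symm_src, Dart.symm_tgt, Dart.symm_e, e1, e2, e3, e4, hne] at h0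
      obtain ⟨⟨d', h1, h2⟩, d'', h3, h4⟩ := hp
      rcases art_dart h1 with rfl | rfl <;> rcases art_dart h3 with rfl | rfl <;> simp_all
  deg2 := by
    intro x
    rcases cut_cases x with ⟨u, hu, rfl⟩ | ⟨k, i, rfl⟩ | ⟨e, he, i, rfl⟩
    · obtain ⟨d1, d2, h1, h2, h3⟩ := hG.deg2 u
      subst h1
      obtain ⟨d1', e1⟩ := exists_DR hG h.2.1 (d := d1) (.inl hu)
      obtain ⟨d2', e2⟩ := exists_DR hG h.2.1 (d := d2) (.inl (h2.symm ▸ hu))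
      refine ⟨d1', d2', e1.src_off hu, (e2.src_off (h2.symm ▸ hu)).trans (cOld_congr h2), ?_⟩
      intro h4
      have := e1.edge
      rw [h4, e2.edge] at this
      exact h3 (Option.some.inj this).symm
    · obtain ⟨d, h1, h2⟩ := (h.proper_K_side hG k i).1
      have ho : Off v w d.tgt := by
        by_contra hcon
        obtain ⟨j, hj⟩ := not_off hcon
        exact notMem_Kset_of_sides hG h.2.1 d h1 hj k h2
      obtain ⟨d', e1, e2, -⟩ := exists_DR_side hG h.2.1 h1 ho h2
      refine ⟨torDart k i, d', rfl, e2, fun h4 => ?_⟩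
      have := e1.edge
      rw [← h4] at this
      cases this
    · exact ⟨artDart r e he i, artTorDart r e he i, rfl, rfl, fun h => by cases h⟩
  par := cut_par hG h

end LenGraph

namespace LenGraph
variable {G : LenGraph.{u}} {r : ℕ∞} {v w : G.V}

/-! ### Separations that do not cross the one being cut. -/

/-- A separation at `{v, w}` with edges not joining `v` and `w` on both sides. -/
def Sep (r : ℕ∞) (v : G.V) (A : Set G.E) (w : G.V) (B : Set G.E) : Prop :=
  Bal r v A w B ∧
    (∃ d : G.Dart, (d.src = v ∧ d.tgt ≠ w ∧ d.e ∈ A) ∨ (d.src = w ∧ d.tgt ≠ v ∧ d.e ∈ B)) ∧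
    ∃ d : G.Dart, (d.src = v ∧ d.tgt ≠ w ∧ d.e ∉ A) ∨ (d.src = w ∧ d.tgt ≠ v ∧ d.e ∉ B)

theorem Sep.compl {A B : Set G.E} (hvw : v ≠ w) (h : Sep r v A w B) : Sep r v Aᶜ w Bᶜ := by
  obtain ⟨h1, ⟨d, h2⟩, d', h3⟩ := h
  exact ⟨h1.compl hvw, ⟨d', h3⟩, d, h2.imp (fun h => ⟨h.1, h.2.1, fun h' => h' h.2.2⟩)
    fun h => ⟨h.1, h.2.1, fun h' => h' h.2.2⟩⟩

theorem Sep.proper {A B : Set G.E} (hG : Good r G) (hvw : v ≠ w) (hn : Near r v w)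
    (h : Sep r v A w B) : Proper v A := by
  obtain ⟨h3, ⟨d, hd⟩, d', hd'⟩ := h
  exact h3.proper hG hvw hn (hd.imp (fun h => ⟨h.1, h.2.2⟩) fun h => ⟨h.1, h.2.2⟩)
    (hd'.imp (fun h => ⟨h.1, h.2.2⟩) fun h => ⟨h.1, h.2.2⟩)

theorem chi_side_eq (K : Set G.E) (i : Bool) :
    chi (G.side v w i) K (G.side v w !i) K = chi v K w K := by
  cases i
  · rfl
  · exact chi_comm _ _ _ _

/-- The intersection of two separations that share a vertex and do not separate one another. -/
theorem inter_van {A B A1 B1 : Set G.E} {b : G.V} (hvw : v ≠ w) (hb : Off v w b)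
    (hl : ∀ d : G.Dart, d.src ≠ d.tgt) (h1 : Bal r v A w B) (h2 : Bal r v A1 b B1)
    (hw : ∀ D, SW r v D w → csum (chi v A1 b B1) D = 0)
    (hb' : ∀ D, SW r v D b → csum (chi v A w B) D = 0) : Van r (g v (A ∩ A1)) := by
  refine van_of_base {v} ?_ fun d h1 h2 => g_of_ne h1 h2
  rintro x p rfl hp
  -- Both potentials vanish at `v`, `w` and `b`. Their product therefore changes only at `v`, namely
  -- on the edges lying in both `A` and `A1`.
  rw [csum_telescope (fun q => csum (chi x A w B) q * csum (chi x A1 b B1) q) p]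
  · rw [h1.1 x p hp]; simp
  · rintro q d s rfl
    obtain ⟨s1, s2, _⟩ := hp.prefix
    have f : d.src = x ∨ d.src = w ∨ d.src = b →
        csum (chi x A w B) q = 0 ∧ csum (chi x A1 b B1) q = 0 := by
      rintro (h | h | h)
      · exact ⟨h1.1 x q (h ▸ s1), h2.1 x q (h ▸ s1)⟩
      · exact ⟨h1.2 q (h ▸ s1), hw q (h ▸ s1)⟩
      · exact ⟨hb' q (h ▸ s1), h2.2 q (h ▸ s1)⟩
    have k : d.tgt = x ∨ d.tgt = w ∨ d.tgt = b →
        csum (chi x A w B) (q ++ [d]) = 0 ∧ csum (chi x A1 b B1) (q ++ [d]) = 0 := by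
      rintro (h | h | h)
      · exact ⟨h1.1 x _ (h ▸ s2), h2.1 x _ (h ▸ s2)⟩
      · exact ⟨h1.2 _ (h ▸ s2), hw _ (h ▸ s2)⟩
      · exact ⟨hb' _ (h ▸ s2), h2.2 _ (h ▸ s2)⟩
    simp only [csum_append, csum_cons, csum_nil, add_zero] at k ⊢
    generalize csum (chi x A w B) q = K at *
    generalize csum (chi x A1 b B1) q = L at *
    have hloop := hl d
    obtain ⟨b1, b2⟩ := hb
    have b3 := b1.symm
    have b4 := b2.symm
    have b5 := hvw.symm
    clear hw hb' h1 h2 s1 s2 hp hl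
    have four : ∀ s : G.V, s = x ∨ s = w ∨ s = b ∨ (s ≠ x ∧ s ≠ w ∧ s ≠ b) := by
      intro s
      by_cases c1 : s = x <;> by_cases c2 : s = w <;> simp [c1, c2, em]
    simp only [chi, g, Set.mem_inter_iff] at *
    rcases four d.src with c | c | c | ⟨c1, c2, c3⟩ <;>
      rcases four d.tgt with e | e | e | ⟨e1, e2, e3⟩ <;>
      by_cases m1 : d.e ∈ A <;> by_cases m2 : d.e ∈ A1 <;>
      simp only [*, and_true, and_false, true_and, false_and, if_true, if_false, true_or, or_true,
        ne_eq, not_true_eq_false, or_self, false_implies, true_implies] at f k hloop ⊢ <;>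
      first | omega | grind

/-- A separation at a vertex of the separator lies in one local component. -/
theorem sep_in_comp (hG : Good r G) (h : LS r v w) {i : Bool} {b : G.V} (hb : Off v w b)
    {A B : Set G.E} (hY : Bal r (G.side v w i) A b B)
    (hw : ∀ D, SW r (G.side v w i) D (G.side v w !i) → csum (chi (G.side v w i) A b B) D = 0)
    {k0 : G.LocalComp r v w}
    (hk : ∀ k, k ≠ k0 → ∀ D, SW r (G.side v w i) D b →
      csum (chi v (Kset r v w k) w (Kset r v w k)) D = 0)
    {d : G.Dart} (hs : d.src = G.side v w i) (ho : Off v w d.tgt) (hA : d.e ∈ A) :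
    d.e ∈ Kset r v w k0 := by
  obtain ⟨hvw, hn, -⟩ := id h
  obtain ⟨k, hk1⟩ := exists_unique_comp hG hn hs ho
  have hk1 := (hk1 k).2 rfl
  by_cases hkk : k = k0
  · exact hkk ▸ hk1
  exfalso
  have hob : Off (G.side v w i) (G.side v w !i) b := ⟨off_side hb _, off_side hb _⟩
  -- For `k` other than `k0`, the intersection of `A` with the edges into `k` has vanishing cut
  -- cochain. If it were nonempty, it would be proper and `v` or `w` would be a local cutvertex.
  have hv := inter_van (side_ne hvw i) hob hG.noloop (bal_K_side hG hvw hn k i) hY hw (by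
    rw [chi_side_eq]; exact hk k hkk)
  obtain ⟨d', h1, h2⟩ := (h.proper_K_side hG k i).2
  exact hG.link _ (Kset r v w k ∩ A) ⟨⟨d, hs, hk1, hA⟩, d', h1, fun h => h2 h.1⟩ hv

theorem Bal.pot01' {a b s t : G.V} {A B : Set G.E} (hab : a ≠ b) (h : Bal r a A b B)
    (hs : s = a ∨ s = b) {p : List G.Dart} (hp : SW r s p t) (ha : t ≠ a) (hb : t ≠ b) :
    csum (chi a A b B) p = 0 ∨ csum (chi a A b B) p = 1 := by
  rcases hs with rfl | rfl
  · exact h.pot01 hab hp ha hb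
  · rw [chi_comm]; exact h.swap.pot01 hab.symm hp hb ha

/-- If the pairs share a vertex, the other vertex of the cut pair has potential 0 or 1 relative to
it, and complementing turns 1 into 0. If they are disjoint, a nonzero sum between `v` and `w` would
mean crossing, by symmetry. -/
theorem exists_sep_zero (hG : Good r G) (h : LS r v w) {a b : G.V} (hY : LS r a b)
    (hne : s(a, b) ≠ s(v, w)) (hnc : ¬ SCross r v w a b) :
    ∃ A B, Sep r a A b B ∧ ∀ D, SW r v D w → csum (chi a A b B) D = 0 := by
  classical
  obtain ⟨hvw, ⟨D0, hD0⟩, -⟩ := id h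
  obtain ⟨hab, -, A, B, hS⟩ := id hY
  have hS : Sep r a A b B := hS
  have key : ∀ {A B : Set G.E}, Sep r a A b B → csum (chi a A b B) D0 = 0 →
      ∃ A B, Sep r a A b B ∧ ∀ D, SW r v D w → csum (chi a A b B) D = 0 := fun hS h0 =>
    ⟨_, _, hS, fun D hD => by rw [hS.1.1.eq (chi_anti _ _ _ _) hD hD0, h0]⟩
  by_cases hv : v = a ∨ v = b
  · have hw : w ≠ a ∧ w ≠ b := by
      constructor
      · rintro rfl
        rcases hv with rfl | rfl
        · exact hvw rfl
        · exact hne Sym2.eq_swap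
      · rintro rfl
        rcases hv with rfl | rfl
        · exact hne rfl
        · exact hvw rfl
    rcases hS.1.pot01' hab hv hD0 hw.1 hw.2 with h0 | h0
    · exact key hS h0
    · refine key (hS.compl hab) ?_
      rw [csum_chi_compl hD0.1, h0]
      rcases hv with rfl | rfl
      · simp [hw.1, hw.2, hab]
      · simp [hw.1, hw.2, hab.symm]
  · by_cases hw : w = a ∨ w = b
    · push Not at hv
      have := hS.1.pot01' hab hw hD0.symm hv.1 hv.2
      rw [csum_rev (chi_anti _ _ _ _)] at this
      rcases this with h0 | h0
      · exact key hS (by omega)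
      · refine key (hS.compl hab) ?_
        rw [csum_chi_compl hD0.1]
        have h1 : csum (chi a A b B) D0 = -1 := by omega
        rw [h1]
        rcases hw with rfl | rfl
        · simp [hv.1, hv.2, hab]
        · simp [hv.1, hv.2, hab.symm]
    · push Not at hv hw
      by_cases h0 : csum (chi a A b B) D0 = 0
      · exact key hS h0
      · exact absurd (h.scross_symm hG ⟨hv.1, hv.2, hw.1, hw.2, A, B, hS.1, D0, hD0, h0⟩) hnc

/-! ### Separations of the cut graph -/

theorem csum_side_zero {c : G.Dart → ℤ} (hc : Anti c) (h0 : ∀ D, SW r v D w → csum c D = 0)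
    {i : Bool} {D : List G.Dart} (hD : SW r (G.side v w i) D (G.side v w !i)) : csum c D = 0 := by
  cases i
  · exact h0 D hD
  · have := h0 _ hD.symm
    rw [csum_rev hc] at this; omega

/-- One of two near vertices over a pair other than the separator is not a slice. -/
theorem old_of_slice (hG : Good r G) (h : LS r v w) {k : G.LocalComp r v w} {i : Bool}
    {y : (G.cut r v w).V} (hxy : Near r (cSlice k i) y)
    (hne : s(G.side v w i, proj y) ≠ s(v, w)) (hp : G.side v w i ≠ proj y) :
    ∃ b hb, y = cOld r b hb := by
  rcases (main_of_near hG h hxy (main_cSlice k i)).cases with hy | ⟨k', j, rfl⟩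
  · exact hy
  · exfalso
    rw [proj_cSlice] at hne hp
    cases i <;> cases j
    · exact hp rfl
    · exact hne rfl
    · exact hne Sym2.eq_swap
    · exact hp rfl

/-- At a slice, the other vertex of the pair decides the component, and by `sep_in_comp` all edges
of `A` at the separator vertex lead into it. So passing to `upSet x A` loses no edge of `A` at this
vertex. -/
theorem up_cond (hG : Good r G) (h : LS r v w) {x y : (G.cut r v w).V} (hx : Main x)
    (hxy : Near r x y) (hne : s(proj x, proj y) ≠ s(v, w)) (hp : proj x ≠ proj y) {A B : Set G.E}
    (hB : Bal r (proj x) A (proj y) B)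
    (h0 : ∀ D, SW r v D w → csum (chi (proj x) A (proj y) B) D = 0)
    (d' : (G.cut r v w).Dart) (d : G.Dart) (hd : DR d' d) (hs : d.src = proj x) (hA : d.e ∈ A) :
    d'.src = x := by
  classical
  rcases hx.cases with ⟨u, hu, rfl⟩ | ⟨k, i, rfl⟩
  · have hs' : d.src = u := hs
    rw [hd.src_off (hs'.symm ▸ hu)]
    exact cOld_congr hs
  · obtain ⟨b, hb, rfl⟩ := old_of_slice hG h hxy hne hp
    have ho : Off v w d.tgt := by
      rcases hd.off with ho | ho
      · exact absurd hs (off_side ho i)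
      · exact ho
    have hK := sep_in_comp hG h hb (i := i) hB (fun D hD => csum_side_zero (chi_anti _ _ _ _) h0 hD)
      (k0 := k) (fun k' hk' D hD => by
        rw [near_slice_old hG h hxy k' hD, if_neg (Ne.symm hk')]) hs ho hA
    obtain ⟨k', h1, h2⟩ := hd.src_side h.1 hs
    rw [h1, Kset_disjoint hG h.2.1 h2 hK]

theorem upSet_mem {x : (G.cut r v w).V} {A : Set G.E} {d' : (G.cut r v w).Dart} {d : G.Dart}
    (hd : DR d' d) (h : d'.e ∈ upSet x A) : d.e ∈ A := by
  obtain ⟨d2', d2, h1, -, h3, h4⟩ := h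
  have := h1.edge
  rw [h4, hd.edge] at this
  rwa [Option.some.inj this]

theorem inside_up (hG : Good r G) (h : LS r v w) {x y : (G.cut r v w).V} (hx : Main x)
    (hxy : Near r x y) (hne : s(proj x, proj y) ≠ s(v, w)) (hp : proj x ≠ proj y) {A B : Set G.E}
    (hB : Bal r (proj x) A (proj y) B)
    (h0 : ∀ D, SW r v D w → csum (chi (proj x) A (proj y) B) D = 0)
    {d : G.Dart} (h1 : d.src = proj x) (h2 : d.tgt ≠ proj y) (h3 : d.e ∈ A) :
    ∃ d' : (G.cut r v w).Dart, d'.src = x ∧ d'.tgt ≠ y ∧ d'.e ∈ upSet x A := by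
  have hoff : Off v w d.src ∨ Off v w d.tgt := by
    rcases hx.cases with ⟨u, hu, rfl⟩ | ⟨k, i, rfl⟩
    · exact .inl (by rw [h1]; exact hu)
    · right
      by_contra hcon
      obtain ⟨j, hj⟩ := not_off hcon
      obtain ⟨b, hb, rfl⟩ := old_of_slice hG h hxy hne hp
      have hij : j = !i := by
        have : j ≠ i := fun e => hG.noloop d (by rw [h1, hj, e]; rfl)
        cases i <;> cases j <;> simp_all
      rw [hij] at hj
      have hsw := hG.edgeClose d
      rw [hj, h1] at hsw
      have := csum_side_zero (i := i) (chi_anti _ _ _ _) h0 hsw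
      have e1 : d.src ≠ b := by rw [h1]; exact (off_side hb i).symm
      have e2 : d.tgt ≠ b := h2
      have e3 : d.src = G.side v w i := h1
      have e4 : G.side v w (!i) ≠ G.side v w i := (side_ne h.1 i).symm
      rw [csum_cons, csum_nil, chi, proj_cOld, g_of_ne e1 e2] at this
      simp [g, h1, h3, hj, e4] at this
  obtain ⟨d', hd⟩ := exists_DR hG h.2.1 hoff
  have hs := up_cond hG h hx hxy hne hp hB h0 d' d hd h1 h3
  exact ⟨d', hs, fun e => h2 (by rw [← hd.tgt, e]), d', d, hd, hs, h3, rfl⟩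

theorem outside_up (hG : Good r G) (h : LS r v w) {x y : (G.cut r v w).V} (hx : Main x)
    (hxy : Near r x y) (hne : s(proj x, proj y) ≠ s(v, w)) (hp : proj x ≠ proj y) {A : Set G.E}
    {d : G.Dart} (h1 : d.src = proj x) (h2 : d.tgt ≠ proj y) (h3 : d.e ∉ A) :
    ∃ d' : (G.cut r v w).Dart, d'.src = x ∧ d'.tgt ≠ y ∧ d'.e ∉ upSet x A := by
  rcases hx.cases with ⟨u, hu, rfl⟩ | ⟨k, i, rfl⟩
  · have ho : Off v w d.src := by rw [h1]; exact hu
    obtain ⟨d', hd⟩ := exists_DR hG h.2.1 (.inl ho)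
    exact ⟨d', (hd.src_off ho).trans (cOld_congr h1), fun e => h2 (by rw [← hd.tgt, e]),
      fun e => h3 (upSet_mem hd e)⟩
  · obtain ⟨b, hb, rfl⟩ := old_of_slice hG h hxy hne hp
    -- The torso edge itself lies on the outer side, and its other end is a slice whereas `y` is
    -- not.
    exact ⟨torDart k i, rfl, (fun e => by cases e), tor_notMem_upSet _ _ k i⟩

/-- Separations not crossing the cut separator lift to the cut graph. -/
theorem lift_sep (hG : Good r G) (h : LS r v w) {x y : (G.cut r v w).V} (hx : Main x)
    (hxy : Near r x y) (hY : LS r (proj x) (proj y)) (hne : s(proj x, proj y) ≠ s(v, w))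
    (hnc : ¬ SCross r v w (proj x) (proj y)) :
    ∃ A B A' B', Sep r (proj x) A (proj y) B ∧ Sep r x A' y B' ∧
      ∀ s p' t, SW r s p' t → Main s → ∃ p, SW r (proj s) p (proj t) ∧
        csum (chi (proj x) A (proj y) B) p = csum (chi x A' y B') p' := by
  obtain ⟨A, B, hS, h0⟩ := exists_sep_zero hG h hY hne hnc
  obtain ⟨T, hT⟩ := exists_torsoWalks hG h
  have hy := main_of_near hG h hxy hx
  have hne' : s(proj y, proj x) ≠ s(v, w) := by rwa [Sym2.eq_swap]
  have h0' : ∀ D, SW r v D w → csum (chi (proj y) B (proj x) A) D = 0 := by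
    intro D hD; rw [chi_comm]; exact h0 D hD
  have cx := up_cond hG h hx hxy hne hY.1 hS.1 h0
  have cy := up_cond hG h hy hxy.symm hne' hY.1.symm hS.1.swap h0'
  have hc : Compat (chi x (upSet x A) y (upSet y B)) (chi (proj x) A (proj y) B) := by
    intro d' d hd
    rw [chi, chi, compat_upSet cx d' d hd, compat_upSet cy d' d hd]
  have ht : ∀ k, chi x (upSet x A) y (upSet y B) (torDart k false) =
      csum (chi (proj x) A (proj y) B) (T k) := by
    intro k
    rw [h0 _ (hT k).1, chi, g_of_notMem (tor_notMem_upSet _ _ _ _),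
      g_of_notMem (tor_notMem_upSet _ _ _ _), add_zero]
  have ha : ∀ d' : (G.cut r v w).Dart, ¬ Main d'.src → chi x (upSet x A) y (upSet y B) d' = 0 := by
    intro d' hm
    have h1 : ∀ z, Main z → d'.src ≠ z ∧ d'.tgt ≠ z := by
      intro z hz
      refine ⟨fun e => hm (e ▸ hz), ?_⟩
      rcases cut_dart_cases d' with ⟨d, hd⟩ | ⟨k, i, rfl⟩ | ⟨e, he, i, rfl | rfl⟩
      · exact absurd hd.main hm
      · exact absurd (main_cSlice k i) hm
      · exact fun e1 => hz e he (!i) e1.symm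
      · exact fun e1 => hz e he (!i) e1.symm
    rw [chi, g_of_ne (h1 x hx).1 (h1 x hx).2, g_of_ne (h1 y hy).1 (h1 y hy).2, add_zero]
  have hpush : ∀ s p' t, SW r s p' t → Main s → ∃ p, SW r (proj s) p (proj t) ∧
        csum (chi (proj x) A (proj y) B) p = csum (chi x (upSet x A) y (upSet y B)) p' := by
    intro s p' t hp hs
    obtain ⟨-, p, h1, h2⟩ := push_sw hT hp hs
    exact ⟨p, h1, h2 _ _ (chi_anti _ _ _ _) (chi_anti _ _ _ _) hc ht⟩
  refine ⟨A, B, upSet x A, upSet y B, hS, ⟨⟨?_, ?_⟩, ?_, ?_⟩, hpush⟩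
  · exact van_cut hT (chi_anti _ _ _ _) (chi_anti _ _ _ _) hc ht ha hS.1.1
  · intro D hD
    obtain ⟨p, h1, h2⟩ := hpush _ _ _ hD hx
    rw [← h2]; exact hS.1.2 p h1
  · obtain ⟨hbal, ⟨d, ⟨h1, h2, h3⟩ | ⟨h1, h2, h3⟩⟩, -⟩ := hS
    · obtain ⟨d', e⟩ := inside_up hG h hx hxy hne hY.1 hbal h0 h1 h2 h3
      exact ⟨d', .inl e⟩
    · obtain ⟨d', e⟩ := inside_up hG h hy hxy.symm hne' hY.1.symm hbal.swap h0' h1 h2 h3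
      exact ⟨d', .inr e⟩
  · obtain ⟨-, -, d, ⟨h1, h2, h3⟩ | ⟨h1, h2, h3⟩⟩ := hS
    · obtain ⟨d', e⟩ := outside_up hG h hx hxy hne hY.1 h1 h2 h3
      exact ⟨d', .inl e⟩
    · obtain ⟨d', e⟩ := outside_up hG h hy hxy.symm hne' hY.1.symm h1 h2 h3
      exact ⟨d', .inr e⟩

end LenGraph

namespace LenGraph
variable {G : LenGraph.{u}} {r : ℕ∞} {v w : G.V}

/-! ### Separators of the cut graph come from separators of the original graph -/

/-- An artificial component has only two vertices and no edge other than those joining them, so it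
offers no edge leaving the pair. -/
theorem LS_main {x y : (G.cut r v w).V} (hL : LS r x y) :
    Main x := by
  intro e he i hx
  obtain ⟨hne, hn, A', B', -, ⟨d, hd⟩, -⟩ := hL
  have hy : ∃ j, y = cArt r e he j := by
    obtain ⟨p, hp⟩ := hn
    have key : ∀ {p : List (G.cut r v w).Dart} {x y : (G.cut r v w).V}, Wk x p y →
        (∃ j, x = cArt r e he j) → ∃ j, y = cArt r e he j := by
      intro p
      induction p with
      | nil => rintro x y rfl h; exact h
      | cons d p ih =>
        rintro x y ⟨rfl, h1⟩ ⟨j, hj⟩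
        refine ih h1 ?_
        rcases art_dart hj with rfl | rfl
        · exact ⟨_, rfl⟩
        · exact ⟨_, rfl⟩
    exact key hp.1 ⟨i, hx⟩
  obtain ⟨j, rfl⟩ := hy
  subst hx
  have hij : j = !i := by
    have : j ≠ i := fun e => hne (e ▸ rfl)
    cases i <;> cases j <;> simp_all
  subst hij
  rcases hd with ⟨h1, h2, -⟩ | ⟨h1, h2, -⟩
  · rcases art_dart h1 with rfl | rfl <;> exact h2 rfl
  · rcases art_dart h1 with rfl | rfl <;> exact h2 (by show cArt r e he (!!i) = _; rw [Bool.not_not])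

/-- A separation at the two slices for `k` would descend to one at `{v, w}` with edges into `k` on
both sides, but a separation does not split a local component. -/
theorem not_LS_torso (hG : Good r G) (h : LS r v w) (k : G.LocalComp r v w) :
    ¬ LS r (cSlice k false) (cSlice k true) := by
  rintro ⟨-, hn', A', B', hB', ⟨d', hin⟩, d'', hout⟩
  obtain ⟨hvw, hn, -⟩ := id h
  have hec := (hG.cut h).edgeClose
  set A := downSet (cSlice k false) A'
  set B := downSet (cSlice k true) B'
  have conv : ∀ {P Q : Prop} {d : (G.cut r v w).Dart},
      (d.src = cSlice k false ∧ d.tgt ≠ cSlice k true ∧ P ∨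
        d.src = cSlice k true ∧ d.tgt ≠ cSlice k false ∧ Q) →
      ∃ i f, DR d f ∧ d.src = cSlice k i ∧ f.src = G.side v w i ∧ Off v w f.tgt ∧
        f.e ∈ Kset r v w k ∧ cond i Q P := by
    intro P Q d hd
    have : ∃ i, d.src = cSlice k i ∧ d.tgt ≠ cSlice k !i ∧ cond i Q P := by
      rcases hd with hd | hd
      exacts [⟨false, hd⟩, ⟨true, hd⟩]
    obtain ⟨i, h1, h2, h3⟩ := this
    rcases main_dart_cases (d' := d) (h1 ▸ main_cSlice k i) with ⟨f, hf⟩ | ⟨k', j, rfl⟩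
    · have e1 : f.src = G.side v w i := by rw [← hf.src, h1]; rfl
      obtain ⟨k', e2, e3⟩ := hf.src_side hvw e1
      obtain ⟨rfl, -⟩ := cSlice_inj (h1.symm.trans e2)
      refine ⟨i, f, hf, h1, e1, ?_, e3, h3⟩
      rcases hf.off with ho | ho
      · exact absurd e1 (off_side ho i)
      · exact ho
    · obtain ⟨rfl, rfl⟩ := cSlice_inj h1
      exact absurd rfl h2
  obtain ⟨i, f, hf, e1, e2, e3, e4, e5⟩ := conv hin
  obtain ⟨j, f', hf', e1', e2', e3', e4', e5'⟩ := conv hout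
  have hmem : f.e ∈ cond i B A := by
    cases i
    · exact (downSet_iff hG hvw hn hf e1).2 e5
    · exact (downSet_iff hG hvw hn hf e1).2 e5
  have hnot : f'.e ∉ cond j B A := by
    cases j
    · exact fun hh => e5' ((downSet_iff hG hvw hn hf' e1').1 hh)
    · exact fun hh => e5' ((downSet_iff hG hvw hn hf' e1').1 hh)
  have hc : Compat (chi (cSlice k false) A' (cSlice k true) B') (chi v A w B) := by
    intro d' d hd
    rw [chi, chi, compat_downSet hG hvw hn _ _ d' d hd, compat_downSet hG hvw hn _ _ d' d hd]
    rfl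
  have ht : ∀ k', chi (cSlice k false) A' (cSlice k true) B' (torDart k' false) = 0 := by
    intro k'
    by_cases hk : k' = k
    · subst hk
      have := hB'.2 [torDart k' false] (hec (torDart k' false))
      rwa [csum_cons, csum_nil, add_zero] at this
    · have n1 : ∀ i j, (cSlice k' i : (G.cut r v w).V) ≠ cSlice k j := fun i j e => hk (cSlice_inj e).1
      rw [chi, g_of_ne (n1 _ _) (n1 _ _), g_of_ne (n1 _ _) (n1 _ _), add_zero]
  have hvan := van_of_cut hG hvw hn (chi_anti _ _ _ _) (chi_anti _ _ _ _) hc ht (fun d h1 h2 => by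
    rw [chi, g_of_notMem (sep_notMem_downSet h1 h2), g_of_notMem (sep_notMem_downSet h1 h2),
      add_zero]) hB'.1
  have hpv : Proper v A := by
    cases i
    · obtain ⟨d, h1, h2⟩ := (h.proper_K hG k).1.2
      exact ⟨⟨f, e2, hmem⟩, d, h1, fun hh => h2 (downSet_K (i := false) hG hvw h1 hh)⟩
    · refine (Bal.proper_iff hG hvan).2 ?_
      obtain ⟨d, h1, h2⟩ := (h.proper_K hG k).2.2
      exact ⟨⟨f, e2, hmem⟩, d, h1, fun hh => h2 (downSet_K (i := true) hG hvw h1 hh)⟩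
  have hbal := Bal.of_van hG hvw hvan hpv
  exact hnot ((hbal.const_on_K hG hvw hn e2 e3 e2' e3' e4 e4').1 hmem)

theorem near_unique₂ (hG : Good r G) (h : LS r v w) {x y z : (G.cut r v w).V}
    (ho : Off v w (proj x) ∨ Off v w (proj y)) (hx : Main x) (h1 : Near r x y) (h2 : Near r x z)
    (hp : proj y = proj z) : y = z := by
  have hy := main_of_near hG h h1 hx
  have hz := main_of_near hG h h2 hx
  rcases hx.cases with ⟨t, ht, rfl⟩ | ⟨k, i, rfl⟩
  · exact near_unique' hG h hy hz h1.symm h2.symm hp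
  · have ho : Off v w (proj y) := by
      rcases ho with ho | ho
      · exact absurd rfl (off_side ho i)
      · exact ho
    rcases hy.cases with ⟨t, ht, rfl⟩ | ⟨k', j, rfl⟩ <;> rcases hz.cases with ⟨s, hs, rfl⟩ | ⟨k'', j', rfl⟩
    · exact cOld_congr hp
    · exact absurd hp (off_side ht _)
    · exact absurd rfl (off_side ho j)
    · exact absurd rfl (off_side ho j)

/-- Two slices are excluded by the hypothesis, so at most one of the vertices carries a torso edge;
complementing moves it to the outer side. -/
theorem exists_sep_tor {x y : (G.cut r v w).V} (hL : LS r x y)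
    (ho : Off v w (proj x) ∨ Off v w (proj y)) :
    ∃ A' B', Sep r x A' y B' ∧ (∀ k i, cSlice k i = x → (torDart k i).e ∉ A') ∧
      ∀ k i, cSlice k i = y → (torDart k i).e ∉ B' := by
  obtain ⟨hxy, -, A', B', hS⟩ := id hL
  have hS : Sep r x A' y B' := hS
  have nold : ∀ {u : G.V} {hu : Off v w u} {A' : Set (G.cut r v w).E} k i,
      cSlice k i = cOld r u hu → (torDart k i).e ∉ A' := by
    intro u hu A' k i h; cases h
  rcases (LS_main hL).cases with ⟨u, hu, rfl⟩ | ⟨k, i, rfl⟩ <;>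
    rcases (LS_main hL.symm).cases with ⟨t, ht, rfl⟩ | ⟨k', j, rfl⟩
  · exact ⟨A', B', hS, nold, nold⟩
  · by_cases hk : (CutE.torso k' : (G.cut r v w).E) ∈ B'
    · exact ⟨_, _, hS.compl hxy, nold, tor_of_slice fun hh => hh hk⟩
    · exact ⟨A', B', hS, nold, tor_of_slice hk⟩
  · by_cases hk : (CutE.torso k : (G.cut r v w).E) ∈ A'
    · exact ⟨_, _, hS.compl hxy, tor_of_slice fun hh => hh hk, nold⟩
    · exact ⟨A', B', hS, tor_of_slice hk, nold⟩
  · rcases ho with ho | ho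
    · exact absurd rfl (off_side ho i)
    · exact absurd rfl (off_side ho j)

theorem inside_down (hG : Good r G) (h : LS r v w) {x y : (G.cut r v w).V} (hx : Main x)
    (hxy : Near r x y) (ho : Off v w (proj x) ∨ Off v w (proj y)) {A' : Set (G.cut r v w).E}
    (ht : ∀ k i, cSlice k i = x → (torDart k i).e ∉ A') {d' : (G.cut r v w).Dart}
    (h1 : d'.src = x) (h2 : d'.tgt ≠ y) (h3 : d'.e ∈ A') :
    ∃ d : G.Dart, d.src = proj x ∧ d.tgt ≠ proj y ∧ d.e ∈ downSet x A' := by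
  subst h1
  rcases main_dart_cases hx with ⟨d, hd⟩ | ⟨k, i, rfl⟩
  · refine ⟨d, hd.src.symm, ?_, (downSet_iff hG h.1 h.2.1 hd rfl).2 h3⟩
    intro e
    exact h2 (near_unique₂ hG h ho hx hxy ⟨_, (hG.cut h).edgeClose d'⟩ (by rw [hd.tgt, e])).symm
  · exact absurd h3 (ht k i rfl)

theorem outside_down (hG : Good r G) (h : LS r v w) {x y : (G.cut r v w).V} (hx : Main x)
    (hxy : Near r x y) (ho : Off v w (proj x) ∨ Off v w (proj y)) {A' : Set (G.cut r v w).E}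
    {d' : (G.cut r v w).Dart} (h1 : d'.src = x) (h2 : d'.tgt ≠ y) (h3 : d'.e ∉ A') :
    ∃ d : G.Dart, d.src = proj x ∧ d.tgt ≠ proj y ∧ d.e ∉ downSet x A' := by
  obtain ⟨hvw, hn, -⟩ := id h
  subst h1
  rcases main_dart_cases hx with ⟨d, hd⟩ | ⟨k, i, rfl⟩
  · refine ⟨d, hd.src.symm, ?_, fun hh => h3 ((downSet_iff hG hvw hn hd rfl).1 hh)⟩
    intro e
    exact h2 (near_unique₂ hG h ho hx hxy ⟨_, (hG.cut h).edgeClose d'⟩ (by rw [hd.tgt, e])).symm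
  · obtain ⟨d, e1, e2⟩ := (h.proper_K_side hG k i).2
    refine ⟨d, e1, ?_, fun hh => e2 (downSet_K hG hvw e1 hh)⟩
    intro e3
    have hoy : Off v w (proj y) := by
      rcases ho with ho | ho
      · exact absurd rfl (off_side ho i)
      · exact ho
    rcases (main_of_near hG h hxy hx).cases with ⟨t, ht, rfl⟩ | ⟨k', j, rfl⟩
    · have e3 : d.tgt = t := e3
      subst e3
      obtain ⟨d2, hd2⟩ := exists_DR hG hn (d := d) (.inr ht)
      obtain ⟨k', f1, f2⟩ := hd2.src_side hvw e1
      have f3 : d2.tgt = cOld r d.tgt ht := hd2.symm.src_off ht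
      have f4 := (hG.cut h).edgeClose d2
      rw [f3, f1] at f4
      have := near_unique' hG h hx (main_cSlice k' i) hxy ⟨_, f4⟩ rfl
      obtain ⟨rfl, -⟩ := cSlice_inj this
      exact e2 f2
    · exact off_side hoy j rfl

theorem exists_sigma (hG : Good r G) (hvw : v ≠ w) (hn : Near r v w) {A B : Set G.E}
    (hb : Bal r v A w B) : ∃ σ : G.LocalComp r v w → ℤ,
      ∀ (d : G.Dart) i k, d.src = G.side v w i → Off v w d.tgt → d.e ∈ Kset r v w k →
        chi v A w B d = σ k := by
  classical
  choose d i h1 h2 h3 using fun k => exists_dart_comp (r := r) hG hn k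
  refine ⟨fun k => chi v A w B (d k), fun d' j k e1 e2 e3 => ?_⟩
  have := hb.const_on_K hG hvw hn e1 e2 (h1 k) (h2 k) e3 (h3 k)
  show chi v A w B d' = chi v A w B (d k)
  rw [chi_side hvw e1 e2, chi_side hvw (h1 k) (h2 k)]
  exact if_congr this rfl rfl

/-- The separation descends edge by edge, using `Bal.of_van` for the condition on walks between the
two vertices. The pair differs from `{v, w}` since not both vertices are slices. It does not cross:
by `push_pot`, two near vertices off the separator have equal potential for every separation at `{v,
w}`. -/
theorem down_LS (hG : Good r G) (h : LS r v w) {x y : (G.cut r v w).V} (hL : LS r x y) :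
    LS r (proj x) (proj y) ∧ s(proj x, proj y) ≠ s(v, w) ∧ ¬ SCross r v w (proj x) (proj y) := by
  obtain ⟨hvw, hn, -⟩ := id h
  have hx := LS_main hL
  have hy := LS_main hL.symm
  obtain ⟨hxy, hnear, -⟩ := id hL
  have hG' := hG.cut h
  have hpne : proj x ≠ proj y := fun e => hxy (near_unique hG h hnear hx e)
  have ho : Off v w (proj x) ∨ Off v w (proj y) := by
    rcases hx.cases with ⟨u, hu, rfl⟩ | ⟨k, i, rfl⟩
    · exact .inl hu
    rcases hy.cases with ⟨u, hu, rfl⟩ | ⟨k', j, rfl⟩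
    · exact .inr hu
    exfalso
    obtain rfl := near_slice hG h hnear
    cases i <;> cases j
    · exact hxy rfl
    · exact not_LS_torso hG h k hL
    · exact not_LS_torso hG h k hL.symm
    · exact hxy rfl
  refine ⟨?_, ?_, ?_⟩
  · obtain ⟨A', B', hS, t1, t2⟩ := exists_sep_tor hL ho
    have hp1 := downSet_proper hG h hx (hS.proper hG' hxy hnear) t1
    have hc : Compat (chi x A' y B') (chi (proj x) (downSet x A') (proj y) (downSet y B')) := by
      intro d' d hd
      rw [chi, chi, compat_downSet hG hvw hn _ _ d' d hd, compat_downSet hG hvw hn _ _ d' d hd]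
    have hvan := van_of_cut hG hvw hn (chi_anti _ _ _ _) (chi_anti _ _ _ _) hc
      (fun k => by rw [chi, g_tor t1, g_tor t2, add_zero]) (fun d h1 h2 => by
        rw [chi, g_of_notMem (sep_notMem_downSet h1 h2), g_of_notMem (sep_notMem_downSet h1 h2),
          add_zero]) hS.1.1
    refine ⟨hpne, near_proj hG h hnear hx, _, _, Bal.of_van hG hpne hvan hp1, ?_, ?_⟩
    · obtain ⟨-, ⟨d, ⟨h1, h2, h3⟩ | ⟨h1, h2, h3⟩⟩, -⟩ := hS
      · obtain ⟨d', e⟩ := inside_down hG h hx hnear ho t1 h1 h2 h3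
        exact ⟨d', .inl e⟩
      · obtain ⟨d', e⟩ := inside_down hG h hy hnear.symm ho.symm t2 h1 h2 h3
        exact ⟨d', .inr e⟩
    · obtain ⟨-, -, d, ⟨h1, h2, h3⟩ | ⟨h1, h2, h3⟩⟩ := hS
      · obtain ⟨d', e⟩ := outside_down hG h hx hnear ho h1 h2 h3
        exact ⟨d', .inl e⟩
      · obtain ⟨d', e⟩ := outside_down hG h hy hnear.symm ho.symm h1 h2 h3
        exact ⟨d', .inr e⟩
  · intro e
    rcases Sym2.eq_iff.1 e with ⟨e1, e2⟩ | ⟨e1, e2⟩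
    · rcases ho with ho | ho
      exacts [ho.1 e1, ho.2 e2]
    · rcases ho with ho | ho
      exacts [ho.2 e1, ho.1 e2]
  · rintro ⟨h1, h2, h3, h4, A, B, hb, D, hD, hne⟩
    obtain ⟨σ, hσ⟩ := exists_sigma hG hvw hn hb
    obtain ⟨p', hp'⟩ := hnear
    obtain ⟨p, e1, e2⟩ := push_pot (exists_torsoWalks hG h) hb hσ hp' hx
    apply hne
    rw [hb.1.eq (chi_anti _ _ _ _) hD e1, e2]
    have z : ∀ {x : (G.cut r v w).V}, Main x → Off v w (proj x) → slPot σ x = 0 := by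
      intro x hx hox
      rcases hx.cases with ⟨u, hu, rfl⟩ | ⟨k, i, rfl⟩
      · rfl
      · exact absurd rfl (off_side hox i)
    rw [z hx ⟨h1, h2⟩, z hy ⟨h3, h4⟩, sub_self]

/-! ### Lifts -/

theorem LS.hasCycleThrough (hG : Good r G) {a b : G.V} (h : LS r a b) :
    G.HasCycleThrough r {a, b} := by
  obtain ⟨A, B, hb, hp, -⟩ := h.exists_proper hG
  obtain ⟨x, C, hC, hne⟩ := exists_cyc (g_anti _ _) (hG.link a A hp)
  have hne2 : csum (g b B) C ≠ 0 := by
    have := hb.1 _ _ hC.1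
    rw [csum_chi] at this; omega
  refine hC.hasCycleThrough ?_
  rintro s (rfl | rfl)
  · exact exists_src_of_csum_g_ne hC.1.1 hne
  · exact exists_src_of_csum_g_ne hC.1.1 hne2

theorem near_of_hasCycleThrough {a b : G.V} (h : G.HasCycleThrough r {a, b}) : Near r a b := by
  obtain ⟨n, c, e, h1, h2, h3⟩ := h
  obtain ⟨p, hp, -, hs⟩ := h1.exists_walk h2
  have hm : ∀ z ∈ ({a, b} : Set G.V), ∃ d ∈ p, d.src = z := by
    intro z hz
    obtain ⟨j, rfl⟩ := h3 hz
    have : c j ∈ p.map Dart.src := by rw [hs]; exact List.mem_ofFn.2 ⟨j, rfl⟩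
    simpa using this
  exact near_of_closed hp (hm a (by simp)) (hm b (by simp))

/-- Take a short cycle on which the cut at `a` is nonzero, for a separation with sum zero between
`v` and `w`. On each of its arcs between `v` and `w` the cuts at `a` and `b` cancel, so an arc with
nonzero cut at `a` meets `b` too. Such an arc is not a single edge, hence it lifts to a short closed
walk containing lifts of both vertices. -/
theorem exists_near_lift (hG : Good r G) (h : LS r v w) {a b : G.V} (hY : LS r a b)
    (hne : s(a, b) ≠ s(v, w)) (hnc : ¬ SCross r v w a b) :
    ∃ x y : (G.cut r v w).V, Main x ∧ proj x = a ∧ proj y = b ∧ Near r x y := by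
  obtain ⟨hvw, hn, -⟩ := id h
  obtain ⟨A, B, hS, h0⟩ := exists_sep_zero hG h hY hne hnc
  obtain ⟨x0, C, hC, hC1⟩ := exists_cyc (g_anti _ _) (hG.link a A (hS.proper hG hY.1 hY.2.1))
  have hC2 : csum (g b B) C ≠ 0 := by
    have := hS.1.1 _ _ hC.1
    rw [csum_chi] at this; omega
  have fin : ∀ {z : (G.cut r v w).V} {p' q' : List (G.cut r v w).Dart} {p : List G.Dart},
      SW r z (p' ++ q') z → List.Forall₂ DR p' p → csum (g a A) p ≠ 0 → csum (g b B) p ≠ 0 →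
      ∃ x y : (G.cut r v w).V, Main x ∧ proj x = a ∧ proj y = b ∧ Near r x y := by
    intro z p' q' p hz hf e1 e2
    have key : ∀ {c : G.V} {E : Set G.E}, csum (g c E) p ≠ 0 →
        ∃ x : (G.cut r v w).V, Main x ∧ proj x = c ∧ ∃ d ∈ p' ++ q', d.src = x := by
      intro c E hc
      obtain ⟨d, hd, hdc⟩ := exists_mem_of_csum_g_ne hc
      have hmem : ∃ d' ∈ p', DR d' d := by
        clear hz e1 e2 hc
        induction hf with
        | nil => simp at hd
        | cons a1 _ ih =>
          rcases List.mem_cons.1 hd with rfl | hd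
          · exact ⟨_, List.mem_cons_self, a1⟩
          · obtain ⟨d', k1, k2⟩ := ih hd
            exact ⟨d', List.mem_cons_of_mem _ k1, k2⟩
      obtain ⟨d', hd', hDR⟩ := hmem
      rcases hdc with hdc | hdc
      · exact ⟨d'.src, hDR.main, hDR.src.trans hdc, d', by simp [hd'], rfl⟩
      · exact ⟨d'.tgt, hDR.symm.main, hDR.tgt.trans hdc,
          hz.1.exists_src (d := d') (by simp [hd']) (.inr rfl)⟩
    obtain ⟨x, m1, m2, m3⟩ := key e1
    obtain ⟨y, -, n2, n3⟩ := key e2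
    exact ⟨x, y, m1, m2, n2, near_of_closed hz m3 n3⟩
  have piece : ∀ {i P}, Piece r v w i P → csum (g a A) P ≠ 0 →
      ∃ x y : (G.cut r v w).V, Main x ∧ proj x = a ∧ proj y = b ∧ Near r x y := by
    rintro i P ⟨hs, hP⟩ hPa
    have hPb : csum (g b B) P ≠ 0 := by
      have := csum_side_zero (chi_anti _ _ _ _) h0 hs
      rw [csum_chi] at this; omega
    rcases hP with ⟨d, rfl⟩ | ⟨k, P', f1, f2, f3⟩
    · exfalso
      have e1 : d.src = G.side v w i := hs.1.1
      have e2 : d.tgt = G.side v w !i := hs.1.2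
      have key : ∀ {c : G.V} {E : Set G.E}, csum (g c E) [d] ≠ 0 → ∃ j, c = G.side v w j := by
        intro c E hc
        obtain ⟨d2, hd2, hdc⟩ := exists_mem_of_csum_g_ne hc
        rw [List.mem_singleton] at hd2
        subst hd2
        rcases hdc with hdc | hdc
        exacts [⟨_, hdc.symm.trans e1⟩, ⟨_, hdc.symm.trans e2⟩]
      obtain ⟨j, rfl⟩ := key hPa
      obtain ⟨j', rfl⟩ := key hPb
      cases j <;> cases j'
      · exact hY.1 rfl
      · exact hne rfl
      · exact hne Sym2.eq_swap
      · exact hY.1 rfl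
    · have hw : Wk (cSlice k i) (P' ++ [torDart k !i]) (cSlice k i) :=
        f2.append ⟨rfl, by show cSlice k (!!i) = _; rw [Bool.not_not]⟩
      have hl : plen [torDart k !i] = G.torsoLen r v w k := by
        rw [plen_cons, plen_nil, add_zero]; rfl
      exact fin (SW.of_closed hw (by rw [plen_append, plen_of_DR f1, hl]; exact f3)) f1 hPa hPb
  rcases lift_cyc hG hvw hn hC with ⟨C2, x', p', hp, hw, hf⟩ | ⟨i, P1, P2, hp, h1, h2⟩
  · refine fin (q' := []) (p' := p') (z := x') ?_ hf ?_ ?_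
    · rw [List.append_nil]
      refine SW.of_closed hw ?_
      rw [plen_of_DR hf]
      have : plen C2 = plen C := (hp.map _).sum_eq
      rw [this]; exact hC.1.closed_le
    · rwa [csum_perm _ hp]
    · rwa [csum_perm _ hp]
  · rw [← csum_perm _ hp, csum_append] at hC1
    by_cases hz : csum (g a A) P1 = 0
    · exact piece h2 (by omega)
    · exact piece h1 hz

theorem lift_LS (hG : Good r G) (h : LS r v w) {x y : (G.cut r v w).V} (hx : Main x)
    (hxy : Near r x y) (hY : LS r (proj x) (proj y)) (hne : s(proj x, proj y) ≠ s(v, w))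
    (hnc : ¬ SCross r v w (proj x) (proj y)) : LS r x y := by
  obtain ⟨A, B, A', B', -, hS, -⟩ := lift_sep hG h hx hxy hY hne hnc
  exact ⟨fun e => hY.1 (congrArg proj e), hxy, A', B', hS⟩

theorem over_iff {x : (G.cut r v w).V} {a : G.V} : G.Over r v w x a ↔ Main x ∧ proj x = a := by
  rcases cut_cases x with ⟨u, hu, rfl⟩ | ⟨k, i, rfl⟩ | ⟨e, he, i, rfl⟩
  · exact ⟨fun h => ⟨main_cOld _ _, h⟩, fun h => h.2⟩
  · exact ⟨fun h => ⟨main_cSlice _ _, h⟩, fun h => h.2⟩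
  · exact ⟨fun h => h.elim, fun h => absurd rfl (h.1 e he i)⟩

theorem isLift_iff {X : Sym2 G.V} {Y : Sym2 (G.cut r v w).V} :
    G.IsLift r v w X Y ↔ ∃ x y, Main x ∧ Main y ∧ X = s(proj x, proj y) ∧ Y = s(x, y) ∧
      (G.cut r v w).HasCycleThrough r {x, y} := by
  constructor
  · rintro ⟨a, b, x, y, rfl, rfl, h1, h2, h3⟩
    obtain ⟨m1, rfl⟩ := over_iff.1 h1
    obtain ⟨m2, rfl⟩ := over_iff.1 h2
    exact ⟨x, y, m1, m2, rfl, rfl, h3⟩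
  · rintro ⟨x, y, m1, m2, rfl, rfl, h3⟩
    exact ⟨_, _, x, y, rfl, rfl, over_iff.2 ⟨m1, rfl⟩, over_iff.2 ⟨m2, rfl⟩, h3⟩

/-- The separation lifts with unchanged sums along projected walks, and by `SCross.ne_zero` crossing
may be tested on this particular separation. -/
theorem scross_up (hG : Good r G) (h : LS r v w) {x y s t : (G.cut r v w).V} (hL : LS r x y)
    (hT : LS r s t) (hc : SCross r (proj x) (proj y) (proj s) (proj t)) : SCross r x y s t := by
  obtain ⟨l1, l2, l3⟩ := down_LS hG h hL
  obtain ⟨t1, t2, t3⟩ := down_LS hG h hT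
  obtain ⟨A, B, A', B', hS, hS', hpush⟩ := lift_sep hG h (LS_main hL) hL.2.1 l1 l2 l3
  obtain ⟨n1, n2, n3, n4, -⟩ := id hc
  obtain ⟨D', hD'⟩ := hT.2.1
  obtain ⟨D, hD, hs⟩ := hpush _ _ _ hD' (LS_main hT)
  refine ⟨fun e => n1 (e ▸ rfl), fun e => n2 (e ▸ rfl), fun e => n3 (e ▸ rfl), fun e => n4 (e ▸ rfl),
    A', B', hS'.1, D', hD', ?_⟩
  rw [← hs]
  exact hc.ne_zero hG l1.1 t1 hS.1 (hS.proper hG l1.1 l1.2.1) hD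

/-- The four vertices lie on one short cycle by `cross_pots`. They are therefore pairwise near, and
`proj` is injective on them by `near_unique`. -/
theorem scross_down (hG : Good r G) (h : LS r v w) {x y s t : (G.cut r v w).V} (hL : LS r x y)
    (hT : LS r s t) (hc : SCross r x y s t) : SCross r (proj x) (proj y) (proj s) (proj t) := by
  have hG' := hG.cut h
  obtain ⟨l1, l2, l3⟩ := down_LS hG h hL
  obtain ⟨A, B, A', B', hS, hS', hpush⟩ := lift_sep hG h (LS_main hL) hL.2.1 l1 l2 l3
  obtain ⟨n1, n2, n3, n4, -⟩ := id hc
  obtain ⟨At, Bt, hBt, hpt, -⟩ := hT.exists_proper hG'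
  obtain ⟨-, -, -, -, -, -, -, -, -, -, -, -, -, hnear⟩ :=
    cross_pots hG' hL.1 hT.1 hc hS'.1 hBt hpt
  have hm : ∀ z ∈ ({x, y, s, t} : Set (G.cut r v w).V), Main z := by
    rintro z (rfl | rfl | rfl | rfl)
    exacts [LS_main hL, LS_main hL.symm, LS_main hT, LS_main hT.symm]
  have hinj : ∀ z ∈ ({x, y, s, t} : Set (G.cut r v w).V), ∀ z' ∈ ({x, y, s, t} : Set (G.cut r v w).V),
      proj z = proj z' → z = z' := fun z hz z' hz' e =>
    near_unique hG h (hnear z z' hz hz') (hm z hz) e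
  obtain ⟨D', hD'⟩ := hT.2.1
  obtain ⟨D, hD, hs⟩ := hpush _ _ _ hD' (LS_main hT)
  refine ⟨fun e => n1 (hinj s (by simp) x (by simp) e), fun e => n2 (hinj s (by simp) y (by simp) e),
    fun e => n3 (hinj t (by simp) x (by simp) e), fun e => n4 (hinj t (by simp) y (by simp) e),
    A, B, hS.1, D, hD, ?_⟩
  rw [hs]
  exact hc.ne_zero hG' hL.1 hT hS'.1 (hS'.proper hG' hL.1 hL.2.1) hD'

end LenGraph

namespace LenGraph
variable {G : LenGraph.{u}} {r : ℕ∞} {v w : G.V}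

/-! ### Components -/

/-- The vertex set `S` is a union of components. -/
def Clos (S : Set G.V) : Prop := ∀ d : G.Dart, d.src ∈ S → d.tgt ∈ S

theorem clos_supp (c : G.toSimple.ConnectedComponent) : Clos c.supp := by
  intro d hd
  by_cases h : d.src = d.tgt
  · exact h ▸ hd
  · have : G.toSimple.Adj d.src d.tgt := toSimple_adj.2 ⟨h, d, rfl, rfl⟩
    exact (c.mem_supp_congr_adj this).1 hd

section sub
variable {S : Set G.V}

/-- The edges of a set in a union of components. -/
def res (A : Set G.E) : Set (G.sub S Set.univ).E := Subtype.val ⁻¹' A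

theorem mem_res {A : Set G.E} {d : (G.sub S Set.univ).Dart} : d.e ∈ res A ↔ d.up.e ∈ A := Iff.rfl

theorem src_eq_iff {d : (G.sub S Set.univ).Dart} {x : (G.sub S Set.univ).V} :
    d.src = x ↔ d.up.src = x.1 := Subtype.ext_iff

theorem tgt_eq_iff {d : (G.sub S Set.univ).Dart} {x : (G.sub S Set.univ).V} :
    d.tgt = x ↔ d.up.tgt = x.1 := Subtype.ext_iff

theorem res_compl (A : Set G.E) : res (S := S) Aᶜ = (res A)ᶜ := rfl

theorem Wk.up {x y : (G.sub S Set.univ).V} {p : List (G.sub S Set.univ).Dart} (h : Wk x p y) :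
    Wk x.1 (p.map Dart.up) y.1 := by
  induction p generalizing x with
  | nil => exact congrArg Subtype.val h
  | cons d p ih => exact ⟨congrArg Subtype.val h.1, ih h.2⟩

theorem Wk.down (hS : Clos S) {x y : G.V} {p : List G.Dart} (h : Wk x p y) (hx : x ∈ S) :
    ∃ (hy : y ∈ S) (q : List (G.sub S Set.univ).Dart), 
      Wk (⟨x, hx⟩ : (G.sub S Set.univ).V) q ⟨y, hy⟩ ∧ q.map Dart.up = p := by
  induction p generalizing x with
  | nil => cases h; exact ⟨hx, [], rfl, rfl⟩
  | cons d p ih =>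
    obtain ⟨rfl, h⟩ := h
    obtain ⟨hy, q, h1, h2⟩ := ih h (hS d hx)
    exact ⟨hy, d.down hx (hS d hx) trivial :: q, ⟨rfl, h1⟩, by rw [List.map_cons, h2]; rfl⟩

theorem plen_up (p : List (G.sub S Set.univ).Dart) : plen (p.map Dart.up) = plen p := by
  simp only [plen, List.map_map]; rfl

theorem SW.up {x y : (G.sub S Set.univ).V} {p : List (G.sub S Set.univ).Dart} (h : SW r x p y) :
    SW r x.1 (p.map Dart.up) y.1 := by
  obtain ⟨h1, q, h2, h3⟩ := h
  exact ⟨h1.up, _, h2.up, by rwa [plen_up, plen_up]⟩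

theorem SW.down (hS : Clos S) {x y : G.V} {p : List G.Dart} (h : SW r x p y) (hx : x ∈ S) :
    ∃ (hy : y ∈ S) (q : List (G.sub S Set.univ).Dart),
      SW r (⟨x, hx⟩ : (G.sub S Set.univ).V) q ⟨y, hy⟩ ∧ q.map Dart.up = p := by
  obtain ⟨h1, p', h2, h3⟩ := h
  obtain ⟨hy, q, h4, rfl⟩ := h1.down hS hx
  obtain ⟨_, q', h5, rfl⟩ := h2.down hS hy
  exact ⟨hy, q, ⟨h4, q', h5, by rwa [plen_up, plen_up] at h3⟩, rfl⟩

theorem csum_up (c : G.Dart → ℤ) (p : List (G.sub S Set.univ).Dart) :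
    csum (fun d => c d.up) p = csum c (p.map Dart.up) := by
  simp only [csum, List.map_map]; rfl

theorem g_up (x : (G.sub S Set.univ).V) (A : Set G.E) (d : (G.sub S Set.univ).Dart) :
    g x (res A) d = g x.1 A d.up := by
  have h1 : (d.src = x ∧ d.e ∈ res A) = (d.up.src = x.1 ∧ d.up.e ∈ A) := by
    rw [mem_res, src_eq_iff]
  have h2 : (d.tgt = x ∧ d.e ∈ res A) = (d.up.tgt = x.1 ∧ d.up.e ∈ A) := by
    rw [mem_res, tgt_eq_iff]
  unfold g
  congr 1 <;> congr 1

theorem van_sub_iff (hS : Clos S) {c : G.Dart → ℤ} (hc : ∀ d : G.Dart, d.src ∉ S → c d = 0) :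
    (Van r fun d : (G.sub S Set.univ).Dart => c d.up) ↔ Van r c := by
  refine ⟨fun h => van_of_base S (fun x p hx hp => ?_) fun d hd _ => hc d hd, fun h y p hp => ?_⟩
  · obtain ⟨_, q, h1, rfl⟩ := hp.down hS hx
    rw [← csum_up]; exact h _ _ h1
  · rw [csum_up]; exact h _ _ hp.up

theorem Clos.symm (hS : Clos S) {d : G.Dart} (h : d.src ∉ S) : d.tgt ∉ S :=
  fun h' => h (hS d.symm h')

theorem g_outside (hS : Clos S) {x : G.V} (hx : x ∈ S) (A : Set G.E) {d : G.Dart}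
    (h : d.src ∉ S) : g x A d = 0 :=
  g_of_ne (fun e => h (e ▸ hx)) fun e => hS.symm h (e ▸ hx)

theorem exists_preimage (A : Set (G.sub S Set.univ).E) : ∃ B : Set G.E, res B = A :=
  ⟨_, Set.preimage_image_eq A Subtype.val_injective⟩

theorem van_g_sub (hS : Clos S) (x : (G.sub S Set.univ).V) (A : Set G.E) :
    Van r (g x (res A)) ↔ Van r (g x.1 A) := by
  rw [funext (g_up x A)]
  exact van_sub_iff hS fun d hd => g_outside hS x.2 A hd

theorem bal_sub (hS : Clos S) (x y : (G.sub S Set.univ).V) (A B : Set G.E) :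
    Bal r x (res A) y (res B) ↔ Bal r x.1 A y.1 B := by
  have : chi x (res A) y (res B) = fun d => chi x.1 A y.1 B d.up := by
    funext d; simp only [chi, ← g_up]
  unfold Bal
  rw [this]
  refine and_congr (van_sub_iff hS fun d hd => ?_) ⟨fun h D hD => ?_, fun h D hD => ?_⟩
  · simp only [chi, g_outside hS x.2 A hd, g_outside hS y.2 B hd, add_zero]
  · obtain ⟨_, q, h1, rfl⟩ := hD.down hS x.2
    rw [← csum_up]; exact h _ h1
  · rw [csum_up]; exact h _ hD.up

theorem near_sub (hS : Clos S) (x y : (G.sub S Set.univ).V) : Near r x y ↔ Near r x.1 y.1 := by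
  refine ⟨fun ⟨p, hp⟩ => ⟨_, hp.up⟩, fun ⟨p, hp⟩ => ?_⟩
  obtain ⟨_, q, h1, rfl⟩ := hp.down hS x.2
  exact ⟨q, h1⟩

theorem dart_sub (hS : Clos S) {P : G.Dart → Prop} (h : ∀ d : G.Dart, P d → d.src ∈ S) :
    (∃ d : (G.sub S Set.univ).Dart, P d.up) ↔ ∃ d, P d :=
  ⟨fun ⟨_, hd⟩ => ⟨_, hd⟩, fun ⟨d, hd⟩ => ⟨d.down (h d hd) (hS d (h d hd)) trivial, hd⟩⟩

theorem LS_sub (hS : Clos S) (x y : (G.sub S Set.univ).V) : LS r x y ↔ LS r x.1 y.1 := by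
  have key : ∀ A B : Set G.E,
      (∃ d : (G.sub S Set.univ).Dart, (d.src = x ∧ d.tgt ≠ y ∧ d.e ∈ res A) ∨
        (d.src = y ∧ d.tgt ≠ x ∧ d.e ∈ res B)) ↔
      ∃ d : G.Dart, (d.src = x.1 ∧ d.tgt ≠ y.1 ∧ d.e ∈ A) ∨ (d.src = y.1 ∧ d.tgt ≠ x.1 ∧ d.e ∈ B) := by
    intro A B
    rw [← dart_sub hS (P := fun d => (d.src = x.1 ∧ d.tgt ≠ y.1 ∧ d.e ∈ A) ∨
      (d.src = y.1 ∧ d.tgt ≠ x.1 ∧ d.e ∈ B))]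
    · simp only [mem_res, src_eq_iff, tgt_eq_iff, ne_eq]
    · rintro d (⟨h, -⟩ | ⟨h, -⟩) <;> rw [h]
      exacts [x.2, y.2]
  have key' := fun A B => key Aᶜ Bᶜ
  simp only [res_compl, Set.mem_compl_iff] at key'
  unfold LS
  refine and_congr (not_congr Subtype.ext_iff) (and_congr (near_sub hS x y) ⟨?_, ?_⟩)
  · rintro ⟨A', B', h1, h2, h3⟩
    obtain ⟨A, rfl⟩ := exists_preimage A'
    obtain ⟨B, rfl⟩ := exists_preimage B'
    exact ⟨A, B, (bal_sub hS x y A B).1 h1, (key A B).1 h2, (key' A B).1 h3⟩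
  · rintro ⟨A, B, h1, h2, h3⟩
    exact ⟨_, _, (bal_sub hS x y A B).2 h1, (key A B).2 h2, (key' A B).2 h3⟩

theorem SCross.of_sub (hS : Clos S) {x y a b : (G.sub S Set.univ).V} (h : SCross r x y a b) :
    SCross r x.1 y.1 a.1 b.1 := by
  obtain ⟨h1, h2, h3, h4, A', B', hb, D, hD, hne⟩ := h
  obtain ⟨A, rfl⟩ := exists_preimage A'
  obtain ⟨B, rfl⟩ := exists_preimage B'
  refine ⟨fun e => h1 (Subtype.ext e), fun e => h2 (Subtype.ext e), fun e => h3 (Subtype.ext e),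
    fun e => h4 (Subtype.ext e), A, B, (bal_sub hS x y A B).1 hb, _, hD.up, ?_⟩
  have : chi x (res A) y (res B) = fun d => chi x.1 A y.1 B d.up := by
    funext d; simp only [chi, ← g_up]
  rwa [← csum_up, ← this]

theorem proper_sub (hS : Clos S) (x : (G.sub S Set.univ).V) (A : Set G.E) :
    Proper x (res A) ↔ Proper x.1 A := by
  unfold Proper
  rw [← dart_sub hS (P := fun d => d.src = x.1 ∧ d.e ∈ A),
    ← dart_sub hS (P := fun d => d.src = x.1 ∧ d.e ∉ A)]
  · simp only [mem_res, src_eq_iff]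
  all_goals exact fun d hd => hd.1 ▸ x.2

theorem Good.sub (hG : Good r G) (hS : Clos S) : Good r (G.sub S Set.univ) where
  finV := have := hG.finV; Subtype.finite
  finE := have := hG.finE; Subtype.finite
  noloop d h := hG.noloop d.up (congrArg Subtype.val h)
  pos e := hG.pos e.1
  link x A' h := by
    obtain ⟨A, rfl⟩ := exists_preimage A'
    rw [van_g_sub hS]
    exact hG.link _ _ ((proper_sub hS x A).1 h)
  deg2 x := by
    obtain ⟨d, d', h1, h2, h3⟩ := hG.deg2 x.1
    have e1 : d.src ∈ S := h1 ▸ x.2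
    have e2 : d'.src ∈ S := h2 ▸ x.2
    exact ⟨d.down e1 (hS d e1) trivial, d'.down e2 (hS d' e2) trivial, Subtype.ext h1,
      Subtype.ext h2, fun h => h3 (congrArg Subtype.val h)⟩
  par d d' d'' h1 h2 h3 h4 :=
    (hG.par d.up d'.up d''.up (congrArg Subtype.val h1) (congrArg Subtype.val h2)
      (fun h => h3 (Subtype.ext h)) (congrArg Subtype.val h4)).imp Subtype.ext Subtype.ext

theorem Cyc.down (hS : Clos S) {x : G.V} (hx : x ∈ S) {C : List G.Dart} (h : Cyc r x C) :
    ∃ C' : List (G.sub S Set.univ).Dart, Cyc r (⟨x, hx⟩ : (G.sub S Set.univ).V) C' ∧ C'.map Dart.up = C := by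
  obtain ⟨h1, h2, h3, h4⟩ := h
  obtain ⟨_, C', h5, rfl⟩ := h1.down hS hx
  refine ⟨C', ⟨h5, by simpa using h2, ?_, ?_⟩, rfl⟩
  · rw [List.Nodup, List.pairwise_map] at h3 ⊢
    rw [List.pairwise_map] at h3
    exact h3.imp fun hne e => hne (congrArg Subtype.val e)
  · rw [List.Nodup, List.pairwise_map] at h4 ⊢
    rw [List.pairwise_map] at h4
    exact h4.imp fun hne e => hne (congrArg Subtype.val e)

end sub

theorem connected_component (c : G.toSimple.ConnectedComponent) :
    (G.component c).toSimple.Connected := by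
  have key : ∀ (x y : G.V) (hx : x ∈ c.supp), G.toSimple.Reachable x y →
      ∃ hy : y ∈ c.supp, (G.component c).toSimple.Reachable ⟨x, hx⟩ ⟨y, hy⟩ := by
    intro x y hx hxy
    obtain ⟨p⟩ := hxy
    induction p with
    | nil => exact ⟨hx, .rfl⟩
    | @cons x y z hxy p ih =>
      obtain ⟨-, d, rfl, rfl⟩ := toSimple_adj.1 hxy
      obtain ⟨hy, h1⟩ := ih (clos_supp c d hx)
      exact ⟨hy, (sub_reach_of_dart hx (clos_supp c d hx) (Set.mem_univ d.e)).trans h1⟩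
  obtain ⟨x, hx⟩ := c.nonempty_supp
  have : Nonempty (G.component c).V := ⟨⟨x, hx⟩⟩
  refine ⟨fun a b => ?_⟩
  obtain ⟨_, h⟩ := key a.1 b.1 a.2 (SimpleGraph.ConnectedComponent.exact (a.2.trans b.2.symm))
  exact h

/-- In a connected graph a nonempty set of vertices closed under adjacency is everything. -/
theorem clos_univ (hc : G.toSimple.Connected) {S : Set G.V} (hS : Clos S) {x : G.V} (hx : x ∈ S)
    (y : G.V) : y ∈ S :=
  reach_invariant (P := fun x y => x ∈ S → y ∈ S) (fun _ h => h) (fun _ _ _ h1 h2 h => h2 (h1 h))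
    (fun a b hab ha => by
      obtain ⟨-, d, rfl, rfl⟩ := toSimple_adj.1 hab
      exact hS d ha) (hc.preconnected x y) hx

/-- A short cycle containing all edges at its vertices. -/
def Ring (r : ℕ∞) (x : G.V) (C : List G.Dart) : Prop :=
  Cyc r x C ∧ ∀ d : G.Dart, (∃ d' ∈ C, d'.src = d.src) → d.e ∈ C.map Dart.e

theorem Ring.down {S : Set G.V} (hS : Clos S) {x : G.V} (hx : x ∈ S) {C : List G.Dart}
    (h : Ring r x C) : ∃ C' : List (G.sub S Set.univ).Dart, Ring r (⟨x, hx⟩ : (G.sub S Set.univ).V) C' := by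
  obtain ⟨C', h1, rfl⟩ := h.1.down hS hx
  refine ⟨C', h1, fun d ⟨d', h2, h3⟩ => ?_⟩
  obtain ⟨f, hf, he⟩ := List.mem_map.1 (h.2 d.up ⟨d'.up, List.mem_map_of_mem h2, by
    exact congrArg Subtype.val h3⟩)
  obtain ⟨f', hf', rfl⟩ := List.mem_map.1 hf
  exact List.mem_map.2 ⟨f', hf', Subtype.ext he⟩

theorem Cyc.clos {x : G.V} {C : List G.Dart} (h : Cyc r x C)
    (hC : ∀ d : G.Dart, (∃ d' ∈ C, d'.src = d.src) → d.e ∈ C.map Dart.e) :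
    Clos {y | ∃ d ∈ C, d.src = y} := by
  intro d hd
  obtain ⟨f, hf, he⟩ := List.mem_map.1 (hC d hd)
  rcases Dart.eq_or_symm he with rfl | rfl
  · exact h.1.1.exists_src hf (.inr rfl)
  · exact ⟨_, hf, rfl⟩

theorem Ring.mem (hc : G.toSimple.Connected) {x : G.V} {C : List G.Dart} (h : Ring r x C)
    (y : G.V) : ∃ d ∈ C, d.src = y := by
  obtain ⟨d, hd⟩ := List.exists_mem_of_ne_nil _ h.1.2.1
  exact clos_univ hc (h.1.clos h.2) ⟨d, hd, rfl⟩ y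

theorem Ring.mem_e (hc : G.toSimple.Connected) {x : G.V} {C : List G.Dart} (h : Ring r x C)
    (d : G.Dart) : d.e ∈ C.map Dart.e := h.2 d (h.mem hc _)

theorem Ring.isCycleGraph (hc : G.toSimple.Connected) {x : G.V} {C : List G.Dart}
    (h : Ring r x C) : G.IsCycleGraph r := by
  obtain ⟨n, hn, h1, h2⟩ := h.1.isCycle
  refine ⟨n, _, _, h1, h2, fun y => ?_, fun e => ?_⟩
  · obtain ⟨d, hd, rfl⟩ := h.mem hc y
    obtain ⟨i, hi, rfl⟩ := List.mem_iff_getElem.1 hd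
    exact ⟨⟨i, by omega⟩, rfl⟩
  · obtain ⟨d, rfl⟩ := exists_dart e
    obtain ⟨f, hf, he⟩ := List.mem_map.1 (h.mem_e hc d)
    obtain ⟨i, hi, rfl⟩ := List.mem_iff_getElem.1 hf
    exact ⟨⟨i, by omega⟩, he⟩

theorem IsCycleGraph.exists_ring (h : G.IsCycleGraph r) (a : G.V) : ∃ C, Ring r a C := by
  obtain ⟨n, c, e, h1, h2, h3, h4⟩ := h
  obtain ⟨p, hp, hd, hs⟩ := h1.exists_walk h2
  have hcyc : Cyc r (c 0) p := by
    have hlen : p.length = n + 1 := by simpa using congrArg List.length hs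
    refine ⟨hp, by rintro rfl; simp at hlen, by rw [hs, List.nodup_ofFn]; exact h1.1, ?_⟩
    have hsub : List.ofFn e ⊆ p.map Dart.e := by
      intro f hf
      obtain ⟨i, rfl⟩ := (List.mem_ofFn' e f).1 hf
      obtain ⟨d, hd, -, -, h5⟩ := hd i
      exact List.mem_map.2 ⟨d, hd, h5⟩
    have hnd : (List.ofFn e).Nodup := List.nodup_ofFn.2 h1.2.1
    have := (List.subperm_of_subset hnd hsub).perm_of_length_le (by simp [hlen])
    exact this.nodup hnd
  obtain ⟨i, rfl⟩ := h3 a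
  obtain ⟨d, hdp, h5, -, -⟩ := hd i
  obtain ⟨q, hq, hperm⟩ := hcyc.rotate_to hdp
  refine ⟨d :: q, h5 ▸ hq, fun f _ => ?_⟩
  obtain ⟨j, hj⟩ := h4 f.e
  obtain ⟨d', hd', -, -, h6⟩ := hd j
  exact List.mem_map.2 ⟨d', hperm.mem_iff.2 hd', h6.trans hj⟩

end LenGraph

namespace LenGraph
variable {G : LenGraph.{u}} {r : ℕ∞} {v w : G.V}

/-! ### Graphs that are basic -/

theorem Good.exists_cyc_through (hG : Good r G) (a : G.V) :
    ∃ (d : G.Dart) (q : List G.Dart), d.src = a ∧ Cyc r a (d :: q) := by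
  obtain ⟨d, d', h1, h2, h3⟩ := hG.deg2 a
  obtain ⟨x, p, h4, h5⟩ := exists_cyc (g_anti _ _) (hG.link a {d.e} ⟨⟨d, h1, rfl⟩, d', h2, Ne.symm h3⟩)
  obtain ⟨f, hf, rfl⟩ := exists_src_of_csum_g_ne h4.1.1 h5
  obtain ⟨q, hq, -⟩ := h4.rotate_to hf
  exact ⟨f, q, rfl, hq⟩

theorem Good.connLocallyTwoConnected (hG : Good r G) (hc : G.toSimple.Connected) :
    G.ConnLocallyTwoConnected r := by
  refine ⟨hc, fun v => (not_isLocalCutvertex_iff hG.edgeClose hG.noloop v).2 (hG.link v), ?_⟩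
  obtain ⟨a⟩ := hc.nonempty
  obtain ⟨d, q, -, h⟩ := hG.exists_cyc_through a
  exact h.hasCycleThrough (by simp)

/-- The edges of a ring at its first vertex are its first and its last edge. -/
theorem Ring.edge_eq (hc : G.toSimple.Connected) {a : G.V} {d dl : G.Dart}
    {q : List G.Dart} (h : Ring r a (d :: (q ++ [dl]))) {f : G.Dart} (hf : f.src = a) :
    f.e = d.e ∨ f.e = dl.e := by
  obtain ⟨hC, -⟩ := id h
  have h1 : d.src = a := hC.1.1.1
  have h2 : dl.tgt = a := by
    have := hC.1.1.2
    exact (wk_split.1 this).2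
  have hnd := hC.2.2.1
  obtain ⟨f', hf', he⟩ := List.mem_map.1 (h.mem_e hc f)
  rcases Dart.eq_or_symm he with rfl | rfl
  · left
    rcases List.mem_cons.1 hf' with rfl | h3
    · rfl
    · rw [List.map_cons, List.nodup_cons] at hnd
      exact absurd (List.mem_map.2 ⟨f', h3, hf.trans h1.symm⟩) hnd.1
  · right
    by_contra hne
    have h4 : f.symm ∈ d :: q := by
      rw [← List.cons_append, List.mem_append, List.mem_singleton] at hf'
      rcases hf' with h4 | h4
      · exact h4
      · exact absurd (by rw [← h4]; rfl) hne
    obtain ⟨p1, p2, h5⟩ := List.append_of_mem h4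
    have hw : Wk a (p1 ++ f.symm :: (p2 ++ [dl])) a := by
      have := hC.1.1
      rw [← List.cons_append, h5] at this; simpa using this
    have hw2 := (wk_split.1 hw).2
    rw [Dart.symm_tgt, hf] at hw2
    have hnd2 : ((d :: q).map Dart.src ++ [dl.src]).Nodup := by simpa using hnd
    cases p2 with
    | nil =>
      have h6 : dl.src = a := hw2.1
      simp only [List.map_cons, List.cons_append, List.nodup_cons] at hnd2
      exact hnd2.1 (by simp [h1, h6])
    | cons m p2 =>
      have h6 : m.src = a := hw2.1
      cases p1 with
      | nil =>
        have h7 : q = m :: p2 := by simpa using (List.cons.inj h5).2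
        subst h7
        simp only [List.map_cons, List.cons_append, List.nodup_cons] at hnd2
        exact hnd2.1 (by simp [h1, h6])
      | cons d0 p1 =>
        obtain ⟨rfl, rfl⟩ := List.cons.inj h5
        simp only [List.map_cons, List.cons_append, List.nodup_cons] at hnd2
        exact hnd2.1 (by simp [h1, h6])

theorem Ring.rotate (hc : G.toSimple.Connected) {x : G.V} {p q : List G.Dart} {d : G.Dart}
    (h : Ring r x (p ++ d :: q)) : Ring r d.src (d :: q ++ p) :=
  ⟨h.1.rotate, fun f _ => by
    have := h.mem_e hc f
    simp only [List.map_append, List.mem_append] at this ⊢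
    exact this.symm⟩

/-- Consecutive vertices of a ring have one further edge each, and a separation puts these two edges
on the same side. So only one side has an edge leaving the pair. -/
theorem Ring.not_LS_first (hG : Good r G) (hc : G.toSimple.Connected) {a : G.V} {d dl : G.Dart}
    {q : List G.Dart} (h : Ring r a (d :: (q ++ [dl]))) : ¬ LS r a d.tgt := by
  classical
  rintro ⟨hab, -, A, B, ⟨hV, hD⟩, ⟨f, hf⟩, f', hf'⟩
  have hda : d.src = a := h.1.1.1.1
  obtain ⟨d2, q2, hq⟩ : ∃ d2 q2, q ++ [dl] = d2 :: q2 := List.exists_cons_of_ne_nil (by simp)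
  have hb : d2.src = d.tgt := by have := h.1.1.1.2; rw [hq] at this; exact this.1
  have h' : Ring r d.tgt (d2 :: (q2 ++ [d])) := by
    have h2 : Ring r a ([d] ++ d2 :: q2) := by rw [← hq]; exact h
    exact hb ▸ h2.rotate hc
  have e1 := csum_g_cyc_eq (A := A) hG.noloop h.1
  have e2 := csum_g_cyc_eq (A := B) hG.noloop h'.1
  have e3 := hV a _ h.1.1
  have hperm : (d :: (q ++ [dl])).Perm (d2 :: (q2 ++ [d])) := by
    rw [hq]; exact (List.perm_append_comm : ([d] ++ (d2 :: q2)).Perm _)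
  rw [csum_chi, e1, csum_perm _ hperm, e2] at e3
  have e4 := hD [d] (hda ▸ hG.edgeClose d)
  simp only [csum_cons, csum_nil, chi, g, hda, hab, hab.symm, true_and, false_and,
    if_false] at e4
  have key : (dl.e ∈ A) ↔ (d2.e ∈ B) := by
    by_cases c1 : d.e ∈ A <;> by_cases c2 : d.e ∈ B <;> by_cases c3 : dl.e ∈ A <;>
      by_cases c4 : d2.e ∈ B <;> simp_all
  have ha : ∀ f : G.Dart, f.src = a → f.tgt ≠ d.tgt → f.e = dl.e := fun f h1 h2 => by
    refine (h.edge_eq hc h1).resolve_left fun h3 => ?_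
    rcases Dart.eq_or_symm h3 with rfl | rfl
    · exact h2 rfl
    · exact hab h1.symm
  have hb' : ∀ f : G.Dart, f.src = d.tgt → f.tgt ≠ a → f.e = d2.e := fun f h1 h2 => by
    refine (h'.edge_eq hc h1).resolve_right fun h3 => ?_
    rcases Dart.eq_or_symm h3 with rfl | rfl
    · exact hab (hda.symm.trans h1)
    · exact h2 hda
  have c1 : dl.e ∈ A := by
    rcases hf with ⟨h1, h2, h3⟩ | ⟨h1, h2, h3⟩
    · exact ha f h1 h2 ▸ h3
    · exact key.2 (hb' f h1 h2 ▸ h3)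
  rcases hf' with ⟨h1, h2, h3⟩ | ⟨h1, h2, h3⟩
  · exact h3 (ha f' h1 h2 ▸ c1)
  · exact h3 (hb' f' h1 h2 ▸ key.1 c1)

theorem Cyc.exists_concat (hG : Good r G) {x : G.V} {C : List G.Dart} (h : Cyc r x C) :
    ∃ d q dl, C = d :: (q ++ [dl]) := by
  obtain ⟨d, C, rfl⟩ := List.exists_cons_of_ne_nil h.2.1
  rcases List.eq_nil_or_concat C with rfl | ⟨q, dl, rfl⟩
  · have := h.1.1
    exact absurd (this.1.trans this.2.symm) (hG.noloop d)
  · exact ⟨d, q, dl, by simp⟩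

/-- In a cycle, every local separator is crossed. -/
theorem Ring.exists_cross (hG : Good r G) (hc : G.toSimple.Connected) {a b : G.V}
    {C : List G.Dart} (h : Ring r a C) (hL : LS r a b) : ∃ p q, LS r p q ∧ SCross r a b p q := by
  classical
  obtain ⟨d1, q0, dl, rfl⟩ := h.1.exists_concat hG
  have h1 : d1.src = a := h.1.1.1.1
  have hw := h.1.1.1.2
  have hl : dl.tgt = a := (wk_split.1 hw).2
  have hrot : Ring r dl.src (dl :: (d1 :: q0)) := by
    have h2 : Ring r a ((d1 :: q0) ++ dl :: []) := h
    simpa using h2.rotate hc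
  have hpb : d1.tgt ≠ b := fun e => h.not_LS_first hG hc (e ▸ hL)
  have hqb : dl.src ≠ b := by
    rintro rfl
    obtain ⟨d', q', dl', he⟩ := hrot.1.exists_concat hG
    obtain ⟨rfl, he'⟩ := List.cons.inj he
    rw [he] at hrot
    exact hrot.not_LS_first hG hc (hl.symm ▸ hL.symm)
  have hpa : d1.tgt ≠ a := fun e => hG.noloop d1 (h1.trans e.symm)
  have hqa : dl.src ≠ a := fun e => hG.noloop dl (e.trans hl.symm)
  obtain ⟨fb, hfb, hfb'⟩ := h.mem hc b
  have hfb2 : fb ∈ q0 := by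
    rcases List.mem_cons.1 hfb with rfl | h2
    · exact absurd (h1.symm.trans hfb') hL.1
    · rcases List.mem_append.1 h2 with h3 | h3
      · exact h3
      · rw [List.mem_singleton.1 h3] at hfb'; exact absurd hfb' hqb
  have hnd := h.1.2.2.1
  have hne := h.1.2.2.2
  -- As `b` differs from `a` and both its neighbours, the cycle has at least four vertices. The
  -- neighbours of `a` form the crossing pair.
  obtain ⟨d2, d3, q1, rfl⟩ : ∃ d2 d3 q1, q0 = d2 :: d3 :: q1 := by
    match q0, hfb2, hw with
    | [f], hf, hw => exact absurd (hw.1.symm.trans (by rw [← hfb', List.mem_singleton.1 hf])) hpb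
    | d2 :: d3 :: q1, _, _ => exact ⟨d2, d3, q1, rfl⟩
  have h2 : d2.src = d1.tgt := hw.1
  have h3 : d3.src = d2.tgt := hw.2.1
  simp only [List.map_cons, List.cons_append, List.map_append, List.map_nil, List.nodup_cons,
    List.mem_cons, List.mem_append, not_or] at hnd hne
  have hpq : d1.tgt ≠ dl.src := by rw [← h2]; exact hnd.2.1.2.2.1
  have htq : d2.tgt ≠ dl.src := by rw [← h3]; exact hnd.2.2.1.2.1
  have he21 : d2.e ≠ d1.e := Ne.symm hne.1.1
  have hel1 : d1.e ≠ dl.e := hne.1.2.2.2.1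
  have hSW : SW r dl.src [dl, d1] d1.tgt := by
    have h4 : SW r dl.src ([dl, d1] ++ (d2 :: d3 :: q1)) dl.src := hrot.1.1
    exact h4.left ⟨rfl, by rw [hl, h1], rfl⟩
  -- All edges at `a` are `d1` and `dl`, so the indicator of `a` is a potential for these two edges
  -- taken as one side at the neighbours of `a`.
  have hpot : ∀ f : G.Dart, chi d1.tgt {d1.e} dl.src {dl.e} f =
      (if f.tgt = a then 1 else 0) - if f.src = a then 1 else 0 := by
    intro f
    by_cases c1 : f.e = d1.e
    · rcases Dart.eq_or_symm c1 with rfl | rfl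
      · simp [chi, g, h1, hpa, hpa.symm, hel1]
      · simp [chi, g, h1, hpa, hpa.symm, hel1]
    by_cases c2 : f.e = dl.e
    · rcases Dart.eq_or_symm c2 with rfl | rfl
      · simp [chi, g, hl, hqa, hqa.symm, Ne.symm hel1]
      · simp [chi, g, hl, hqa, hqa.symm, Ne.symm hel1]
    have n1 : f.src ≠ a := fun e => (h.edge_eq hc e).elim c1 c2
    have n2 : f.tgt ≠ a := fun e => (h.edge_eq hc (f := f.symm) e).elim c1 c2
    simp [chi, g, n1, n2, c1, c2]
  refine ⟨d1.tgt, dl.src, ⟨hpq, ⟨_, hSW.symm⟩, {d1.e}, {dl.e}, ⟨fun x p hp => ?_, fun D hD => ?_⟩,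
    ⟨d1.symm, .inl ⟨rfl, ?_, rfl⟩⟩, d2, .inl ⟨h2, htq, he21⟩⟩, ?_⟩
  · rw [csum_potential (fun z => if z = a then 1 else 0) hp.1 fun d _ => hpot d, sub_self]
  · rw [csum_potential (fun z => if z = a then 1 else 0) hD.1 fun d _ => hpot d]
    simp [hpa, hqa]
  · rw [Dart.symm_tgt, h1]; exact hqa.symm
  · obtain ⟨A, B, hb, ⟨⟨f, hf, hfA⟩, f', hf', hfA'⟩, -⟩ := hL.exists_proper hG
    refine ⟨hpa, hpb, hqa, hqb, A, B, hb, _, hSW.symm, ?_⟩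
    rw [csum_rev (chi_anti _ _ _ _)]
    have hb1 : a ≠ b := hL.1
    have e1 := h.edge_eq hc hf
    have e2 := h.edge_eq hc hf'
    by_cases c1 : d1.e ∈ A <;> by_cases c2 : dl.e ∈ A
    · rcases e2 with e2 | e2 <;> rw [e2] at hfA' <;> contradiction
    · simp [chi, g, h1, hl, hpa, hpb, hqa, hqb, hb1, c1, c2]
    · simp [chi, g, h1, hl, hpa, hpb, hqa, hqb, hb1, c1, c2]
    · rcases e1 with e1 | e1 <;> rw [e1] at hfA <;> contradiction

/-- Suppose an edge leaves a short cycle at one of its vertices. Either `par` is violated, or this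
vertex, its two neighbours on the cycle and the far end of the edge are four distinct vertices. -/
theorem Good.ring_of_card (hG : Good r G) (h : ¬ 4 ≤ ENat.card G.V) (a : G.V) :
    ∃ C, Ring r a C := by
  obtain ⟨d0, q0, h0, hC⟩ := hG.exists_cyc_through a
  refine ⟨_, hC, fun f ⟨f', hf', hff⟩ => ?_⟩
  obtain ⟨q, hq, hperm⟩ := hC.rotate_to hf'
  rw [hff] at hq
  suffices f.e ∈ (f' :: q).map Dart.e from (hperm.map _).mem_iff.1 this
  obtain ⟨d1, q, dl, he⟩ := hq.exists_concat hG
  rw [he] at hq ⊢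
  have h1 : d1.src = f.src := hq.1.1.1
  have hw := hq.1.1.2
  have hl : dl.tgt = f.src := (wk_split.1 hw).2
  by_contra hne
  simp only [List.map_cons, List.map_append, List.map_nil, List.mem_cons, List.mem_append,
    not_or] at hne
  have hnd := hq.2.2.1
  have hnde := hq.2.2.2
  simp only [List.map_cons, List.map_append, List.map_nil, List.nodup_cons, List.mem_cons,
    List.mem_append, not_or] at hnde
  have hel1 : d1.e ≠ dl.e := hnde.1.2.1
  by_cases hpq : d1.tgt = dl.src
  · rcases hG.par d1 dl.symm f (h1.trans hl.symm) hpq hel1 h1.symm with h2 | h2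
    · exact hne.1 h2
    · exact hne.2.2.1 h2
  by_cases hp : f.tgt = d1.tgt
  · rcases hG.par d1 f dl.symm h1 hp.symm (Ne.symm hne.1) (hl.trans h1.symm) with h2 | h2
    · exact hel1 h2.symm
    · exact hne.2.2.1 h2.symm
  by_cases hq' : f.tgt = dl.src
  · rcases hG.par dl.symm f d1 hl hq'.symm (Ne.symm hne.2.2.1) (h1.trans hl.symm) with h2 | h2
    · exact hel1 h2
    · exact hne.1 h2.symm
  have := hG.finV
  have := Fintype.ofFinite G.V
  have hnd4 : [f.src, f.tgt, d1.tgt, dl.src].Nodup := by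
    have n1 := hG.noloop f
    have n2 := hG.noloop d1
    have n3 := hG.noloop dl
    rw [h1] at n2; rw [hl] at n3
    simp [n1, n2, Ne.symm n3, hp, hq', hpq]
  have := hnd4.length_le_card
  apply h
  rw [ENat.card_eq_coe_fintype_card]
  exact_mod_cast this

theorem Good.basicComponents (hG : Good r G)
    (hall : ∀ v w : G.V, LS r v w → ∃ a b, LS r a b ∧ SCross r v w a b) : G.BasicComponents r := by
  intro c
  have hH : Good r (G.component c) := hG.sub (clos_supp c)
  have hc := connected_component c
  by_cases h : ∃ x y : (G.component c).V, LS r x y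
  · obtain ⟨x, y, h⟩ := h
    obtain ⟨C, h1, h2⟩ := exists_ring hG hall ((LS_sub (clos_supp c) x y).1 h)
    obtain ⟨C', h3⟩ := Ring.down (clos_supp c) x.2 ⟨h1, h2⟩
    exact .inr (Ring.isCycleGraph hc h3)
  by_cases h4 : 4 ≤ ENat.card (G.component c).V
  · exact .inl ⟨hH.connLocallyTwoConnected hc,
      fun x y hxy => h ⟨x, y, (isLocalSep_iff hH).1 hxy⟩, h4⟩
  · obtain ⟨a⟩ := hc.nonempty
    obtain ⟨C, hC⟩ := hH.ring_of_card h4 a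
    exact .inr (hC.isCycleGraph hc)

/-- A locally 3-connected component contains no separator, so the separator lies in a cycle, where
the neighbours of one of its vertices cross it. -/
theorem BasicComponents.exists_cross (hG : Good r G) (hB : G.BasicComponents r) (h : LS r v w) :
    ∃ a b, LS r a b ∧ SCross r v w a b := by
  let c := G.toSimple.connectedComponentMk v
  have hS := clos_supp c
  have hv : v ∈ c.supp := rfl
  have hw : w ∈ c.supp := by
    obtain ⟨p, hp⟩ := h.2.1
    exact (hp.down hS hv).1
  have hH : Good r (G.component c) := hG.sub hS
  have hc := connected_component c
  have hL : LS (G := G.component c) r ⟨v, hv⟩ ⟨w, hw⟩ := (LS_sub hS ⟨v, hv⟩ ⟨w, hw⟩).2 h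
  rcases hB c with h1 | h1
  · exact absurd ((isLocalSep_iff hH).2 hL) (h1.2.1 _ _)
  · obtain ⟨C, hC⟩ := IsCycleGraph.exists_ring h1 ⟨v, hv⟩
    obtain ⟨p, q, h2, h3⟩ := hC.exists_cross hH hc hL
    exact ⟨p.1, q.1, (LS_sub hS p q).1 h2, SCross.of_sub hS h3⟩

/-! ### Simple graphs -/

/-- If `x` had a single edge, the indicator of `x` would be a potential for this edge at its other
end, which by `link` has no further edge. Then the connected graph would have just one edge. -/
theorem deg2_of_link (hc : G.toSimple.Connected) (hl : ∀ d : G.Dart, d.src ≠ d.tgt)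
    (link : ∀ (v : G.V) (A : Set G.E), Proper v A → ¬ Van r (g v A)) {e0 e1 : G.E} (he : e0 ≠ e1)
    (x : G.V) : ∃ d d' : G.Dart, d.src = x ∧ d'.src = x ∧ d.e ≠ d'.e := by
  classical
  by_contra hcon
  push Not at hcon
  obtain ⟨f0, hf0⟩ := exists_dart e0
  obtain ⟨f1, hf1⟩ := exists_dart e1
  obtain ⟨d, hd⟩ : ∃ d : G.Dart, d.src = x := by
    by_contra h
    push Not at h
    exact h f0 (clos_univ hc (S := {x}) (fun d hd => absurd hd (h d)) rfl f0.src)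
  have hu : ∀ f : G.Dart, f.src = d.tgt → f.e = d.e := by
    intro f hf
    by_contra hne
    refine link d.tgt {d.e} ⟨⟨d.symm, rfl, rfl⟩, f, hf, hne⟩ fun y p hp => ?_
    have hnl := hl d
    rw [hd] at hnl
    rw [csum_potential (fun z => if z = x then 1 else 0) hp.1, sub_self]
    intro f _
    by_cases c1 : f.e = d.e
    · rcases Dart.eq_or_symm c1 with rfl | rfl <;> simp [g, hd, hnl, hnl.symm]
    · have n1 : f.src ≠ x := fun h => c1 (hcon f d h hd)
      have n2 : f.tgt ≠ x := fun h => c1 (hcon f.symm d h hd)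
      simp [g, c1, n1, n2]
  have hall : ∀ y, y ∈ ({x, d.tgt} : Set G.V) := by
    refine clos_univ hc (x := x) (fun f hf => ?_) (.inl rfl)
    have : f.e = d.e := by
      rcases hf with hf | hf
      · exact hcon f d hf hd
      · exact hu f hf
    rcases Dart.eq_or_symm this with rfl | rfl
    · exact .inr rfl
    · exact .inl hd
  have hedge : ∀ f : G.Dart, f.e = d.e := by
    intro f
    rcases hall f.src with hf | hf
    · exact hcon f d hf hd
    · exact hu f hf
  exact he (by rw [← hf0, ← hf1, hedge f0, hedge f1])

theorem good_ofSimple {V : Type u} [Finite V] (Γ : SimpleGraph V)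
    (h : (ofSimple Γ).LocallyTwoConnected r) : Good r (ofSimple Γ) := by
  have hnl : ∀ d : (ofSimple Γ).Dart, d.src ≠ d.tgt := fun d => by
    have h1 : d.e.1 = s(d.src, d.tgt) := d.h
    have h2 : s(d.src, d.tgt) ∈ Γ.edgeSet := h1 ▸ d.e.2
    exact Γ.ne_of_adj (SimpleGraph.mem_edgeSet Γ |>.1 h2)
  have hnl' : ∀ c (d : ((ofSimple Γ).component c).Dart), d.src ≠ d.tgt := fun c d h =>
    hnl d.up (congrArg Subtype.val h)
  have hcyc : ∀ c, (∃ e0 e1 : ((ofSimple Γ).component c).E, e0 ≠ e1) ∧ (2 : ℕ∞) ≤ r := by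
    intro c
    obtain ⟨-, -, n, x, e, ⟨h1, h2, h3⟩, hr, -⟩ := h c
    rcases n with - | n
    · exact absurd rfl (hnl' c ⟨x 0, x 0, e 0, h3 0⟩)
    · refine ⟨⟨e 0, e 1, fun h => by simpa using h2 h⟩, le_trans ?_ hr⟩
      have : (∑ i, ((ofSimple Γ).component c).len (e i)) = n + 1 + 1 := by
        show (∑ i : Fin (n + 1 + 1), 1) = n + 1 + 1
        simp
      rw [this]
      exact_mod_cast (by omega : 2 ≤ n + 1 + 1)
  have hlink : ∀ c (x : ((ofSimple Γ).component c).V) A, Proper x A → ¬ Van r (g x A) := by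
    intro c x
    refine (not_isLocalCutvertex_iff (fun d => ?_) (hnl' c) x).1 ((h c).2.1 x)
    -- Traversing a unit edge back and forth has length 2, which is at most `r` because a loopless
    -- cycle of length at most `r` exists.
    exact ⟨⟨rfl, rfl⟩, [d.symm], ⟨rfl, rfl⟩, (hcyc c).2⟩
  refine ⟨‹Finite V›, (inferInstance : Finite Γ.edgeSet), hnl, fun _ => Nat.one_pos, ?_, ?_, ?_⟩
  · intro v A hA
    let c := (ofSimple Γ).toSimple.connectedComponentMk v
    have hS := clos_supp c
    rw [← van_g_sub hS ⟨v, rfl⟩ A]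
    exact hlink c _ _ ((proper_sub hS ⟨v, rfl⟩ A).2 hA)
  · intro v
    let c := (ofSimple Γ).toSimple.connectedComponentMk v
    obtain ⟨⟨e0, e1, he⟩, -⟩ := hcyc c
    obtain ⟨d, d', h1, h2, h3⟩ := deg2_of_link (h c).1 (hnl' c) (hlink c) he ⟨v, rfl⟩
    exact ⟨d.up, d'.up, congrArg Subtype.val h1, congrArg Subtype.val h2,
      fun h => h3 (Subtype.ext h)⟩
  · intro d d' _ h1 h2 h3
    refine absurd (Subtype.ext ?_) h3
    have e1 : d.e.1 = s(d.src, d.tgt) := d.h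
    have e2 : d'.e.1 = s(d'.src, d'.tgt) := d'.h
    rw [e1, e2, h1, h2]

end LenGraph

namespace LenGraph
variable {G : LenGraph.{u}} {r : ℕ∞} {v w : G.V}

/-! ### Cutting along the uncrossed separators -/

theorem mem_uncrossed_iff (hG : Good r G) : s(v, w) ∈ G.uncrossed r ↔
    LS r v w ∧ ∀ a b, LS r a b → ¬ SCross r v w a b := by
  constructor
  · rintro ⟨v', w', h1, h2, h3⟩
    have h2' := (isLocalSep_iff hG).1 h2
    have h3' : ∀ a b, LS r a b → ¬ SCross r v' w' a b := fun a b hab hc =>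
      h3 a b ((isLocalSep_iff hG).2 hab) ((crosses_iff hG h2'.1 h2'.2.1 hab).2 hc)
    rcases Sym2.eq_iff.1 h1 with ⟨rfl, rfl⟩ | ⟨rfl, rfl⟩
    · exact ⟨h2', h3'⟩
    · exact ⟨h2'.symm, fun a b hab hc => h3' a b hab hc.swap_left⟩
  · rintro ⟨h1, h2⟩
    exact ⟨v, w, rfl, (isLocalSep_iff hG).2 h1, fun a b hab hc =>
      h2 a b ((isLocalSep_iff hG).1 hab)
        ((crosses_iff hG h1.1 h1.2.1 ((isLocalSep_iff hG).1 hab)).1 hc)⟩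

theorem not_scross_of_uncrossed (hG : Good r G) (h : LS r v w) {a b : G.V}
    (hY : s(a, b) ∈ G.uncrossed r) : ¬ SCross r v w a b := fun hc => by
  obtain ⟨h1, h2⟩ := (mem_uncrossed_iff hG).1 hY
  exact h2 v w h (h1.scross_symm hG hc)

theorem exists_isLift (hG : Good r G) (h : LS r v w) {Y : Sym2 G.V} (hY : Y ∈ G.uncrossed r)
    (hne : Y ≠ s(v, w)) : ∃ Y', G.IsLift r v w Y Y' := by
  induction Y with
  | _ a b =>
    have hnc := not_scross_of_uncrossed hG h hY
    have hL := ((mem_uncrossed_iff hG).1 hY).1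
    obtain ⟨x, y, hx, rfl, rfl, hxy⟩ := exists_near_lift hG h hL hne hnc
    have hL' := lift_LS hG h hx hxy hL hne hnc
    exact ⟨s(x, y), isLift_iff.2 ⟨x, y, hx, LS_main hL'.symm, rfl, rfl,
      hL'.hasCycleThrough (hG.cut h)⟩⟩

/-- A separator crossing the lift projects to one crossing `Y`. The cut pair may be any local
separator, as is needed for arbitrary cutting sequences. -/
theorem uncrossed_of_isLift (hG : Good r G) (h : LS r v w) {Y : Sym2 G.V}
    (hY : Y ∈ G.uncrossed r) (hne : Y ≠ s(v, w)) {Y' : Sym2 (G.cut r v w).V}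
    (hl : G.IsLift r v w Y Y') : Y' ∈ (G.cut r v w).uncrossed r := by
  obtain ⟨x, y, hx, hy, rfl, rfl, hc⟩ := isLift_iff.1 hl
  have hnc := not_scross_of_uncrossed hG h hY
  obtain ⟨hL, hu⟩ := (mem_uncrossed_iff hG).1 hY
  have hL' := lift_LS hG h hx (near_of_hasCycleThrough hc) hL hne hnc
  refine (mem_uncrossed_iff (hG.cut h)).2 ⟨hL', fun s t hT hcr => ?_⟩
  exact hu _ _ (down_LS hG h hT).1 (scross_down hG h hL' hT hcr)

/-- A separator crossing the projection of `Y'` is not `{v, w}` and does not cross it, as `{v, w}`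
is uncrossed. Hence it lifts and crosses `Y'`, a contradiction. -/
theorem exists_isLift_eq (hG : Good r G) (hX : s(v, w) ∈ G.uncrossed r)
    {Y' : Sym2 (G.cut r v w).V} (hY : Y' ∈ (G.cut r v w).uncrossed r) :
    ∃ Y ∈ G.uncrossed r, Y ≠ s(v, w) ∧ G.IsLift r v w Y Y' := by
  obtain ⟨h, hXu⟩ := (mem_uncrossed_iff hG).1 hX
  have hG' := hG.cut h
  induction Y' with
  | _ x y =>
    obtain ⟨hL, hu⟩ := (mem_uncrossed_iff hG').1 hY
    obtain ⟨hL0, hne, hnc⟩ := down_LS hG h hL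
    refine ⟨_, (mem_uncrossed_iff hG).2 ⟨hL0, fun a b hab hcr => ?_⟩, hne, isLift_iff.2
      ⟨x, y, LS_main hL, LS_main hL.symm, rfl, rfl, hL.hasCycleThrough hG'⟩⟩
    have hnab : s(a, b) ≠ s(v, w) := by
      intro he
      have hcr' : SCross r (proj x) (proj y) v w := by
        rcases Sym2.eq_iff.1 he with ⟨rfl, rfl⟩ | ⟨rfl, rfl⟩
        · exact hcr
        · exact hcr.swap_right
      exact hnc (h.scross_symm hG hcr')
    obtain ⟨s, t, hs, rfl, rfl, hst⟩ := exists_near_lift hG h hab hnab (hXu a b hab)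
    have hT := lift_LS hG h hs hst hab hnab (hXu _ _ hab)
    exact hu _ _ hT (scross_up hG h hL hT hcr)

theorem eq_of_proj_off {x y : (G.cut r v w).V} (hx : Main x) (hy : Main y)
    (ho : Off v w (proj x)) (he : proj x = proj y) : x = y := by
  rcases hx.cases with ⟨u, hu, rfl⟩ | ⟨k, i, rfl⟩
  · rcases hy.cases with ⟨t, ht, rfl⟩ | ⟨k', j, rfl⟩
    · obtain rfl : u = t := he
      rfl
    · exact absurd he (off_side hu j)
  · exact absurd rfl (off_side ho i)

/-- At least one vertex of the pair is off the separator and so has a unique lift. The lift of the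
other is then determined by being near it. -/
theorem isLift_right_unique (hG : Good r G) (h : LS r v w) {Y : Sym2 G.V} (hn : ¬ Y.IsDiag)
    (hne : Y ≠ s(v, w)) {Y1 Y2 : Sym2 (G.cut r v w).V} (h1 : G.IsLift r v w Y Y1)
    (h2 : G.IsLift r v w Y Y2) : Y1 = Y2 := by
  have key : ∀ {x y z t : (G.cut r v w).V}, Main x → Main y → Main z → Main t → Near r x y →
      Near r z t → proj x = proj z → proj y = proj t → Off v w (proj x) → x = z ∧ y = t := by
    intro x y z t hx hy hz ht h1 h2 e1 e2 ho
    obtain rfl := eq_of_proj_off hx hz ho e1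
    exact ⟨rfl, near_unique₂ hG h (.inl ho) hx h1 h2 e2⟩
  have key2 : ∀ {x y z t : (G.cut r v w).V}, Main x → Main y → Main z → Main t → Near r x y →
      Near r z t → proj x = proj z → proj y = proj t → Off v w (proj x) ∨ Off v w (proj y) →
      s(x, y) = s(z, t) := by
    rintro x y z t hx hy hz ht h1 h2 e1 e2 (ho | ho)
    · obtain ⟨rfl, rfl⟩ := key hx hy hz ht h1 h2 e1 e2 ho
      rfl
    · obtain ⟨rfl, rfl⟩ := key hy hx ht hz h1.symm h2.symm e2 e1 ho
      rfl
  obtain ⟨x, y, hx, hy, rfl, rfl, hc⟩ := isLift_iff.1 h1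
  obtain ⟨z, t, hz, ht, he, rfl, hc'⟩ := isLift_iff.1 h2
  have n1 := near_of_hasCycleThrough hc
  have n2 := near_of_hasCycleThrough hc'
  have ho : Off v w (proj x) ∨ Off v w (proj y) := by
    by_contra hcon
    simp only [Off, not_or, not_and_or, not_not, ne_eq] at hcon
    rw [Sym2.mk_isDiag_iff] at hn
    rcases hcon with ⟨c1 | c1, c2 | c2⟩
    · exact hn (c1.trans c2.symm)
    · exact hne (by rw [c1, c2])
    · exact hne (by rw [c1, c2, Sym2.eq_swap])
    · exact hn (c1.trans c2.symm)
  rcases Sym2.eq_iff.1 he with ⟨e1, e2⟩ | ⟨e1, e2⟩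
  · exact key2 hx hy hz ht n1 n2 e1 e2 ho
  · rw [key2 hx hy ht hz n1 n2.symm e1 e2 ho, Sym2.eq_swap]

theorem isLift_left_unique {Y1 Y2 : Sym2 G.V} {Y : Sym2 (G.cut r v w).V}
    (h1 : G.IsLift r v w Y1 Y) (h2 : G.IsLift r v w Y2 Y) : Y1 = Y2 := by
  obtain ⟨x, y, -, -, rfl, rfl, -⟩ := isLift_iff.1 h1
  obtain ⟨z, t, -, -, rfl, he, -⟩ := isLift_iff.1 h2
  simpa using congrArg (Sym2.map proj) he

theorem not_isDiag_of_uncrossed {X : Sym2 G.V} (h : X ∈ G.uncrossed r) : ¬ X.IsDiag := by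
  obtain ⟨v, w, rfl, h, -⟩ := h
  exact h.1

theorem forall₂_mem_right {α β : Type*} {R : α → β → Prop} {L : List α} {L' : List β}
    (h : List.Forall₂ R L L') {b : β} (hb : b ∈ L') : ∃ a ∈ L, R a b := by
  induction h with
  | nil => simp at hb
  | @cons a b' L L' hab _ ih =>
    rcases List.mem_cons.1 hb with rfl | hb
    · exact ⟨a, List.mem_cons_self, hab⟩
    · obtain ⟨a', h1, h2⟩ := ih hb
      exact ⟨a', List.mem_cons_of_mem _ h1, h2⟩

theorem forall₂_mem_left {α β : Type*} {R : α → β → Prop} {L : List α} {L' : List β}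
    (h : List.Forall₂ R L L') {a : α} (ha : a ∈ L) : ∃ b ∈ L', R a b :=
  forall₂_mem_right h.flip ha

theorem exists_forall₂ {α β : Type*} {R : α → β → Prop} {L : List α}
    (h : ∀ a ∈ L, ∃ b, R a b) : ∃ L', List.Forall₂ R L L' := by
  induction L with
  | nil => exact ⟨[], .nil⟩
  | cons a L ih =>
    obtain ⟨b, hb⟩ := h a List.mem_cons_self
    obtain ⟨L', hL'⟩ := ih fun a ha => h a (List.mem_cons_of_mem _ ha)
    exact ⟨b :: L', .cons hb hL'⟩

theorem forall₂_nodup {α β : Type*} {R : α → β → Prop} (hR : ∀ a a' b, R a b → R a' b → a = a')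
    {L : List α} {L' : List β} (h : List.Forall₂ R L L') (hL : L.Nodup) : L'.Nodup := by
  induction h with
  | nil => exact List.nodup_nil
  | @cons a b L L' hab h ih =>
    obtain ⟨h1, h2⟩ := List.nodup_cons.1 hL
    refine List.nodup_cons.2 ⟨fun hb => ?_, ih h2⟩
    obtain ⟨a', ha', hR'⟩ := forall₂_mem_right h hb
    exact h1 (hR _ _ _ hab hR' ▸ ha')

/-- The members of `L` are exactly the uncrossed local separators. -/
def Lists (r : ℕ∞) (G : LenGraph.{u}) (L : List (Sym2 G.V)) : Prop :=
  L.Nodup ∧ ∀ X, X ∈ L ↔ X ∈ G.uncrossed r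

/-- Lifting is a bijection between the uncrossed separators other than the cut one and the uncrossed
separators of the cut graph, so the lifted list is again complete and without repetition. -/
theorem Lists.lift (hG : Good r G) {L : List (Sym2 G.V)} (h : Lists r G (s(v, w) :: L))
    {L' : List (Sym2 (G.cut r v w).V)} (hL : List.Forall₂ (G.IsLift r v w) L L') :
    Lists r (G.cut r v w) L' := by
  have hX := (h.2 _).1 List.mem_cons_self
  have hLS := ((mem_uncrossed_iff hG).1 hX).1
  obtain ⟨h1, h2⟩ := List.nodup_cons.1 h.1
  refine ⟨forall₂_nodup (R := G.IsLift r v w) (fun _ _ _ e1 e2 => isLift_left_unique e1 e2) hL h2,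
    fun Y' => ⟨fun hY' => ?_, fun hY' => ?_⟩⟩
  · obtain ⟨Y, hY, hl⟩ := forall₂_mem_right hL hY'
    exact uncrossed_of_isLift hG hLS ((h.2 _).1 (List.mem_cons_of_mem _ hY))
      (fun e => h1 (e ▸ hY)) hl
  · obtain ⟨Y, hY, hne, hl⟩ := exists_isLift_eq hG hX hY'
    have hmem : Y ∈ L := (List.mem_cons.1 ((h.2 Y).2 hY)).resolve_left hne
    obtain ⟨Y2, hY2, hl2⟩ := forall₂_mem_left hL hmem
    exact isLift_right_unique hG hLS (not_isDiag_of_uncrossed hY) hne hl2 hl ▸ hY2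

/-- Induction on the number of uncrossed separators, over all good graphs. When none is left, every
separator is crossed and `Good.basicComponents` applies. -/
theorem cutsAlong (n : ℕ) : ∀ (G : LenGraph.{u}) (L : List (Sym2 G.V)), L.length = n → Good r G →
    Lists r G L → (∃ G', CutsAlong r G L G') ∧ ∀ G', CutsAlong r G L G' → G'.BasicComponents r := by
  induction n with
  | zero =>
    intro G L hn hG hL
    obtain rfl := List.length_eq_zero_iff.1 hn
    refine ⟨⟨G, .nil G⟩, fun G' h => ?_⟩
    cases h
    refine hG.basicComponents fun v w h => ?_
    by_contra hcon
    push Not at hcon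
    exact absurd ((hL.2 _).2 ((mem_uncrossed_iff hG).2 ⟨h, hcon⟩)) (by simp)
  | succ n ih =>
    intro G L hn hG hL
    obtain ⟨X, L, rfl⟩ := List.exists_cons_of_length_eq_add_one hn
    have hX := (hL.2 X).1 List.mem_cons_self
    constructor
    · induction X with
      | _ v w =>
        obtain ⟨h1, h2⟩ := List.nodup_cons.1 hL.1
        have hLS := ((mem_uncrossed_iff hG).1 hX).1
        obtain ⟨L', hL'⟩ := exists_forall₂ (R := G.IsLift r v w) (L := L) fun Y hY =>
          exists_isLift hG hLS ((hL.2 _).1 (List.mem_cons_of_mem _ hY)) fun e => h1 (e ▸ hY)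
        obtain ⟨G', h'⟩ := (ih _ L' (by rw [← hL'.length_eq]; simpa using hn) (hG.cut hLS)
          (hL.lift hG hL')).1
        exact ⟨G', .cons ((isLocalSep_iff hG).2 hLS) hL' h'⟩
    · intro G' h
      cases h with
      | @cons _ _ v w _ L' h1 h2 h3 =>
        exact (ih _ L' (by rw [← h2.length_eq]; simpa using hn)
          (hG.cut ((isLocalSep_iff hG).1 h1)) (hL.lift hG h2)).2 G' h3

/-- As long as it is not cut, an uncrossed separator has an uncrossed lift after each step. At the
end this contradicts `BasicComponents.exists_cross`. -/
theorem CutSeq.cutsAt {G H : LenGraph.{u}} (S : CutSeq r G H) (hG : Good r G)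
    (hH : H.BasicComponents r) {X : Sym2 G.V} (hX : X ∈ G.uncrossed r) : S.CutsAt X := by
  induction S with
  | nil G =>
    obtain ⟨v, w, rfl, -⟩ := id hX
    obtain ⟨h1, h2⟩ := (mem_uncrossed_iff hG).1 hX
    obtain ⟨a, b, h3, h4⟩ := hH.exists_cross hG h1
    exact absurd h4 (h2 a b h3)
  | cons v w h S ih =>
    have hLS := (isLocalSep_iff hG).1 h
    by_cases hne : X = s(v, w)
    · exact .inl hne
    · obtain ⟨Y, hY⟩ := exists_isLift hG hLS hX hne
      exact .inr ⟨Y, hY, ih (hG.cut hLS) hH (uncrossed_of_isLift hG hLS hX hne hY)⟩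

end LenGraph

theorem mainTheorem3 {V : Type u} [Finite V] (G : SimpleGraph V) (r : ℕ∞)
    (hG : (LenGraph.ofSimple G).LocallyTwoConnected r) :
    (∀ L : List (Sym2 (LenGraph.ofSimple G).V), L.Nodup →
      (∀ X, X ∈ L ↔ X ∈ (LenGraph.ofSimple G).uncrossed r) →
      (∃ G' : LenGraph.{u}, LenGraph.CutsAlong r (LenGraph.ofSimple G) L G') ∧
      ∀ G' : LenGraph.{u}, LenGraph.CutsAlong r (LenGraph.ofSimple G) L G' →
        G'.BasicComponents r) ∧
    (∀ (G'' : LenGraph.{u}) (S : LenGraph.CutSeq r (LenGraph.ofSimple G) G''),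
      G''.BasicComponents r →
      ∀ X ∈ (LenGraph.ofSimple G).uncrossed r, S.CutsAt X) := by
  have hgood := LenGraph.good_ofSimple G hG
  exact ⟨fun L h1 h2 => LenGraph.cutsAlong _ _ L rfl hgood ⟨h1, h2⟩,
    fun _ S hS _ hX => S.cutsAt hgood hS hX⟩
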